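/- **Theorem.** There is an algorithm (a random access machine program with unit-cost instructions: constants, addition, truncated subtraction, halving, indirect memory access, comparison, output) that, given a Boolean circuit $C$ and a tree decomposition $T$ of $C$, computes a d-SDNNF $D$ equivalent to $C$ together with a v-tree of $D$, and whose running time is $O(|T|\cdot 2^{(4+\epsilon)k})$ for every $\epsilon>0$, where $|T|$ is the number of nodes of $T$ and $k$ is the width of $T$; that is, for every $\epsilon>0$ there is a constant $K_\epsilon$ such that on all inputs $(C,T)$ the algorithm halts after at most $K_\epsilon\cdot|T|\cdot 2^{(4+\epsilon)k}$ steps. Here a *Boolean circuit* is a finite directed acyclic graph whose vertices (*gates*) are variable gates (with no inputs), NOT-gates (with exactly one input), OR-gates or AND-gates (with arbitrarily many inputs, possibly none), with a distinguished output gate. A *tree decomposition* of $C$ is a rooted tree whose nodes are labelled by sets of gates (*bags*), such that the two ends of every wire lie in a common bag and, for each gate, the nodes whose bags contain it form a nonempty connected subtree; its *width* is the maximal size of a bag minus $1$. Two circuits are *equivalent* if they have the same variable gates and capture the same Boolean function of them. For a gate $g$, let $\mathsf{Vars}(g)$ be the set of variable gates with a (possibly trivial) directed path to $g$. A *v-tree*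 over a finite set $V$ is a rooted ordered tree, in which every node has at most two children, and whose leaves are in bijection with $V$ (for $V=\emptyset$, it is the empty tree). It *structures* a circuit $D$ (is a v-tree of $D$) if it is over the set of variable gates of $D$ and if, for every AND-gate of $D$ with inputs $g_1,\dots,g_m$, $m>0$ (in some order), it has a node with exactly $m$ children $n_1,\dots,n_m$ such that all elements of $\mathsf{Vars}(g_i)$ are leaves of the subtree rooted at $n_i$, for $1\le i\le m$. A *d-SDNNF* is a circuit $D$ such that the inputs of NOT-gates are variable gates, distinct inputs $g_1\neq g_2$ of an AND-gate satisfy $\mathsf{Vars}(g_1)\cap\mathsf{Vars}(g_2)=\emptyset$, no two distinct inputs of an OR-gate evaluate to $1$ under a common valuation of the variables, and some v-tree structures $D$. -/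

import Mathlib

namespace KC

/-! ### Boolean circuits -/

/-- The four types of gates. -/
inductive GateKind where
  | var | not | or | and
  deriving DecidableEq

/-- A Boolean circuit: a finite directed acyclic graph whose vertices (the gates, named by natural
numbers) are typed, with a distinguished output gate. `(h, g) ∈ wires` says that `h` is an input of
`g`. AND- and OR-gates may have any fan-in, including zero. The value of `kind` outside `gates` is
irrelevant. -/
structure Circuit where
  gates : Finset ℕ
  wires : Finset (ℕ × ℕ)
  output : ℕ
  kind : ℕ → GateKind
  output_mem : output ∈ gates
  wires_mem : ∀ h g, (h, g) ∈ wires → h ∈ gates ∧ g ∈ gates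
  acyclic : ∀ g, ¬ Relation.TransGen (fun a b => (a, b) ∈ wires) g g
  not_fanin : ∀ g ∈ gates, kind g = .not → (wires.filter (fun w => w.2 = g)).card = 1
  var_fanin : ∀ g ∈ gates, kind g = .var → (wires.filter (fun w => w.2 = g)).card = 0

namespace Circuit

/-- The wire relation. -/
def Wire (C : Circuit) (h g : ℕ) : Prop := (h, g) ∈ C.wires

/-- The inputs of a gate. -/
def inputs (C : Circuit) (g : ℕ) : Finset ℕ := C.gates.filter (fun h => (h, g) ∈ C.wires)

/-- The variable gates of the circuit. -/
def vars (C : Circuit) : Finset ℕ := C.gates.filter (fun g => C.kind g = .var)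

/-- A finite acyclic graph is well founded, so gates can be evaluated recursively. -/
theorem wire_wf (C : Circuit) : WellFounded C.Wire := by
  have hfin : (↑C.gates : Set ℕ).Finite := C.gates.finite_toSet
  let R : C.gates → C.gates → Prop := fun a b => Relation.TransGen C.Wire a.1 b.1
  have : Std.Irrefl R := ⟨fun a h => C.acyclic a.1 h⟩
  have : IsTrans C.gates R := ⟨fun a b c h₁ h₂ => Relation.TransGen.trans h₁ h₂⟩
  have hR : WellFounded R := Finite.wellFounded_of_trans_of_irrefl R
  have key : ∀ a : C.gates, Acc C.Wire a.1 := by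
    intro a
    induction a using hR.induction with
    | _ a ih =>
      refine ⟨_, fun b hb => ?_⟩
      exact ih ⟨b, (C.wires_mem b a.1 hb).1⟩ (Relation.TransGen.single hb)
  refine ⟨fun g => ⟨_, fun b hb => ?_⟩⟩
  exact key ⟨b, (C.wires_mem b g hb).1⟩

open Classical in
/-- The evaluation of the circuit that extends the valuation `ν` of its variable gates (the values
of `ν` elsewhere are never used for a gate). -/
noncomputable def eval (C : Circuit) (ν : ℕ → Bool) : ℕ → Bool :=
  C.wire_wf.fix fun g rec =>
    match C.kind g with
    | .var => ν g
    | .not => decide (∃ h, ∃ hw : C.Wire h g, rec h hw = false)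
    | .or => decide (∃ h, ∃ hw : C.Wire h g, rec h hw = true)
    | .and => decide (∀ h, ∀ hw : C.Wire h g, rec h hw = true)

open Classical in
theorem eval_eq (C : Circuit) (ν : ℕ → Bool) (g : ℕ) :
    C.eval ν g = match C.kind g with
      | .var => ν g
      | .not => decide (∃ h, ∃ _ : C.Wire h g, C.eval ν h = false)
      | .or => decide (∃ h, ∃ _ : C.Wire h g, C.eval ν h = true)
      | .and => decide (∀ h, ∀ _ : C.Wire h g, C.eval ν h = true) := by
  unfold eval
  exact C.wire_wf.fix_eq _ g

/-- Two circuits are equivalent if they have the same variable gates and capture the same Boolean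
function of these. -/
def Equivalent (C D : Circuit) : Prop :=
  C.vars = D.vars ∧ ∀ ν : ℕ → Bool, C.eval ν C.output = D.eval ν D.output

open Classical in
/-- The variable gates that have a directed (possibly trivial) path to `g`. -/
noncomputable def varsBelow (C : Circuit) (g : ℕ) : Finset ℕ :=
  C.vars.filter (fun v => Relation.ReflTransGen C.Wire v g)

/-- Negation normal form. -/
def IsNNF (C : Circuit) : Prop :=
  ∀ g ∈ C.gates, C.kind g = .not → ∀ h ∈ C.inputs g, C.kind h = .var

/-- Every AND-gate is decomposable. -/
def IsDecomposable (C : Circuit) : Prop :=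
  ∀ g ∈ C.gates, C.kind g = .and → ∀ h₁ ∈ C.inputs g, ∀ h₂ ∈ C.inputs g, h₁ ≠ h₂ →
    Disjoint (C.varsBelow h₁) (C.varsBelow h₂)

/-- Every OR-gate is deterministic. -/
def IsDeterministic (C : Circuit) : Prop :=
  ∀ g ∈ C.gates, C.kind g = .or → ∀ h₁ ∈ C.inputs g, ∀ h₂ ∈ C.inputs g, h₁ ≠ h₂ →
    ∀ ν : ℕ → Bool, ¬ (C.eval ν h₁ = true ∧ C.eval ν h₂ = true)

end Circuit

/-! ### v-trees -/

/-- Nonempty rooted ordered binary trees (each node has at most two children) with leaves labelled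
by gate names. A node is identified with the subtree rooted at it. -/
inductive BinTree where
  | leaf (v : ℕ)
  | one (t : BinTree)
  | two (l r : BinTree)

namespace BinTree

/-- The labels of the leaves, from left to right. -/
def leaves : BinTree → List ℕ
  | leaf v => [v]
  | one t => t.leaves
  | two l r => l.leaves ++ r.leaves

/-- The subtrees rooted at the children of the root. -/
def children : BinTree → List BinTree
  | leaf _ => []
  | one t => [t]
  | two l r => [l, r]

/-- The subtrees rooted at all the nodes. -/
def subtrees : BinTree → List BinTree
  | leaf v => [leaf v]
  | one t => one t :: t.subtrees
  | two l r => two l r :: (l.subtrees ++ r.subtrees)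

/-- Preorder serialization. -/
def code : BinTree → List ℕ
  | leaf v => [1, v]
  | one t => 2 :: t.code
  | two l r => 3 :: (l.code ++ r.code)

end BinTree

/-- A rooted ordered binary tree, possibly empty (the empty tree is the only one without leaves, so
it is the v-tree over the empty set). -/
abbrev VTree := Option BinTree

namespace VTree

def leaves : VTree → List ℕ
  | none => []
  | some t => t.leaves

def subtrees : VTree → List BinTree
  | none => []
  | some t => t.subtrees

def code : VTree → List ℕ
  | none => [0]
  | some t => t.code

/-- The leaves of `T` are in bijection with `V`. -/
def IsOver (T : VTree) (V : Finset ℕ) : Prop := T.leaves.Nodup ∧ T.leaves.toFinset = V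

/-- `T` structures `C`: it is a v-tree over the variables of `C`, and for every AND-gate with
inputs `h₁, …, hₘ`, `m > 0`, there is a node of `T` with `m` children such that the variables
below `hᵢ` are leaves of the subtree rooted at the `i`-th child. -/
def Structures (T : VTree) (C : Circuit) : Prop :=
  T.IsOver C.vars ∧
  ∀ g ∈ C.gates, C.kind g = .and → (C.inputs g).Nonempty →
    ∃ n ∈ T.subtrees, ∃ hs : List ℕ, hs.Nodup ∧ hs.toFinset = C.inputs g ∧
      List.Forall₂ (fun h (c : BinTree) => C.varsBelow h ⊆ c.leaves.toFinset) hs n.children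

end VTree

/-- Deterministic structured decomposable negation normal form. -/
def Circuit.IsDSDNNF (C : Circuit) : Prop :=
  C.IsNNF ∧ C.IsDecomposable ∧ C.IsDeterministic ∧ ∃ T : VTree, T.Structures C

/-! ### Tree decompositions -/

/-- A tree decomposition of the underlying undirected graph of a circuit. The nodes of the rooted
tree are numbered in an arbitrary order; the tree is given by the parent of each node, where by
convention the root is its own parent. -/
structure TreeDecomposition (C : Circuit) where
  size : ℕ
  root : Fin size
  parent : Fin size → Fin size
  parent_root : parent root = root
  reaches_root : ∀ b, ∃ j : ℕ, parent^[j] b = root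
  bag : Fin size → Finset ℕ
  bag_subset : ∀ b, bag b ⊆ C.gates
  edge_covered : ∀ h g, (h, g) ∈ C.wires → ∃ b, h ∈ bag b ∧ g ∈ bag b
  /-- The nodes whose bag contains a given gate form a (nonempty) connected subtree. -/
  connected : ∀ g ∈ C.gates,
    ((SimpleGraph.fromRel (fun b b' => parent b = b')).induce {b | g ∈ bag b}).Connected

/-- The maximal size of a bag, minus one. (Some bag is nonempty, since it contains the output gate,
so that the subtraction is not truncated.) -/
def TreeDecomposition.width {C : Circuit} (T : TreeDecomposition C) : ℕ :=
  (Finset.univ.sup fun b => (T.bag b).card) - 1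

/-! ### Random access machines -/

/-- Memory of a random access machine: registers, arrays, and a write-only output tape. The indices
of the registers and arrays that are used are constants of the program. -/
structure State where
  reg : ℕ → ℕ
  mem : ℕ → ℕ → ℕ
  out : List ℕ

/-- Elementary instructions. There is no multiplication, so that numbers grow by at most one bit
per step, as usual under the uniform cost criterion. -/
inductive Instr where
  /-- `x := c` -/
  | const (x c : ℕ)
  /-- `x := y + z` -/
  | add (x y z : ℕ)
  /-- `x := max (y - z) 0` -/
  | sub (x y z : ℕ)
  /-- `x := ⌊y / 2⌋` -/
  | half (x y : ℕ)
  /-- `x := A[y]`, for the array `A` of index `a` -/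
  | load (x a y : ℕ)
  /-- `A[x] := y`, for the array `A` of index `a` -/
  | store (a x y : ℕ)
  /-- append `x` to the output tape -/
  | write (x : ℕ)

/-- Effect of an instruction. -/
def Instr.exec (s : State) : Instr → State
  | const x c => { s with reg := Function.update s.reg x c }
  | add x y z => { s with reg := Function.update s.reg x (s.reg y + s.reg z) }
  | sub x y z => { s with reg := Function.update s.reg x (s.reg y - s.reg z) }
  | half x y => { s with reg := Function.update s.reg x (s.reg y / 2) }
  | load x a y => { s with reg := Function.update s.reg x (s.mem a (s.reg y)) }
  | store a x y =>
      { s with mem := Function.update s.mem a (Function.update (s.mem a) (s.reg x) (s.reg y)) }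
  | write x => { s with out := s.out ++ [s.reg x] }

/-- Programs: instructions combined by sequencing, branching and loops, whose conditions compare
two registers. -/
inductive Program where
  | skip
  | instr (i : Instr)
  | seq (p q : Program)
  | ifLt (x y : ℕ) (p q : Program)
  | whileLt (x y : ℕ) (p : Program)

/-- `Runs p s t s'`: the program `p`, started in the state `s`, halts after `t` steps in the state
`s'`. Every instruction and every test of a condition is one step. -/
inductive Runs : Program → State → ℕ → State → Prop where
  | skip (s : State) : Runs .skip s 0 s
  | instr (i : Instr) (s : State) : Runs (.instr i) s 1 (i.exec s)
  | seq {p q : Program} {s s' s'' : State} {t t' : ℕ} :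
      Runs p s t s' → Runs q s' t' s'' → Runs (.seq p q) s (t + t') s''
  | ifTrue {x y : ℕ} {p q : Program} {s s' : State} {t : ℕ} :
      s.reg x < s.reg y → Runs p s t s' → Runs (.ifLt x y p q) s (t + 1) s'
  | ifFalse {x y : ℕ} {p q : Program} {s s' : State} {t : ℕ} :
      ¬ s.reg x < s.reg y → Runs q s t s' → Runs (.ifLt x y p q) s (t + 1) s'
  | whileTrue {x y : ℕ} {p : Program} {s s' s'' : State} {t t' : ℕ} :
      s.reg x < s.reg y → Runs p s t s' → Runs (.whileLt x y p) s' t' s'' →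
      Runs (.whileLt x y p) s (t + t' + 1) s''
  | whileFalse {x y : ℕ} {p : Program} {s : State} :
      ¬ s.reg x < s.reg y → Runs (.whileLt x y p) s 1 s

/-- The initial state: array `0` holds the input, everything else is zero. -/
def State.initial (input : List ℕ) : State where
  reg := fun _ => 0
  mem := fun a i => if a = 0 then input.getD i 0 else 0
  out := []

/-- The program `p` on input `input` halts within `t` steps with output `output`. -/
def Computes (p : Program) (input : List ℕ) (t : ℕ) (output : List ℕ) : Prop :=
  ∃ t' ≤ t, ∃ s, Runs p (State.initial input) t' s ∧ s.out = output

/-! ### Representation of the input and of the output -/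

def GateKind.code : GateKind → ℕ
  | var => 0
  | not => 1
  | or => 2
  | and => 3

/-- `l` represents `C`: the number of gates, the number of wires, the output gate, the name and type
of each gate, and the two ends of each wire, gates and wires being listed in any order without
repetition. -/
def Circuit.RepresentedBy (C : Circuit) (l : List ℕ) : Prop :=
  ∃ (gs : List ℕ) (ws : List (ℕ × ℕ)),
    gs.Nodup ∧ gs.toFinset = C.gates ∧ ws.Nodup ∧ ws.toFinset = C.wires ∧
    l = [gs.length, ws.length, C.output]
      ++ gs.flatMap (fun g => [g, (C.kind g).code]) ++ ws.flatMap (fun w => [w.1, w.2])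

/-- `l` represents `T`: the number of nodes, the root, the parent of each node, and for each node
the size of its bag followed by the elements of the bag in any order without repetition. -/
def TreeDecomposition.RepresentedBy {C : Circuit} (T : TreeDecomposition C) (l : List ℕ) : Prop :=
  ∃ bags : Fin T.size → List ℕ,
    (∀ b, (bags b).Nodup ∧ (bags b).toFinset = T.bag b) ∧
    l = [T.size, T.root.val] ++ (List.finRange T.size).map (fun b => (T.parent b).val)
      ++ (List.finRange T.size).flatMap (fun b => (bags b).length :: bags b)

end KC

/-!
A circuit evaluates to one under a valuation `ν` of its variables if and only if some valuation `μ` of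
all its gates extends `ν`, respects every gate, and gives one to the output gate; such a `μ` is unique
(`sol_eval`, `Sol.unique`). The program counts on this in a bottom-up dynamic programming over the tree
decomposition.

A state of a bag says for each gate of the bag which value it has and whether it is satisfied, that is,
whether its value is already justified by wires to gates seen so far: an OR-gate of value one needs one
input of value one, an AND-gate of value zero needs one input of value zero, and a NOT-gate needs its
input. All other conditions are local to a wire, so they are checked in the bags. This makes `4 ^ m`
states for a bag of `m` gates. For a connected part of the tree with top node `b`, `Holds` says which
states of the bag of `b` come from a partial valuation of the gates of the part. When the part of a
child is merged into the part of its parent, a state of the parent and a state of the child combine to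
at most one state (`IsJoin.unique`), and the function of the resulting state is the disjunction, over
the pairs that lead to it, of the conjunctions (`holds_union`). Different pairs exclude each other,
because the valuation of the gates of the part is determined by `ν` and the resulting state
(`join_unique`), so that the disjunction is deterministic. The two factors of a conjunction depend on
different variables, because each variable gets a leaf of its own (`NormalDec`), and all the AND-gates of
one merge belong to the same new node of the v-tree. Hence the gates of the tables form a d-SDNNF,
structured by the v-tree that records the merges (`Forest`, `Stage.absorb`). At the end the root, whose
bag is empty, has one state, and its gate computes the function of the circuit (`holds_root`).

A merge goes through all pairs of states, `16 ^ M` of them for bags of at most `M` gates, with `O(M)`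
steps for each. Together with the initialization this takes `O(|T| * M ^ 3 * 16 ^ M)` steps, where
`M = k + 1`, and the polynomial factor is absorbed by `2 ^ (ε * k)` (`exists_time_bound`).

The program is written in a small structured language (`Cmd`), in which the contents of memory are a
record, and which is compiled to the machine (`Cmd.runs_compile`); `Spec` bounds the running time of a
command together with its effect. Apart from the variable gates, which keep
their names, the gates of the output get names above all names of gates of the given circuit. They are
made in an order in which the inputs of a gate precede it (`Net.Ok`).
-/

set_option linter.constructorNameAsVariable false
set_option linter.unusedSimpArgs false

namespace KC

/-! ### A structured programming language -/

/-- The registers of the program. Those in use throughout are `nG`, `nW`, `oG` for the number of gates,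
the number of wires and the output gate of the given circuit, `n` and `nn` for the sink and the number
of nodes of the tree, `fr` for the next fresh name of a gate, `gl` and `wl` for the lengths of `go` and
`wo`, `tt` for the end of `tab`, and `nv` for the last node of the v-trees. -/
inductive Var where
  | nG | nW | oG | pos | fr | i | j | o | n | rt | tru | nn | tt | m | b | pw
  | x | y | t | g | h | k | wk | sg | ok | gl | wl | nv | qt | c | p | mc
  | bc | pp | pc | tp | tc | vp | vc | e | f | w | z | r | a | sk
  deriving DecidableEq

/-- The arrays of the program. The input is in `inp`.

Indexed by gates: `kd` has the type; `ix` and `off` give the position in the matrix `wm` of the wires;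
`va`, `sa` have the value plus one and the satisfaction in the current state of the bag of the parent,
`vb`, `sb` the same for the bag of the child; `seen` marks the variables that have a leaf.

Indexed by nodes of the tree: `par` is the parent; `sz` and `st` are the length of the bag and its
place in `inp`; `cnt` is the number of children that have not been processed; `tb` and `pw4` are the
place of the table in `tab` and its length; `vt` is the root of the v-tree. An entry of a table is the
successor of the name of a gate, or zero for a function that is constantly zero.

The nodes of the v-trees have their children in `vl` and `vr`; a leaf has zero in `vl` and its variable
in `vr`. The array `q` lists the nodes of the tree, `go` and `wo` collect the gates and wires of the
output, and `stk` is a stack. -/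
inductive Arr where
  | inp | kd | ix | off | wm | par | sz | st | cnt | tb | pw4 | tab | seen | vt | vl | vr
  | q | va | sa | vb | sb | go | wo | stk
  deriving DecidableEq

/-- The contents of all registers and arrays, and the output tape. With one field for each register
and array, an equation `s' = { s with … }` also says what a piece of code leaves untouched. -/
structure S where
  (nG nW oG pos fr i j o n rt tru nn tt m b pw : ℕ := 0)
  (x y t g h k wk sg ok gl wl nv qt c p mc : ℕ := 0)
  (bc pp pc tp tc vp vc e f w z r a sk : ℕ := 0)
  (inp kd ix off wm par sz st cnt tb pw4 tab seen vt vl vr : ℕ → ℕ := fun _ => 0)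
  (q va sa vb sb go wo stk : ℕ → ℕ := fun _ => 0)
  out : List ℕ := []

namespace S

/-- The contents of a register. -/
def get (s : S) : Var → ℕ
  | .nG => s.nG | .nW => s.nW | .oG => s.oG | .pos => s.pos | .fr => s.fr
  | .i => s.i | .j => s.j | .o => s.o | .n => s.n | .rt => s.rt
  | .tru => s.tru | .nn => s.nn | .tt => s.tt | .m => s.m | .b => s.b
  | .pw => s.pw | .x => s.x | .y => s.y | .t => s.t | .g => s.g
  | .h => s.h | .k => s.k | .wk => s.wk | .sg => s.sg | .ok => s.ok
  | .gl => s.gl | .wl => s.wl | .nv => s.nv | .qt => s.qt | .c => s.c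
  | .p => s.p | .mc => s.mc | .bc => s.bc | .pp => s.pp | .pc => s.pc
  | .tp => s.tp | .tc => s.tc | .vp => s.vp | .vc => s.vc | .e => s.e
  | .f => s.f | .w => s.w | .z => s.z | .r => s.r | .a => s.a
  | .sk => s.sk

/-- Writing a register. -/
def set (s : S) (n : ℕ) : Var → S
  | .nG => { s with nG := n } | .nW => { s with nW := n } | .oG => { s with oG := n }
  | .pos => { s with pos := n } | .fr => { s with fr := n } | .i => { s with i := n }
  | .j => { s with j := n } | .o => { s with o := n } | .n => { s with n := n }
  | .rt => { s with rt := n } | .tru => { s with tru := n } | .nn => { s with nn := n }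
  | .tt => { s with tt := n } | .m => { s with m := n } | .b => { s with b := n }
  | .pw => { s with pw := n } | .x => { s with x := n } | .y => { s with y := n }
  | .t => { s with t := n } | .g => { s with g := n } | .h => { s with h := n }
  | .k => { s with k := n } | .wk => { s with wk := n } | .sg => { s with sg := n }
  | .ok => { s with ok := n } | .gl => { s with gl := n } | .wl => { s with wl := n }
  | .nv => { s with nv := n } | .qt => { s with qt := n } | .c => { s with c := n }
  | .p => { s with p := n } | .mc => { s with mc := n } | .bc => { s with bc := n }
  | .pp => { s with pp := n } | .pc => { s with pc := n } | .tp => { s with tp := n }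
  | .tc => { s with tc := n } | .vp => { s with vp := n } | .vc => { s with vc := n }
  | .e => { s with e := n } | .f => { s with f := n } | .w => { s with w := n }
  | .z => { s with z := n } | .r => { s with r := n } | .a => { s with a := n }
  | .sk => { s with sk := n }

/-- The contents of an array. -/
def getA (s : S) : Arr → ℕ → ℕ
  | .inp => s.inp | .kd => s.kd | .ix => s.ix | .off => s.off | .wm => s.wm
  | .par => s.par | .sz => s.sz | .st => s.st | .cnt => s.cnt | .tb => s.tb
  | .pw4 => s.pw4 | .tab => s.tab | .seen => s.seen | .vt => s.vt | .vl => s.vl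
  | .vr => s.vr | .q => s.q | .va => s.va | .sa => s.sa | .vb => s.vb
  | .sb => s.sb | .go => s.go | .wo => s.wo | .stk => s.stk

/-- Writing an array. -/
def setA (s : S) (f : ℕ → ℕ) : Arr → S
  | .inp => { s with inp := f } | .kd => { s with kd := f } | .ix => { s with ix := f }
  | .off => { s with off := f } | .wm => { s with wm := f } | .par => { s with par := f }
  | .sz => { s with sz := f } | .st => { s with st := f } | .cnt => { s with cnt := f }
  | .tb => { s with tb := f } | .pw4 => { s with pw4 := f } | .tab => { s with tab := f }
  | .seen => { s with seen := f } | .vt => { s with vt := f } | .vl => { s with vl := f }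
  | .vr => { s with vr := f } | .q => { s with q := f } | .va => { s with va := f }
  | .sa => { s with sa := f } | .vb => { s with vb := f } | .sb => { s with sb := f }
  | .go => { s with go := f } | .wo => { s with wo := f } | .stk => { s with stk := f }

end S
namespace S

theorem get_set_self (s : S) (n : ℕ) (x : Var) : (s.set n x).get x = n := by
  cases x <;> rfl

theorem get_set_of_ne (s : S) (n : ℕ) {x y : Var} (h : y ≠ x) : (s.set n x).get y = s.get y := by
  cases x <;> cases y <;> first | rfl | exact absurd rfl h

theorem getA_set (s : S) (n : ℕ) (x : Var) : (s.set n x).getA = s.getA := by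
  cases x <;> rfl

theorem out_set (s : S) (n : ℕ) (x : Var) : (s.set n x).out = s.out := by
  cases x <;> rfl

theorem getA_setA_self (s : S) (f : ℕ → ℕ) (x : Arr) : (s.setA f x).getA x = f := by
  cases x <;> rfl

theorem getA_setA_of_ne (s : S) (f : ℕ → ℕ) {x y : Arr} (h : y ≠ x) :
    (s.setA f x).getA y = s.getA y := by
  cases x <;> cases y <;> first | rfl | exact absurd rfl h

theorem get_setA (s : S) (f : ℕ → ℕ) (x : Arr) : (s.setA f x).get = s.get := by
  cases x <;> rfl

theorem out_setA (s : S) (f : ℕ → ℕ) (x : Arr) : (s.setA f x).out = s.out := by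
  cases x <;> rfl

end S

/-- Arithmetic expressions; `ld a e` reads the array `a` at the index `e`, and `cnd e₁ e₂ a b` stands
for `a` if `e₁ < e₂`, and for `b` otherwise. -/
inductive Expr where
  | c (n : ℕ) | v (x : Var) | add (e₁ e₂ : Expr) | sub (e₁ e₂ : Expr) | half (e : Expr)
  | ld (a : Arr) (e : Expr) | cnd (e₁ e₂ a b : Expr)

/-- `x` if `a < b`, and `y` otherwise. -/
def sel {α : Type} (a b : ℕ) (x y : α) : α := if a < b then x else y

namespace Expr

instance : Add Expr := ⟨add⟩
instance : Sub Expr := ⟨sub⟩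
instance (n : ℕ) : OfNat Expr n := ⟨c n⟩

/-- The value of an expression. -/
def eval (s : S) : Expr → ℕ
  | c n => n
  | v x => s.get x
  | add e₁ e₂ => e₁.eval s + e₂.eval s
  | sub e₁ e₂ => e₁.eval s - e₂.eval s
  | half e => e.eval s / 2
  | ld a e => s.getA a (e.eval s)
  | cnd e₁ e₂ a b => sel (e₁.eval s) (e₂.eval s) (a.eval s) (b.eval s)

/-- A bound on the number of steps for the evaluation. -/
def cost : Expr → ℕ
  | c _ => 1
  | v _ => 1
  | add e₁ e₂ => e₁.cost + e₂.cost + 1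
  | sub e₁ e₂ => e₁.cost + e₂.cost + 1
  | half e => e.cost + 1
  | ld _ e => e.cost + 1
  | cnd e₁ e₂ a b => e₁.cost + e₂.cost + max a.cost b.cost + 1

theorem eval_add (s : S) (e₁ e₂ : Expr) : (e₁ + e₂).eval s = e₁.eval s + e₂.eval s := rfl
theorem eval_sub (s : S) (e₁ e₂ : Expr) : (e₁ - e₂).eval s = e₁.eval s - e₂.eval s := rfl
theorem eval_ofNat (s : S) (n : ℕ) : (OfNat.ofNat n : Expr).eval s = n := rfl

end Expr

/-- A structured language on top of the machine instructions. `ite e₁ e₂ a b` tests `e₁ < e₂`, and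
`rep e a` repeats `a` as often as the value of `e` before the loop says. -/
inductive Cmd where
  | skip
  | set (x : Var) (e : Expr)
  | sto (a : Arr) (e₁ e₂ : Expr)
  | wr (e : Expr)
  | seq (a b : Cmd)
  | ite (e₁ e₂ : Expr) (a b : Cmd)
  | rep (e : Expr) (a : Cmd)

infixr:60 " ;; " => Cmd.seq

namespace Cmd

/-- The effect of a command. -/
def den : Cmd → S → S
  | skip, s => s
  | set x e, s => s.set (e.eval s) x
  | sto a e₁ e₂, s => s.setA (Function.update (s.getA a) (e₁.eval s) (e₂.eval s)) a
  | wr e, s => { s with out := s.out ++ [e.eval s] }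
  | seq a b, s => den b (den a s)
  | ite e₁ e₂ a b, s => sel (e₁.eval s) (e₂.eval s) (den a s) (den b s)
  | rep e a, s => (den a)^[e.eval s] s

/-- A bound on the number of steps of a command. -/
def cost : Cmd → S → ℕ
  | skip, _ => 0
  | set _ e, _ => e.cost + 1
  | sto _ e₁ e₂, _ => e₁.cost + e₂.cost + 1
  | wr e, _ => e.cost + 1
  | seq a b, s => cost a s + cost b (den a s)
  | ite e₁ e₂ a b, s =>
      e₁.cost + e₂.cost + (if e₁.eval s < e₂.eval s then cost a s else cost b s) + 1
  | rep e a, s => e.cost + (∑ k ∈ Finset.range (e.eval s), (cost a ((den a)^[k] s) + 3)) + 1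

/-- Commands without loops. -/
def straight : Cmd → Bool
  | seq a b => straight a && straight b
  | ite _ _ a b => straight a && straight b
  | rep _ _ => false
  | _ => true

/-- A bound on the number of steps of a command without loops. -/
def scost : Cmd → ℕ
  | skip => 0
  | set _ e => e.cost + 1
  | sto _ e₁ e₂ => e₁.cost + e₂.cost + 1
  | wr e => e.cost + 1
  | seq a b => scost a + scost b
  | ite e₁ e₂ a b => e₁.cost + e₂.cost + max (scost a) (scost b) + 1
  | rep _ _ => 0

theorem cost_le_scost (a : Cmd) (h : a.straight = true) (s : S) : a.cost s ≤ a.scost := by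
  induction a generalizing s with
  | seq a b iha ihb =>
    simp only [straight, Bool.and_eq_true] at h
    exact Nat.add_le_add (iha h.1 _) (ihb h.2 _)
  | ite e₁ e₂ a b iha ihb =>
    simp only [straight, Bool.and_eq_true] at h
    have h₁ := iha h.1 s
    have h₂ := ihb h.2 s
    simp only [cost, scost]
    split_ifs <;> omega
  | rep e a => simp [straight] at h
  | _ => simp [cost, scost]

end Cmd

/-! ### Compilation -/

/-- The machine register that holds a register of the program. -/
def Var.idx (x : Var) : ℕ := x.ctorIdx

/-- The machine array that holds an array of the program. -/
def Arr.idx (a : Arr) : ℕ := a.ctorIdx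

theorem Var.idx_injective : Function.Injective Var.idx := fun x y h => by
  rw [← Var.ofNat_ctorIdx x, ← Var.ofNat_ctorIdx y]; exact congrArg _ h

theorem Arr.idx_injective : Function.Injective Arr.idx := fun x y h => by
  rw [← Arr.ofNat_ctorIdx x, ← Arr.ofNat_ctorIdx y]; exact congrArg _ h

theorem Var.idx_lt (x : Var) : x.idx < 99 := by cases x <;> decide

/-- Code that leaves the value of the expression in the register `100 + d`, and changes no register
below it. Register `99` always holds zero. -/
def Expr.compile : Expr → ℕ → Program
  | .c n, d => .instr (.const (100 + d) n)
  | .v x, d => .instr (.add (100 + d) x.idx 99)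
  | .add e₁ e₂, d => .seq (.seq (e₁.compile d) (e₂.compile (d + 1)))
      (.instr (.add (100 + d) (100 + d) (100 + (d + 1))))
  | .sub e₁ e₂, d => .seq (.seq (e₁.compile d) (e₂.compile (d + 1)))
      (.instr (.sub (100 + d) (100 + d) (100 + (d + 1))))
  | .half e, d => .seq (e.compile d) (.instr (.half (100 + d) (100 + d)))
  | .ld a e, d => .seq (e.compile d) (.instr (.load (100 + d) a.idx (100 + d)))
  | .cnd e₁ e₂ a b, d => .seq (.seq (e₁.compile d) (e₂.compile (d + 1)))
      (.ifLt (100 + d) (100 + (d + 1)) (a.compile d) (b.compile d))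

/-- Code for a command, which changes no register from `100` to `99 + d`. A loop keeps the number of
the remaining rounds in the register `100 + d`. -/
def Cmd.compile : Cmd → ℕ → Program
  | .skip, _ => .skip
  | .set x e, d => .seq (e.compile d) (.instr (.add x.idx (100 + d) 99))
  | .sto a e₁ e₂, d => .seq (.seq (e₁.compile d) (e₂.compile (d + 1)))
      (.instr (.store a.idx (100 + d) (100 + (d + 1))))
  | .wr e, d => .seq (e.compile d) (.instr (.write (100 + d)))
  | .seq a b, d => .seq (a.compile d) (b.compile d)
  | .ite e₁ e₂ a b, d => .seq (.seq (e₁.compile d) (e₂.compile (d + 1)))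
      (.ifLt (100 + d) (100 + (d + 1)) (a.compile d) (b.compile d))
  | .rep e a, d => .seq (e.compile d) (.whileLt 99 (100 + d)
      (.seq (a.compile (d + 1)) (.seq (.instr (.const (100 + (d + 1)) 1))
        (.instr (.sub (100 + d) (100 + d) (100 + (d + 1)))))))

/-- The machine state `σ` represents the contents `s` of the registers and arrays. -/
def Models (s : S) (σ : State) : Prop :=
  (∀ x : Var, σ.reg x.idx = s.get x) ∧ σ.reg 99 = 0 ∧ (∀ a : Arr, σ.mem a.idx = s.getA a) ∧
    σ.out = s.out

theorem Models.of_eq {s : S} {σ σ' : State} (h : Models s σ) (hr : ∀ i < 100, σ'.reg i = σ.reg i)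
    (hm : σ'.mem = σ.mem) (ho : σ'.out = σ.out) : Models s σ' := by
  refine ⟨fun x => ?_, ?_, fun a => ?_, ?_⟩
  · rw [hr _ (x.idx_lt.trans (by norm_num)), h.1]
  · rw [hr _ (by norm_num), h.2.1]
  · rw [hm, h.2.2.1]
  · rw [ho, h.2.2.2]

/-- The compiled expression leaves its value in a temporary register and keeps the registers below it,
the memory and the output. -/
theorem Expr.runs_compile (e : Expr) (d : ℕ) {s : S} {σ : State} (h : Models s σ) :
    ∃ t ≤ e.cost, ∃ σ', Runs (e.compile d) σ t σ' ∧ σ'.reg (100 + d) = e.eval s ∧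
      (∀ i < 100 + d, σ'.reg i = σ.reg i) ∧ σ'.mem = σ.mem ∧ σ'.out = σ.out := by
  have pair : ∀ e₁ e₂ : Expr,
      (∀ (d : ℕ) {σ : State}, Models s σ → ∃ t ≤ e₁.cost, ∃ σ', Runs (e₁.compile d) σ t σ' ∧
        σ'.reg (100 + d) = e₁.eval s ∧ (∀ i < 100 + d, σ'.reg i = σ.reg i) ∧
        σ'.mem = σ.mem ∧ σ'.out = σ.out) →
      (∀ (d : ℕ) {σ : State}, Models s σ → ∃ t ≤ e₂.cost, ∃ σ', Runs (e₂.compile d) σ t σ' ∧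
        σ'.reg (100 + d) = e₂.eval s ∧ (∀ i < 100 + d, σ'.reg i = σ.reg i) ∧
        σ'.mem = σ.mem ∧ σ'.out = σ.out) →
      ∀ (d : ℕ) {σ : State}, Models s σ → ∃ t ≤ e₁.cost + e₂.cost, ∃ σ',
        Runs (.seq (e₁.compile d) (e₂.compile (d + 1))) σ t σ' ∧
        σ'.reg (100 + d) = e₁.eval s ∧ σ'.reg (100 + (d + 1)) = e₂.eval s ∧
        (∀ i < 100 + d, σ'.reg i = σ.reg i) ∧ σ'.mem = σ.mem ∧ σ'.out = σ.out := by
    intro e₁ e₂ ih₁ ih₂ d σ h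
    obtain ⟨t₁, l₁, σ₁, r₁, v₁, k₁, m₁, o₁⟩ := ih₁ d h
    obtain ⟨t₂, l₂, σ₂, r₂, v₂, k₂, m₂, o₂⟩ :=
      ih₂ (d + 1) (h.of_eq (fun i hi => k₁ i (by omega)) m₁ o₁)
    exact ⟨_, Nat.add_le_add l₁ l₂, σ₂, r₁.seq r₂, by rw [k₂ _ (by omega), v₁], v₂,
      fun i hi => by rw [k₂ i (by omega), k₁ i hi], m₂.trans m₁, o₂.trans o₁⟩
  induction e generalizing d σ with
  | c n =>
    refine ⟨_, le_rfl, _, .instr _ _, ?_, fun i hi => ?_, rfl, rfl⟩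
    · simp [Instr.exec, eval]
    · simp [Instr.exec, hi.ne]
  | v x =>
    refine ⟨_, le_rfl, _, .instr _ _, ?_, fun i hi => ?_, rfl, rfl⟩
    · simp [Instr.exec, eval, h.1, h.2.1]
    · simp [Instr.exec, hi.ne]
  | add e₁ e₂ ih₁ ih₂ =>
    obtain ⟨t₁, l₁, σ₁, r₁, v₁, w₁, k₁, m₁, o₁⟩ := pair e₁ e₂ ih₁ ih₂ d h
    refine ⟨_, Nat.add_le_add_right l₁ 1, _, r₁.seq (.instr _ _), ?_, fun i hi => ?_, m₁, o₁⟩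
    · simp [Instr.exec, eval, v₁, w₁]
    · simp [Instr.exec, hi.ne, k₁ i hi]
  | sub e₁ e₂ ih₁ ih₂ =>
    obtain ⟨t₁, l₁, σ₁, r₁, v₁, w₁, k₁, m₁, o₁⟩ := pair e₁ e₂ ih₁ ih₂ d h
    refine ⟨_, Nat.add_le_add_right l₁ 1, _, r₁.seq (.instr _ _), ?_, fun i hi => ?_, m₁, o₁⟩
    · simp [Instr.exec, eval, v₁, w₁]
    · simp [Instr.exec, hi.ne, k₁ i hi]
  | half e ih =>
    obtain ⟨t₁, l₁, σ₁, r₁, v₁, k₁, m₁, o₁⟩ := ih d h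
    refine ⟨_, Nat.add_le_add_right l₁ 1, _, r₁.seq (.instr _ _), ?_, fun i hi => ?_, m₁, o₁⟩
    · simp [Instr.exec, eval, v₁]
    · simp [Instr.exec, hi.ne, k₁ i hi]
  | ld a e ih =>
    obtain ⟨t₁, l₁, σ₁, r₁, v₁, k₁, m₁, o₁⟩ := ih d h
    refine ⟨_, Nat.add_le_add_right l₁ 1, _, r₁.seq (.instr _ _), ?_, fun i hi => ?_, m₁, o₁⟩
    · simp [Instr.exec, eval, v₁, m₁, h.2.2.1]
    · simp [Instr.exec, hi.ne, k₁ i hi]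
  | cnd e₁ e₂ a b ih₁ ih₂ iha ihb =>
    obtain ⟨t₁, l₁, σ₁, r₁, v₁, w₁, k₁, m₁, o₁⟩ := pair e₁ e₂ ih₁ ih₂ d h
    have h₁ := h.of_eq (fun i hi => k₁ i (by omega)) m₁ o₁
    by_cases hlt : e₁.eval s < e₂.eval s
    · obtain ⟨t₂, l₂, σ₂, r₂, v₂, k₂, m₂, o₂⟩ := iha d h₁
      refine ⟨_, ?_, σ₂, r₁.seq (.ifTrue (by rw [v₁, w₁]; exact hlt) r₂), by simp [eval, sel, hlt, v₂],
        fun i hi => by rw [k₂ i hi, k₁ i hi], m₂.trans m₁, o₂.trans o₁⟩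
      simp only [cost]; omega
    · obtain ⟨t₂, l₂, σ₂, r₂, v₂, k₂, m₂, o₂⟩ := ihb d h₁
      refine ⟨_, ?_, σ₂, r₁.seq (.ifFalse (by rw [v₁, w₁]; exact hlt) r₂), by simp [eval, sel, hlt, v₂],
        fun i hi => by rw [k₂ i hi, k₁ i hi], m₂.trans m₁, o₂.trans o₁⟩
      simp only [cost]; omega

theorem Expr.runs_compile₂ (e₁ e₂ : Expr) (d : ℕ) {s : S} {σ : State} (h : Models s σ) :
    ∃ t ≤ e₁.cost + e₂.cost, ∃ σ', Runs (.seq (e₁.compile d) (e₂.compile (d + 1))) σ t σ' ∧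
      σ'.reg (100 + d) = e₁.eval s ∧ σ'.reg (100 + (d + 1)) = e₂.eval s ∧
      (∀ i < 100 + d, σ'.reg i = σ.reg i) ∧ σ'.mem = σ.mem ∧ σ'.out = σ.out := by
  obtain ⟨t₁, l₁, σ₁, r₁, v₁, k₁, m₁, o₁⟩ := e₁.runs_compile d h
  obtain ⟨t₂, l₂, σ₂, r₂, v₂, k₂, m₂, o₂⟩ :=
    e₂.runs_compile (d + 1) (h.of_eq (fun i hi => k₁ i (by omega)) m₁ o₁)
  exact ⟨_, Nat.add_le_add l₁ l₂, σ₂, r₁.seq r₂, by rw [k₂ _ (by omega), v₁], v₂,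
    fun i hi => by rw [k₂ i (by omega), k₁ i hi], m₂.trans m₁, o₂.trans o₁⟩

/-- The compiled command takes the memory of the machine to one that represents the denotation. -/
theorem Cmd.runs_compile (a : Cmd) (d : ℕ) {s : S} {σ : State} (h : Models s σ) :
    ∃ t ≤ a.cost s, ∃ σ', Runs (a.compile d) σ t σ' ∧ Models (a.den s) σ' ∧
      ∀ i < d, σ'.reg (100 + i) = σ.reg (100 + i) := by
  induction a generalizing d s σ with
  | skip => exact ⟨_, le_rfl, σ, .skip _, h, fun _ _ => rfl⟩
  | set x e =>
    obtain ⟨t₁, l₁, σ₁, r₁, v₁, k₁, m₁, o₁⟩ := e.runs_compile d h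
    have h₁ := h.of_eq (fun i hi => k₁ i (by omega)) m₁ o₁
    have hx := x.idx_lt
    refine ⟨_, Nat.add_le_add_right l₁ 1, _, r₁.seq (.instr _ _),
      ⟨fun y => ?_, ?_, fun b => ?_, ?_⟩, fun i hi => ?_⟩
    · by_cases hy : y = x
      · subst hy
        simp [Instr.exec, den, S.get_set_self, v₁, h₁.2.1]
      · have : y.idx ≠ x.idx := fun hh => hy (Var.idx_injective hh)
        simp [Instr.exec, den, S.get_set_of_ne _ _ hy, this, h₁.1]
    · simp [Instr.exec, hx.ne', h₁.2.1]
    · simp [Instr.exec, den, S.getA_set, h₁.2.2.1]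
    · simp [Instr.exec, den, S.out_set, h₁.2.2.2]
    · have : 100 + i ≠ x.idx := by omega
      simp [Instr.exec, this, k₁ (100 + i) (by omega)]
  | sto b e₁ e₂ =>
    obtain ⟨t₁, l₁, σ₁, r₁, v₁, w₁, k₁, m₁, o₁⟩ := Expr.runs_compile₂ e₁ e₂ d h
    have h₁ := h.of_eq (fun i hi => k₁ i (by omega)) m₁ o₁
    refine ⟨_, Nat.add_le_add_right l₁ 1, _, r₁.seq (.instr _ _),
      ⟨fun y => ?_, ?_, fun c => ?_, ?_⟩, fun i hi => ?_⟩
    · simp [Instr.exec, den, S.get_setA, h₁.1]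
    · simp [Instr.exec, h₁.2.1]
    · by_cases hc : c = b
      · subst hc
        simp [Instr.exec, den, S.getA_setA_self, v₁, w₁, h₁.2.2.1]
      · have : c.idx ≠ b.idx := fun hh => hc (Arr.idx_injective hh)
        simp [Instr.exec, den, S.getA_setA_of_ne _ _ hc, this, h₁.2.2.1]
    · simp [Instr.exec, den, S.out_setA, h₁.2.2.2]
    · simp [Instr.exec, k₁ (100 + i) (by omega)]
  | wr e =>
    obtain ⟨t₁, l₁, σ₁, r₁, v₁, k₁, m₁, o₁⟩ := e.runs_compile d h
    have h₁ := h.of_eq (fun i hi => k₁ i (by omega)) m₁ o₁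
    refine ⟨_, Nat.add_le_add_right l₁ 1, _, r₁.seq (.instr _ _), ⟨h₁.1, h₁.2.1, h₁.2.2.1, ?_⟩,
      fun i hi => k₁ (100 + i) (by omega)⟩
    simp [Instr.exec, den, v₁, h₁.2.2.2]
  | seq a b iha ihb =>
    obtain ⟨t₁, l₁, σ₁, r₁, h₁, k₁⟩ := iha d h
    obtain ⟨t₂, l₂, σ₂, r₂, h₂, k₂⟩ := ihb d h₁
    exact ⟨_, Nat.add_le_add l₁ l₂, σ₂, r₁.seq r₂, h₂, fun i hi => (k₂ i hi).trans (k₁ i hi)⟩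
  | ite e₁ e₂ a b iha ihb =>
    obtain ⟨t₁, l₁, σ₁, r₁, v₁, w₁, k₁, m₁, o₁⟩ := Expr.runs_compile₂ e₁ e₂ d h
    have h₁ := h.of_eq (fun i hi => k₁ i (by omega)) m₁ o₁
    by_cases hlt : e₁.eval s < e₂.eval s
    · obtain ⟨t₂, l₂, σ₂, r₂, h₂, k₂⟩ := iha d h₁
      refine ⟨_, ?_, σ₂, r₁.seq (.ifTrue (by rw [v₁, w₁]; exact hlt) r₂),
        by simpa [den, sel, hlt] using h₂, fun i hi => (k₂ i hi).trans (k₁ _ (by omega))⟩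
      simp only [cost, hlt, if_true]; omega
    · obtain ⟨t₂, l₂, σ₂, r₂, h₂, k₂⟩ := ihb d h₁
      refine ⟨_, ?_, σ₂, r₁.seq (.ifFalse (by rw [v₁, w₁]; exact hlt) r₂),
        by simpa [den, sel, hlt] using h₂, fun i hi => (k₂ i hi).trans (k₁ _ (by omega))⟩
      simp only [cost, hlt, if_false]; omega
  | rep e a ih =>
    obtain ⟨t₁, l₁, σ₁, r₁, v₁, k₁, m₁, o₁⟩ := e.runs_compile d h
    have h₁ := h.of_eq (fun i hi => k₁ i (by omega)) m₁ o₁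
    have key : ∀ (n : ℕ) (s : S) (σ : State), Models s σ → σ.reg (100 + d) = n →
        ∃ t ≤ (∑ k ∈ Finset.range n, (cost a ((den a)^[k] s) + 3)) + 1, ∃ σ',
          Runs (.whileLt 99 (100 + d) (.seq (a.compile (d + 1))
            (.seq (.instr (.const (100 + (d + 1)) 1))
              (.instr (.sub (100 + d) (100 + d) (100 + (d + 1))))))) σ t σ' ∧
          Models ((den a)^[n] s) σ' ∧ ∀ i < d, σ'.reg (100 + i) = σ.reg (100 + i) := by
      intro n
      induction n with
      | zero =>
        intro s σ hs hn
        exact ⟨1, by simp, σ, .whileFalse (by rw [hn, hs.2.1]; simp), hs, fun _ _ => rfl⟩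
      | succ n ihn =>
        intro s σ hs hn
        obtain ⟨t₂, l₂, σ₂, r₂, h₂, k₂⟩ := ih (d + 1) hs
        have r₃ := (r₂.seq ((Runs.instr (.const (100 + (d + 1)) 1) σ₂).seq
          (Runs.instr (.sub (100 + d) (100 + d) (100 + (d + 1))) _)))
        obtain ⟨t₄, l₄, σ₄, r₄, h₄, k₄⟩ := ihn (den a s) _ (h₂.of_eq
            (σ' := (Instr.sub (100 + d) (100 + d) (100 + (d + 1))).exec
              ((Instr.const (100 + (d + 1)) 1).exec σ₂)) (fun i hi => by
                simp only [Instr.exec]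
                rw [Function.update_of_ne (by omega), Function.update_of_ne (by omega)]) rfl rfl)
            (by simp [Instr.exec, k₂ d (by omega), hn])
        refine ⟨_, ?_, σ₄, .whileTrue (by rw [hs.2.1, hn]; omega) r₃ r₄, by simpa using h₄,
          fun i hi => ?_⟩
        · rw [Finset.sum_range_succ']
          simp only [Function.iterate_succ_apply, Function.iterate_zero, id]
          omega
        · rw [k₄ i hi]
          have h1 : 100 + i ≠ 100 + d := by omega
          have h2 : 100 + i ≠ 100 + (d + 1) := by omega
          simp only [Instr.exec]
          rw [Function.update_of_ne h1, Function.update_of_ne h2, k₂ i (by omega)]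
    obtain ⟨t₂, l₂, σ₂, r₂, h₂, k₂⟩ := key _ s σ₁ h₁ v₁
    refine ⟨_, ?_, σ₂, r₁.seq r₂, h₂, fun i hi => (k₂ i hi).trans (k₁ _ (by omega))⟩
    simp only [cost]
    omega

/-- The initial contents of registers and arrays. -/
def S.initial (l : List ℕ) : S := { inp := fun i => l.getD i 0 }

theorem models_initial (l : List ℕ) : Models (S.initial l) (State.initial l) := by
  refine ⟨fun x => by cases x <;> rfl, rfl, fun a => ?_, rfl⟩
  cases a <;> rfl

/-! ### Rules for the effect and the running time of commands -/

/-- Started in `s`, the command `a` takes at most `t` steps and leads to contents with `Q`. -/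
def Spec (a : Cmd) (s : S) (t : ℕ) (Q : S → Prop) : Prop := Q (a.den s) ∧ a.cost s ≤ t

theorem Spec.computes {a : Cmd} {l : List ℕ} {t : ℕ} {o : List ℕ}
    (h : Spec a (S.initial l) t fun s => s.out = o) : Computes (a.compile 0) l t o := by
  obtain ⟨t', ht, σ, r, m, _⟩ := a.runs_compile 0 (models_initial l)
  exact ⟨t', ht.trans h.2, σ, r, m.2.2.2.trans h.1⟩

theorem Spec.mono {a : Cmd} {s : S} {t t' : ℕ} {Q Q' : S → Prop} (h : Spec a s t Q)
    (hQ : ∀ s, Q s → Q' s) (ht : t ≤ t') : Spec a s t' Q' := ⟨hQ _ h.1, h.2.trans ht⟩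

theorem Spec.seq {a b : Cmd} {s : S} {t₁ t₂ : ℕ} {Q R : S → Prop} (h₁ : Spec a s t₁ R)
    (h₂ : ∀ s, R s → Spec b s t₂ Q) : Spec (a ;; b) s (t₁ + t₂) Q :=
  ⟨(h₂ _ h₁.1).1, Nat.add_le_add h₁.2 (h₂ _ h₁.1).2⟩

theorem Spec.straight {a : Cmd} {s : S} {Q : S → Prop} {t : ℕ} (ha : a.straight = true)
    (ht : a.scost ≤ t) (h : Q (a.den s)) : Spec a s t Q :=
  ⟨h, (a.cost_le_scost ha s).trans ht⟩

theorem Spec.ite {e₁ e₂ : Expr} {a b : Cmd} {s : S} {t : ℕ} {Q : S → Prop}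
    (h₁ : e₁.eval s < e₂.eval s → Spec a s t Q) (h₂ : ¬ e₁.eval s < e₂.eval s → Spec b s t Q) :
    Spec (.ite e₁ e₂ a b) s (e₁.cost + e₂.cost + t + 1) Q := by
  by_cases h : e₁.eval s < e₂.eval s
  · simpa [Spec, Cmd.den, sel, Cmd.cost, h] using h₁ h
  · simpa [Spec, Cmd.den, sel, Cmd.cost, h] using h₂ h

/-- The rule for loops, with an invariant that depends on the number of completed rounds. -/
theorem Spec.rep {e : Expr} {a : Cmd} {s : S} {t : ℕ} {Q : S → Prop} (I : ℕ → S → Prop) (n : ℕ)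
    (hn : e.eval s = n) (h₀ : I 0 s) (hs : ∀ i < n, ∀ s, I i s → Spec a s t (I (i + 1)))
    (hQ : ∀ s, I n s → Q s) : Spec (.rep e a) s (n * (t + 3) + e.cost + 1) Q := by
  subst hn
  have key : ∀ k ≤ e.eval s, I k ((a.den)^[k] s) ∧
      ∑ j ∈ Finset.range k, (a.cost ((a.den)^[j] s) + 3) ≤ k * (t + 3) := by
    intro k
    induction k with
    | zero => exact fun _ => ⟨h₀, by simp⟩
    | succ k ih =>
      intro hk
      obtain ⟨h1, h2⟩ := ih (by omega)
      obtain ⟨h3, h4⟩ := hs k (by omega) _ h1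
      refine ⟨by rwa [Function.iterate_succ_apply'], ?_⟩
      rw [Finset.sum_range_succ]
      linarith
  refine ⟨hQ _ (key _ le_rfl).1, ?_⟩
  have := (key _ le_rfl).2
  simp only [Cmd.cost]
  omega

/-! ### The program -/

section

open KC.Expr (v ld half cnd)

/-- Reading the header. -/
def readGates : Cmd :=
  .set .nG (ld .inp 0) ;; .set .nW (ld .inp 1) ;; .set .oG (ld .inp 2) ;; .set .pos 3 ;;
  .set .fr 1

/-- Reading the name and the type of a gate: the type goes to `kd`, and the sum `off h + ix g` gets
different values for different pairs `(h, g)` of gates. The register `fr` exceeds the names of all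
gates. -/
def readGate : Cmd :=
  .set .g (ld .inp (v .pos)) ;; .sto .kd (v .g) (ld .inp (v .pos + 1)) ;;
  .sto .ix (v .g) (v .i) ;; .sto .off (v .g) (v .o) ;; .set .fr (v .fr + v .g + 1) ;;
  .set .o (v .o + v .nG) ;; .set .i (v .i + 1) ;; .set .pos (v .pos + 2)

/-- Marking a wire in the matrix `wm`. -/
def readWire : Cmd :=
  .sto .wm (ld .off (ld .inp (v .pos)) + ld .ix (ld .inp (v .pos + 1))) 1 ;;
  .set .pos (v .pos + 2)

/-- Reading the number of nodes and the root of the tree. -/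
def readTree : Cmd :=
  .set .n (ld .inp (v .pos)) ;; .set .rt (ld .inp (v .pos + 1)) ;; .set .pos (v .pos + 2) ;;
  .set .i 0

def readParent : Cmd :=
  .sto .par (v .i) (ld .inp (v .pos)) ;; .set .i (v .i + 1) ;; .set .pos (v .pos + 1)

/-- The node `n` becomes the parent of the root and of itself. -/
def addSink : Cmd :=
  .sto .par (v .rt) (v .n) ;; .sto .par (v .n) (v .n) ;; .set .i 0

def readBag : Cmd :=
  .sto .sz (v .i) (ld .inp (v .pos)) ;; .sto .st (v .i) (v .pos + 1) ;;
  .set .pos (v .pos + 1 + ld .inp (v .pos)) ;; .set .i (v .i + 1)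

/-- Copying the input to the arrays; each bag stays where it is in `inp`. -/
def readInput : Cmd :=
  readGates ;; .rep (v .nG) readGate ;; .rep (v .nW) readWire ;; readTree ;;
  .rep (v .n) readParent ;; addSink ;; .rep (v .n) readBag

/-- Output of a gate of type `k` with the next fresh name. -/
def newGate (k : Expr) : Cmd :=
  .sto .go (v .gl) (v .fr) ;; .sto .go (v .gl + 1) k ;; .set .gl (v .gl + 2)

/-- Output of a wire from the gate `e` to the gate with the next fresh name. -/
def newWire (e : Expr) : Cmd :=
  .sto .wo (v .wl) e ;; .sto .wo (v .wl + 1) (v .fr) ;; .set .wl (v .wl + 2)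

/-- The next fresh name is used up; it is kept in `z`. -/
def useName : Cmd := .set .z (v .fr) ;; .set .fr (v .fr + 1)

/-- Storing two digits of the state `x` of the bag in `b`, `m` by the name of a gate: the array `va`
gets the value plus one, the array `sa` tells whether the gate is satisfied. -/
def decodeDigitA : Cmd :=
  .set .g (ld .inp (v .b + v .j)) ;; .set .h (half (v .t)) ;;
  .sto .va (v .g) (1 + (v .t - (v .h + v .h))) ;; .set .t (half (v .h)) ;;
  .sto .sa (v .g) (v .h - (v .t + v .t)) ;; .set .j (v .j + 1)

/-- The digits of the state `x` of the bag of the parent go to `va` and `sa`. -/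
def decodeA : Cmd := (.set .j 0 ;; .set .t (v .x)) ;; .rep (v .m) decodeDigitA

/-- The same for the state `y` of the bag in `bc`, `mc`, and the arrays `vb`, `sb`. -/
def decodeDigitB : Cmd :=
  .set .g (ld .inp (v .bc + v .j)) ;; .set .h (half (v .t)) ;;
  .sto .vb (v .g) (1 + (v .t - (v .h + v .h))) ;; .set .t (half (v .h)) ;;
  .sto .sb (v .g) (v .h - (v .t + v .t)) ;; .set .j (v .j + 1)

def decodeB : Cmd := (.set .j 0 ;; .set .t (v .y)) ;; .rep (v .mc) decodeDigitB

def clearGateA : Cmd :=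
  .set .g (ld .inp (v .b + v .j)) ;; .sto .va (v .g) 0 ;; .sto .sa (v .g) 0 ;; .set .j (v .j + 1)

/-- The arrays `va` and `sa` become zero again on the bag in `b`, `m`. -/
def clearA : Cmd := .set .j 0 ;; .rep (v .m) clearGateA

def clearGateB : Cmd :=
  .set .g (ld .inp (v .bc + v .j)) ;; .sto .vb (v .g) 0 ;; .sto .sb (v .g) 0 ;; .set .j (v .j + 1)

/-- The arrays `vb` and `sb` become zero again on the bag in `bc`, `mc`. -/
def clearB : Cmd := .set .j 0 ;; .rep (v .mc) clearGateB

/-- The start of the check of the gate `g` of the bag: `wk` tells whether its value is weak. -/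
def checkStart : Cmd :=
  .set .g (ld .inp (v .b + v .j)) ;; .set .k (ld .kd (v .g)) ;;
  .set .wk (cnd (v .k) 2 1
    (cnd (ld .va (v .g) + 1) (v .k) 0 (cnd (v .k) (ld .va (v .g) + 1) 0 1))) ;;
  .set .sg (v .wk) ;; .set .y 0

/-- The check of the pair of gates `h`, `g` of the bag. -/
def checkPair : Cmd :=
  .set .h (ld .inp (v .b + v .y)) ;;
  .set .w (ld .wm (ld .off (v .h) + ld .ix (v .g))) ;;
  .set .f (cnd (ld .va (v .h)) (ld .va (v .g)) 0 (cnd (ld .va (v .g)) (ld .va (v .h)) 0 1)) ;;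
  .set .sg (cnd 0 (v .w) (cnd 0 (v .f) 1 (v .sg)) (v .sg)) ;;
  .set .ok (cnd 0 (v .w) (cnd (v .k) 2 (cnd 0 (v .f) 0 (v .ok))
    (cnd 0 (v .f) (v .ok) (cnd 0 (v .wk) 0 (v .ok)))) (v .ok)) ;;
  .set .y (v .y + 1)

/-- The end of the check of the gate `g`: `sg` is what the satisfaction digit has to be, and the
output gate needs the value one. -/
def checkEnd : Cmd :=
  .set .ok (cnd (v .sg) (ld .sa (v .g)) 0 (cnd (ld .sa (v .g)) (v .sg) 0 (v .ok))) ;;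
  .set .ok (cnd (v .g) (v .oG) (v .ok) (cnd (v .oG) (v .g) (v .ok)
    (cnd (ld .va (v .g)) 2 0 (v .ok)))) ;;
  .set .j (v .j + 1)

def checkGate : Cmd := checkStart ;; .rep (v .m) checkPair ;; checkEnd

/-- Afterwards, `ok` tells whether the state `x` of the bag is locally consistent. -/
def checkState : Cmd := (.set .ok 1 ;; .set .j 0) ;; .rep (v .m) checkGate

/-- The entry for the state `x`: the constant gate if `x` is locally consistent, otherwise zero. -/
def initEntry : Cmd :=
  decodeA ;; checkState ;;
  (.sto .tab (v .tt + v .x) (cnd 0 (v .ok) (v .tru + 1) 0) ;; .set .x (v .x + 1))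

def initStart : Cmd :=
  .sto .tb (v .i) (v .tt) ;; .set .m (ld .sz (v .i)) ;; .set .b (ld .st (v .i)) ;; .set .pw 1

def initPow : Cmd := .set .pw (v .pw + v .pw + v .pw + v .pw)

/-- The table of the node `i`, which at this point does not depend on the variables. -/
def initNode : Cmd :=
  initStart ;; .rep (v .m) initPow ;; (.sto .pw4 (v .i) (v .pw) ;; .set .x 0) ;;
  .rep (v .pw) initEntry ;; clearA ;; (.set .tt (v .tt + v .pw) ;; .set .i (v .i + 1))

/-- The constant gate, and the tables of the nodes of the given tree and of the sink. -/
def initTables : Cmd :=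
  (newGate 3 ;; useName ;; .set .tru (v .z) ;; .set .i 0) ;; .rep (v .n + 1) initNode

/-- A new leaf of the tree for the variable gate `g`, attached to the node `i`. -/
def newLeaf : Cmd :=
  .sto .seen (v .g) 1 ;;
  .sto .go (v .gl) (v .g) ;; .sto .go (v .gl + 1) 0 ;; .set .gl (v .gl + 2) ;;
  newGate 1 ;; newWire (v .g) ;; useName ;;
  .sto .par (v .nn) (v .i) ;; .sto .sz (v .nn) 1 ;; .sto .st (v .nn) (v .b + v .j) ;;
  .sto .tb (v .nn) (v .tt) ;; .sto .pw4 (v .nn) 4 ;;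
  .sto .tab (v .tt + 2) (v .z + 1) ;; .sto .tab (v .tt + 3) (v .g + 1) ;; .set .tt (v .tt + 4) ;;
  .set .nv (v .nv + 1) ;; .sto .vl (v .nv) 0 ;; .sto .vr (v .nv) (v .g) ;;
  .sto .vt (v .nn) (v .nv) ;; .set .nn (v .nn + 1)

/-- A variable gate of the bag gets a leaf unless it has one already. -/
def leafGate : Cmd :=
  .set .g (ld .inp (v .b + v .j)) ;;
  .ite (ld .kd (v .g)) 1 (.ite (ld .seen (v .g)) 1 newLeaf .skip) .skip ;;
  .set .j (v .j + 1)

def leafNode : Cmd :=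
  (.set .m (ld .sz (v .i)) ;; .set .b (ld .st (v .i)) ;; .set .j 0) ;;
  .rep (v .m) leafGate ;; .set .i (v .i + 1)

/-- Leaves for all variable gates; their numbers as nodes of the tree start after the sink. -/
def addLeaves : Cmd := (.set .nn (v .n + 1) ;; .set .i 0) ;; .rep (v .n) leafNode

def countChild : Cmd :=
  .sto .cnt (ld .par (v .i)) (ld .cnt (ld .par (v .i)) + 1) ;; .set .i (v .i + 1)

/-- The node `i` enters the queue if it has no children: it is written to the end in any case, but the
end moves only then. -/
def queueLeaf : Cmd :=
  .sto .q (v .qt) (v .i) ;; .set .qt (cnd (ld .cnt (v .i)) 1 (v .qt + 1) (v .qt)) ;;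
  .set .i (v .i + 1)

/-- The next node of the queue is processed, and its parent enters the queue if this was its last
unprocessed child. -/
def queueNext : Cmd :=
  .set .p (ld .par (ld .q (v .i))) ;; .sto .cnt (v .p) (ld .cnt (v .p) - 1) ;;
  .sto .q (v .qt) (v .p) ;; .set .qt (cnd (ld .cnt (v .p)) 1 (v .qt + 1) (v .qt)) ;;
  .set .i (v .i + 1)

/-- The nodes except the sink are listed in `q`, children before their parents. -/
def sortNodes : Cmd :=
  .set .i 0 ;; .rep (v .nn) countChild ;; .set .i 0 ;; .rep (v .nn) queueLeaf ;;
  .set .i 0 ;; .rep (v .nn - 1) queueNext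

/-- Comparison of the two states at the gate `g` of the bag of the child. -/
def compatGate : Cmd :=
  .set .g (ld .inp (v .bc + v .j)) ;;
  .set .ok (cnd (ld .va (v .g)) 1 (cnd (ld .sb (v .g)) 1 0 (v .ok))
    (cnd (ld .va (v .g)) (ld .vb (v .g)) 0 (cnd (ld .vb (v .g)) (ld .va (v .g)) 0 (v .ok)))) ;;
  .set .j (v .j + 1)

/-- Afterwards, `ok` tells whether the state of the parent and the state of the child are compatible. -/
def compat : Cmd := (.set .ok 1 ;; .set .j 0) ;; .rep (v .mc) compatGate

/-- Two digits of the resulting state: the value is that of the parent, and a gate is satisfied if it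
is satisfied in one of the two states. -/
def encodeDigit : Cmd :=
  .set .g (ld .inp (v .b + v .j)) ;;
  .set .r (cnd 1 (ld .va (v .g)) (v .r + v .pw) (v .r)) ;; .set .pw (v .pw + v .pw) ;;
  .set .r (cnd 0 (ld .sa (v .g) + ld .sb (v .g)) (v .r + v .pw) (v .r)) ;;
  .set .pw (v .pw + v .pw) ;; .set .j (v .j + 1)

/-- The state of the bag of the parent that results from the two states goes to `r`. -/
def encode : Cmd := (.set .r 0 ;; .set .pw 1 ;; .set .j 0) ;; .rep (v .m) encodeDigit

/-- The gates for a pair of compatible states: the conjunction of the gates of the two tables, and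
its disjunction with the former gate of the resulting state. -/
def joinGates : Cmd :=
  .set .w (cnd 0 (v .vc) (v .f - 1) (v .e - 1)) ;;
  newGate 2 ;; newWire (v .w) ;; useName ;;
  .ite 0 (v .vp) (.ite 0 (v .vc)
    (newGate 3 ;; newWire (v .e - 1) ;; newWire (v .z) ;; useName) .skip) .skip ;;
  .set .w (ld .tab (v .tt + v .r)) ;;
  .ite 0 (v .w) (newGate 2 ;; newWire (v .w - 1) ;; newWire (v .z) ;; useName) .skip ;;
  .sto .tab (v .tt + v .r) (v .z + 1)

/-- The contribution of the pair of states `x`, `y`. -/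
def joinPair : Cmd :=
  .set .f (ld .tab (v .tc + v .y)) ;;
  .ite 0 (v .f) (decodeB ;; compat ;; .ite 0 (v .ok) (encode ;; joinGates) .skip) .skip ;;
  .set .y (v .y + 1)

/-- The contributions of the pairs with the state `x` of the parent. -/
def joinRow : Cmd :=
  .set .e (ld .tab (v .tp + v .x)) ;;
  .ite 0 (v .e) (decodeA ;; .set .y 0 ;; .rep (v .pc) joinPair) .skip ;;
  .set .x (v .x + 1)

def absorbStart : Cmd :=
  .set .c (ld .q (v .i)) ;; .set .p (ld .par (v .c)) ;;
  .set .m (ld .sz (v .p)) ;; .set .b (ld .st (v .p)) ;;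
  .set .mc (ld .sz (v .c)) ;; .set .bc (ld .st (v .c)) ;;
  .set .pp (ld .pw4 (v .p)) ;; .set .pc (ld .pw4 (v .c)) ;;
  .set .tp (ld .tb (v .p)) ;; .set .tc (ld .tb (v .c)) ;;
  .set .vp (ld .vt (v .p)) ;; .set .vc (ld .vt (v .c)) ;; .set .x 0

/-- The parent gets its new table. It gets a new node of the v-tree only if both v-trees are nonempty. -/
def absorbEnd : Cmd :=
  .sto .tb (v .p) (v .tt) ;; .set .tt (v .tt + v .pp) ;;
  .sto .vl (v .nv + 1) (v .vp) ;; .sto .vr (v .nv + 1) (v .vc) ;;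
  .sto .vt (v .p) (cnd 0 (v .vc) (cnd 0 (v .vp) (v .nv + 1) (v .vc)) (v .vp)) ;;
  .set .nv (cnd 0 (v .vc) (cnd 0 (v .vp) (v .nv + 1) (v .nv)) (v .nv)) ;;
  .set .i (v .i + 1)

/-- The node `q i` is merged into its parent. -/
def absorb : Cmd := absorbStart ;; .rep (v .pp) joinRow ;; clearA ;; clearB ;; absorbEnd

def absorbAll : Cmd := .set .i 0 ;; .rep (v .nn - 1) absorb

/-- The header of the output. If the only state of the sink has no gate, an OR-gate without inputs
becomes the output gate. -/
def finish : Cmd :=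
  .set .e (ld .tab (ld .tb (v .n))) ;;
  .ite 0 (v .e) .skip (newGate 2 ;; useName ;; .set .e (v .z + 1)) ;;
  .wr (half (v .gl)) ;; .wr (half (v .wl)) ;; .wr (v .e - 1) ;; .set .i 0 ;; .set .j 0 ;;
  .set .a (ld .vt (v .n))

def writeGates : Cmd := .wr (ld .go (v .i)) ;; .set .i (v .i + 1)

def writeWires : Cmd := .wr (ld .wo (v .j)) ;; .set .j (v .j + 1)

def startStack : Cmd :=
  .ite 0 (v .a) (.sto .stk 0 (v .a) ;; .set .sk 1) (.wr 0)

/-- One step of the preorder traversal of the v-tree. -/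
def writeNode : Cmd :=
  .ite 0 (v .sk)
    (.set .sk (v .sk - 1) ;; .set .a (ld .stk (v .sk)) ;;
      .ite 0 (ld .vl (v .a))
        (.wr 3 ;; .sto .stk (v .sk) (ld .vr (v .a)) ;;
          .sto .stk (v .sk + 1) (ld .vl (v .a)) ;; .set .sk (v .sk + 2))
        (.wr 1 ;; .wr (ld .vr (v .a)))) .skip

/-- Output of the circuit and its v-tree. A v-tree with `m` leaves has fewer than `2 * m` nodes, hence
`2 * nG` steps of the traversal are enough. -/
def output : Cmd :=
  finish ;; .rep (v .gl) writeGates ;; .rep (v .wl) writeWires ;; startStack ;;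
  .rep (v .nG + v .nG) writeNode

/-- The computation between input and output. -/
def translate : Cmd := initTables ;; addLeaves ;; sortNodes ;; absorbAll

def mainCmd : Cmd := readInput ;; translate ;; output

end

/-! ### Partial evaluations of a circuit -/

/-- The values that a gate may have without an input that is responsible for it. -/
def Weak : GateKind → Bool → Prop
  | .or, a => a = false
  | .and, a => a = true
  | _, _ => True

instance (k : GateKind) (a : Bool) : Decidable (Weak k a) := by
  cases k <;> simp only [Weak] <;> infer_instance

/-- The value `a` of a gate of type `k` tolerates an input with value `b`. -/
def Tolerates (k : GateKind) (a b : Bool) : Prop :=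
  if k = .not then b ≠ a else Weak k a → b = a

/-- A rooted tree decomposition with nodes `0, …, nn - 1`, given by their bags and parents, in a
normal form: the root `n` has an empty bag and is its own parent, the bags of the nodes above `n` are
the singletons of the variable gates, and the nodes below `n` cover all wires and gates. Connectedness
is expressed as an induction principle: a set that contains one node with the gate `g`, and is closed
under adjacency among such nodes, contains them all. -/
structure NormalDec (C : Circuit) (n nn : ℕ) (bag : ℕ → List ℕ) (par : ℕ → ℕ) : Prop where
  lt : n < nn
  par_lt : ∀ b < nn, par b < nn
  par_root : par n = n
  reach : ∀ b < nn, ∃ j, par^[j] b = n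
  nodup : ∀ b < nn, (bag b).Nodup
  sub : ∀ b < nn, ∀ g ∈ bag b, g ∈ C.gates
  bag_root : bag n = []
  leaf : ∀ b, n < b → b < nn → ∃ v ∈ C.vars, bag b = [v]
  exists_leaf : ∀ v ∈ C.vars, ∃ b, n < b ∧ b < nn ∧ bag b = [v]
  leaf_unique : ∀ b b' v, n < b → b < nn → n < b' → b' < nn → bag b = [v] → bag b' = [v] → b = b'
  wire : ∀ h g, C.Wire h g → ∃ b < n, h ∈ bag b ∧ g ∈ bag b
  gate : ∀ g ∈ C.gates, ∃ b < n, g ∈ bag b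
  conn : ∀ (g : ℕ) (X : Set ℕ),
    (∀ x < nn, g ∈ bag x → g ∈ bag (par x) → (x ∈ X ↔ par x ∈ X)) →
    ∀ x ∈ X, x < nn → g ∈ bag x → ∀ y < nn, g ∈ bag y → y ∈ X

section Solutions

variable (C : Circuit) (n : ℕ) (bag : ℕ → List ℕ)

/-- The constraints at the node `b` on a valuation `μ` of the gates, given the valuation `ν` of the
variables: the wires inside the bag are respected, and at a leaf of a variable, `μ` is `ν`. -/
def Loc (ν μ : ℕ → Bool) (b : ℕ) : Prop :=
  (b ≤ n → ∀ g ∈ bag b, ∀ h ∈ bag b, C.Wire h g → Tolerates (C.kind g) (μ g) (μ h)) ∧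
    (n < b → ∀ v ∈ bag b, μ v = ν v)

/-- The value of the gate `g` is weak, or there is an input responsible for it in a common bag of the
nodes in `X`. -/
def Satisfied (X : Set ℕ) (μ : ℕ → Bool) (g : ℕ) : Prop :=
  Weak (C.kind g) (μ g) ∨ ∃ x ∈ X, g ∈ bag x ∧ ∃ h ∈ bag x, C.Wire h g ∧ μ h = μ g

/-- `μ` meets the constraints at the nodes in `X`, and all gates there, except those in the bag of
`b`, are satisfied. -/
structure Sol (X : Set ℕ) (b : ℕ) (ν μ : ℕ → Bool) : Prop where
  loc : ∀ x ∈ X, Loc C n bag ν μ x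
  sat : ∀ x ∈ X, ∀ g ∈ bag x, g ∉ bag b → Satisfied C bag X μ g

/-- All nodes with a gate that occurs in `X`, but not in the bag of `b`, are in `X`. -/
def Separated (nn : ℕ) (X : Set ℕ) (b : ℕ) : Prop :=
  ∀ x ∈ X, ∀ g ∈ bag x, g ∉ bag b → ∀ y < nn, g ∈ bag y → y ∈ X

end Solutions

section

variable {C : Circuit} {n nn : ℕ} {bag : ℕ → List ℕ} {par : ℕ → ℕ}

theorem Satisfied.congr {X : Set ℕ} {μ μ' : ℕ → Bool} {g : ℕ}
    (h : ∀ x ∈ X, ∀ g ∈ bag x, μ g = μ' g) (hg : μ g = μ' g) (hs : Satisfied C bag X μ g) :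
    Satisfied C bag X μ' g := by
  rcases hs with hs | ⟨x, hx, hgx, h', hh', hw, he⟩
  · left; rwa [← hg]
  · exact .inr ⟨x, hx, hgx, h', hh', hw, by rw [← h x hx h' hh', he, hg]⟩

/-- Of the two values of an OR-gate or an AND-gate, exactly one is weak. -/
theorem weak_or_weak {k : GateKind} (hk : k = .or ∨ k = .and) {a b : Bool} (h : a ≠ b) :
    ¬ Weak k a ∧ Weak k b ∨ Weak k a ∧ ¬ Weak k b := by
  rcases hk with rfl | rfl <;> cases a <;> cases b <;> simp_all [Weak]

theorem exists_wire_of_not {g : ℕ} (hg : g ∈ C.gates) (hk : C.kind g = .not) :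
    ∃ h, C.Wire h g := by
  have := C.not_fanin g hg hk
  obtain ⟨w, hw⟩ := Finset.card_pos.mp (by omega : 0 < (C.wires.filter (fun w => w.2 = g)).card)
  rw [Finset.mem_filter] at hw
  exact ⟨w.1, by rw [Circuit.Wire, ← hw.2]; exact hw.1⟩

theorem wire_not_unique {g h h' : ℕ} (hk : C.kind g = .not) (hw : C.Wire h g) (hw' : C.Wire h' g) :
    h = h' := by
  have := C.not_fanin g (C.wires_mem _ _ hw).2 hk
  have h2 := Finset.card_le_one.mp this.le (h, g) (Finset.mem_filter.mpr ⟨hw, rfl⟩) (h', g)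
    (Finset.mem_filter.mpr ⟨hw', rfl⟩)
  exact congrArg Prod.fst h2

theorem not_wire_of_var {g h : ℕ} (hk : C.kind g = .var) : ¬ C.Wire h g := fun hw => by
  have := C.var_fanin g (C.wires_mem _ _ hw).2 hk
  rw [Finset.card_eq_zero] at this
  have h2 : (h, g) ∈ C.wires.filter (fun w => w.2 = g) := Finset.mem_filter.mpr ⟨hw, rfl⟩
  rw [this] at h2
  simp at h2

/-- Solutions are determined by their values in the bag of `b`: the other values are forced along the
wires of the circuit, all of which are seen by the nodes in `X`. -/
theorem Sol.unique (E : NormalDec C n nn bag par) {X : Set ℕ} {b : ℕ} (hX : ∀ x ∈ X, x < nn)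
    (hc : Separated bag nn X b) {ν μ μ' : ℕ → Bool} (h : Sol C n bag X b ν μ)
    (h' : Sol C n bag X b ν μ') (hb : ∀ g ∈ bag b, μ g = μ' g) :
    ∀ x ∈ X, ∀ g ∈ bag x, μ g = μ' g := by
  have key : ∀ g, ∀ x ∈ X, g ∈ bag x → μ g = μ' g := by
    intro g
    induction g using C.wire_wf.induction with
    | _ g ih =>
      intro x hx hgx
      by_cases hgb : g ∈ bag b
      · exact hb g hgb
      have hall := hc x hx g hgx hgb
      -- an input of a gate outside the bag of `b` shares a node of `X` with it
      have hwire : ∀ i, C.Wire i g → ∃ y ∈ X, y ≤ n ∧ i ∈ bag y ∧ g ∈ bag y := by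
        intro i hi
        obtain ⟨y, hy, hiy, hgy⟩ := E.wire i g hi
        exact ⟨y, hall y (hy.trans E.lt) hgy, hy.le, hiy, hgy⟩
      have hin : ∀ i, C.Wire i g → μ i = μ' i := by
        intro i hi
        obtain ⟨y, hy, _, hiy, _⟩ := hwire i hi
        exact ih i hi y hy hiy
      have htol : ∀ i, C.Wire i g →
          Tolerates (C.kind g) (μ g) (μ i) ∧ Tolerates (C.kind g) (μ' g) (μ' i) := by
        intro i hi
        obtain ⟨y, hy, hyn, hiy, hgy⟩ := hwire i hi
        exact ⟨(h.loc y hy).1 hyn g hgy i hiy hi, (h'.loc y hy).1 hyn g hgy i hiy hi⟩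
      have hg := E.sub x (hX x hx) g hgx
      have main : C.kind g = .or ∨ C.kind g = .and → μ g = μ' g := by
        intro hk
        by_contra hne
        have hnn : C.kind g ≠ .not := by rcases hk with hk | hk <;> simp [hk]
        simp only [Tolerates, hnn, if_false] at htol
        rcases weak_or_weak hk hne with ⟨h1, h2⟩ | ⟨h1, h2⟩
        · rcases h.sat x hx g hgx hgb with h3 | ⟨y, _, _, i, _, hi, he⟩
          · exact h1 h3
          · exact hne (by rw [← he, hin i hi, (htol i hi).2 h2])
        · rcases h'.sat x hx g hgx hgb with h3 | ⟨y, _, _, i, _, hi, he⟩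
          · exact h2 h3
          · exact hne (by rw [← he, ← hin i hi, (htol i hi).1 h1])
      cases hk : C.kind g with
      | var =>
        obtain ⟨y, hny, hy, hyb⟩ := E.exists_leaf g (by simp [Circuit.vars, hg, hk])
        have hgy : g ∈ bag y := by simp [hyb]
        have hyX := hall y hy hgy
        rw [(h.loc y hyX).2 hny g hgy, (h'.loc y hyX).2 hny g hgy]
      | not =>
        obtain ⟨i, hi⟩ := exists_wire_of_not hg hk
        have := htol i hi
        simp only [Tolerates, hk, if_true] at this
        have h3 := hin i hi
        revert this h3
        cases μ i <;> cases μ' i <;> cases μ g <;> cases μ' g <;> simp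
      | or => exact main (.inl hk)
      | and => exact main (.inr hk)
  exact fun x hx g hg => key g x hx hg

open Classical in
/-- The evaluation of the circuit is a solution. -/
theorem sol_eval (E : NormalDec C n nn bag par) (ν : ℕ → Bool) :
    Sol C n bag {x | x < nn} n ν (C.eval ν) := by
  refine ⟨fun x hx => ⟨fun _ g _ h _ hw => ?_, fun hnx v hv => ?_⟩, fun x hx g hg _ => ?_⟩
  · rw [C.eval_eq ν g]
    cases hk : C.kind g with
    | var => exact absurd hw (not_wire_of_var hk)
    | not =>
      have : (∃ i, ∃ _ : C.Wire i g, C.eval ν i = false) ↔ C.eval ν h = false :=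
        ⟨fun ⟨i, hi, he⟩ => by rwa [wire_not_unique hk hw hi], fun he => ⟨h, hw, he⟩⟩
      simp only [Tolerates, if_true, this]
      cases C.eval ν h <;> simp
    | or =>
      simp only [Tolerates, Weak, reduceCtorEq, if_false, decide_eq_false_iff_not]
      intro hn
      rw [decide_eq_false hn]
      by_contra hne
      exact hn ⟨h, hw, by simpa using hne⟩
    | and =>
      simp only [Tolerates, Weak, reduceCtorEq, if_false, decide_eq_true_eq]
      intro hn
      rw [decide_eq_true hn]
      exact hn h hw
  · obtain ⟨u, hu, hb⟩ := E.leaf x hnx hx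
    rw [hb, List.mem_singleton] at hv
    subst hv
    have hk : C.kind v = .var := (Finset.mem_filter.mp hu).2
    rw [C.eval_eq]
    simp [hk]
  · by_cases hwk : Weak (C.kind g) (C.eval ν g)
    · exact .inl hwk
    · have : ∃ h, C.Wire h g ∧ C.eval ν h = C.eval ν g := by
        revert hwk
        rw [C.eval_eq ν g]
        cases hk : C.kind g <;> simp [Weak]
        · intro h hw he
          refine ⟨h, hw, ?_⟩
          rw [he, eq_comm, decide_eq_true_eq]
          exact ⟨h, hw, he⟩
        · intro h hw he
          refine ⟨h, hw, ?_⟩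
          rw [he, eq_comm, decide_eq_false_iff_not]
          intro h'
          rw [h' h hw] at he
          simp at he
      obtain ⟨h, hw, he⟩ := this
      obtain ⟨y, hy, h1, h2⟩ := E.wire h g hw
      exact .inr ⟨y, hy.trans E.lt, h2, h, h1, hw, he⟩

end

/-! ### States of a bag -/

/-- The value of the gate `g` in the state `σ` of the bag `l`. -/
def valBit (l : List ℕ) (σ g : ℕ) : Bool := σ.testBit (2 * l.idxOf g)

/-- Whether the gate `g` is satisfied in the state `σ` of the bag `l`. -/
def satBit (l : List ℕ) (σ g : ℕ) : Bool := σ.testBit (2 * l.idxOf g + 1)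

theorem state_ext {l : List ℕ} (hl : l.Nodup) {σ τ : ℕ} (hσ : σ < 4 ^ l.length)
    (hτ : τ < 4 ^ l.length)
    (h : ∀ g ∈ l, valBit l σ g = valBit l τ g ∧ satBit l σ g = satBit l τ g) : σ = τ := by
  refine Nat.eq_of_testBit_eq fun i => ?_
  by_cases hi : i / 2 < l.length
  · have := h l[i / 2] (List.getElem_mem _)
    simp only [valBit, satBit, hl.idxOf_getElem] at this
    rcases Nat.mod_two_eq_zero_or_one i with h2 | h2
    · rw [show i = 2 * (i / 2) by omega]; exact this.1
    · rw [show i = 2 * (i / 2) + 1 by omega]; exact this.2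
  · have h4 : (4 : ℕ) ^ l.length ≤ 2 ^ i := by
      rw [show 4 = 2 ^ 2 by norm_num, ← pow_mul]
      exact Nat.pow_le_pow_right (by norm_num) (by omega)
    rw [Nat.testBit_lt_two_pow (hσ.trans_le h4), Nat.testBit_lt_two_pow (hτ.trans_le h4)]

open Classical in
theorem exists_state (l : List ℕ) (a : ℕ → Bool) (b : ℕ → Prop) :
    ∃ σ < 4 ^ l.length, ∀ g ∈ l, valBit l σ g = a g ∧ (satBit l σ g = true ↔ b g) := by
  have key : ∀ m, ∀ f : ℕ → Bool, ∃ σ < 2 ^ m, ∀ i < m, σ.testBit i = f i := by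
    intro m f
    refine ⟨Nat.ofBits fun i : Fin m => f i, Nat.ofBits_lt_two_pow _, fun i hi => ?_⟩
    rw [Nat.testBit_ofBits_lt _ _ hi]
  obtain ⟨σ, h1, h2⟩ := key (2 * l.length) fun i =>
    if i % 2 = 0 then a (l.getD (i / 2) 0) else decide (b (l.getD (i / 2) 0))
  refine ⟨σ, by rwa [show 4 = 2 ^ 2 by norm_num, ← pow_mul], fun g hg => ?_⟩
  have hi := List.idxOf_lt_length_of_mem hg
  have hD : l.getD (l.idxOf g) 0 = g := by
    rw [List.getD_eq_getElem _ _ hi, List.getElem_idxOf]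
  constructor
  · rw [valBit, h2 _ (by omega), if_pos (by omega), Nat.mul_div_cancel_left _ two_pos, hD]
  · rw [satBit, h2 _ (by omega), if_neg (by omega), decide_eq_true_eq,
      show (2 * l.idxOf g + 1) / 2 = l.idxOf g by omega, hD]

/-- The states `σ` and `τ` of the bags `l` and `l'` agree on the values of the common gates, and the
gates of `l'` that are not in `l` are satisfied. -/
def Compat (l l' : List ℕ) (σ τ : ℕ) : Prop :=
  ∀ g ∈ l', if g ∈ l then valBit l σ g = valBit l' τ g else satBit l' τ g = true

/-- `ρ` is the state of `l` obtained from `σ` by taking account of the gates satisfied in `τ`. -/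
def IsJoin (l l' : List ℕ) (σ τ ρ : ℕ) : Prop :=
  ρ < 4 ^ l.length ∧ ∀ g ∈ l, valBit l ρ g = valBit l σ g ∧
    (satBit l ρ g = true ↔ satBit l σ g = true ∨ g ∈ l' ∧ satBit l' τ g = true)

theorem IsJoin.unique {l l' : List ℕ} (hl : l.Nodup) {σ τ ρ ρ' : ℕ} (h : IsJoin l l' σ τ ρ)
    (h' : IsJoin l l' σ τ ρ') : ρ = ρ' :=
  state_ext hl h.1 h'.1 fun g hg => ⟨(h.2 g hg).1.trans (h'.2 g hg).1.symm,
    Bool.eq_iff_iff.mpr ((h.2 g hg).2.trans (h'.2 g hg).2.symm)⟩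

section Holds

variable (C : Circuit) (n : ℕ) (bag : ℕ → List ℕ)

/-- `μ` witnesses that the state `σ` of the bag of `b` is reached under the valuation `ν` of the
variables by the nodes in `X`. -/
structure Wit (X : Set ℕ) (b : ℕ) (ν : ℕ → Bool) (σ : ℕ) (μ : ℕ → Bool) : Prop where
  sol : Sol C n bag X b ν μ
  out : ∀ x ∈ X, x ≤ n → C.output ∈ bag x → μ C.output = true
  bits : ∀ g ∈ bag b, valBit (bag b) σ g = μ g ∧
    (satBit (bag b) σ g = true ↔ Satisfied C bag X μ g)

/-- The state `σ` of the bag of `b` is reached under the valuation `ν` by the nodes in `X`. -/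
def Holds (X : Set ℕ) (b : ℕ) (ν : ℕ → Bool) (σ : ℕ) : Prop :=
  σ < 4 ^ (bag b).length ∧ ∃ μ, Wit C n bag X b ν σ μ

end Holds

section

variable {C : Circuit} {n nn : ℕ} {bag : ℕ → List ℕ} {par : ℕ → ℕ}

theorem Wit.congr {X : Set ℕ} {b : ℕ} {ν : ℕ → Bool} {σ : ℕ} {μ μ' : ℕ → Bool} (hb : b ∈ X)
    (h : Wit C n bag X b ν σ μ) (he : ∀ x ∈ X, ∀ g ∈ bag x, μ g = μ' g) :
    Wit C n bag X b ν σ μ' := by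
  refine ⟨⟨fun x hx => ⟨fun hxn g hg i hi hw => ?_, fun hxn v hv => ?_⟩, fun x hx g hg hgb => ?_⟩,
    fun x hx hxn ho => ?_, fun g hg => ⟨?_, (h.bits g hg).2.trans ⟨fun hs => ?_, fun hs => ?_⟩⟩⟩
  · rw [← he x hx g hg, ← he x hx i hi]; exact (h.sol.loc x hx).1 hxn g hg i hi hw
  · rw [← he x hx v hv]; exact (h.sol.loc x hx).2 hxn v hv
  · exact (h.sol.sat x hx g hg hgb).congr he (he x hx g hg)
  · rw [← he x hx _ ho]; exact h.out x hx hxn ho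
  · rw [(h.bits g hg).1, he b hb g hg]
  · exact hs.congr he (he b hb g hg)
  · exact hs.congr (fun x hx g hg => (he x hx g hg).symm) (he b hb g hg).symm

/-- Common gates of the two sets of nodes are in both bags. -/
def Interface (bag : ℕ → List ℕ) (X Y : Set ℕ) (p c : ℕ) : Prop :=
  ∀ x ∈ X, ∀ y ∈ Y, ∀ g ∈ bag x, g ∈ bag y → g ∈ bag p ∧ g ∈ bag c

theorem Satisfied.union {X Y : Set ℕ} {μ : ℕ → Bool} {g : ℕ} :
    Satisfied C bag (X ∪ Y) μ g ↔ Satisfied C bag X μ g ∨ Satisfied C bag Y μ g := by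
  simp only [Satisfied, Set.mem_union, or_and_right, exists_or]
  by_cases h : Weak (C.kind g) (μ g) <;> simp [h]

/-- Away from the nodes of `Y`, only weak values are satisfied by `Y`. -/
theorem Satisfied.weak {Y : Set ℕ} {μ : ℕ → Bool} {g : ℕ} (h : Satisfied C bag Y μ g)
    (hg : ∀ y ∈ Y, g ∉ bag y) (X : Set ℕ) : Satisfied C bag X μ g := by
  rcases h with h | ⟨y, hy, hgy, _⟩
  · exact .inl h
  · exact absurd hgy (hg y hy)

/-- Two witnesses for states that can be joined are restrictions of a common one. -/
theorem Wit.glue {X Y : Set ℕ} {p c : ℕ} (hp : p ∈ X) (hc : c ∈ Y)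
    (hi : Interface bag X Y p c) {ν : ℕ → Bool} {σ τ ρ : ℕ} {μ₁ μ₂ : ℕ → Bool}
    (h₁ : Wit C n bag X p ν σ μ₁) (h₂ : Wit C n bag Y c ν τ μ₂)
    (hC : Compat (bag p) (bag c) σ τ) (hJ : IsJoin (bag p) (bag c) σ τ ρ) :
    ∃ μ, Wit C n bag (X ∪ Y) p ν ρ μ ∧ Wit C n bag X p ν σ μ ∧ Wit C n bag Y c ν τ μ := by
  classical
  let μ : ℕ → Bool := fun g => if ∃ x ∈ X, g ∈ bag x then μ₁ g else μ₂ g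
  have e₁ : ∀ x ∈ X, ∀ g ∈ bag x, μ₁ g = μ g := fun x hx g hg =>
    (if_pos (c := ∃ x ∈ X, g ∈ bag x) ⟨x, hx, hg⟩).symm
  have e₂ : ∀ y ∈ Y, ∀ g ∈ bag y, μ₂ g = μ g := by
    intro y hy g hg
    by_cases hx : ∃ x ∈ X, g ∈ bag x
    · obtain ⟨x, hx, hgx⟩ := hx
      obtain ⟨hgp, hgc⟩ := hi x hx y hy g hgx hg
      have := hC g hgc
      rw [if_pos hgp, (h₁.bits g hgp).1, (h₂.bits g hgc).1] at this
      rw [← this, e₁ x hx g hgx]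
    · exact (if_neg hx).symm
  have w₁ := h₁.congr hp e₁
  have w₂ := h₂.congr hc e₂
  refine ⟨μ, ⟨⟨?_, ?_⟩, ?_, ?_⟩, w₁, w₂⟩
  · rintro x (hx | hx)
    exacts [w₁.sol.loc x hx, w₂.sol.loc x hx]
  · rintro x (hx | hx) g hg hgp
    · exact Satisfied.union.mpr (.inl (w₁.sol.sat x hx g hg hgp))
    · by_cases hgc : g ∈ bag c
      · have := hC g hgc
        rw [if_neg hgp] at this
        exact Satisfied.union.mpr (.inr ((w₂.bits g hgc).2.mp this))
      · exact Satisfied.union.mpr (.inr (w₂.sol.sat x hx g hg hgc))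
  · rintro x (hx | hx)
    exacts [w₁.out x hx, w₂.out x hx]
  · intro g hg
    obtain ⟨h1, h2⟩ := hJ.2 g hg
    refine ⟨h1.trans (w₁.bits g hg).1, h2.trans ?_⟩
    rw [Satisfied.union, (w₁.bits g hg).2]
    by_cases hgc : g ∈ bag c
    · simp [hgc, (w₂.bits g hgc).2]
    · simp only [hgc, false_and, or_false]
      refine ⟨.inl, fun h => h.elim id fun h => h.weak (fun y hy hgy => ?_) X⟩
      exact hgc (hi p hp y hy g hg hgy).2

/-- The states of the union of two clusters are the joins of the states of the clusters. -/
theorem holds_union {X Y : Set ℕ} {p c : ℕ} (hp : p ∈ X) (hc : c ∈ Y)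
    (hi : Interface bag X Y p c) {ν : ℕ → Bool} {ρ : ℕ} :
    Holds C n bag (X ∪ Y) p ν ρ ↔ ∃ σ τ, Compat (bag p) (bag c) σ τ ∧
      IsJoin (bag p) (bag c) σ τ ρ ∧ Holds C n bag X p ν σ ∧ Holds C n bag Y c ν τ := by
  constructor
  · rintro ⟨hρ, μ, w⟩
    obtain ⟨σ, hσ, bσ⟩ := exists_state (bag p) μ (Satisfied C bag X μ)
    obtain ⟨τ, hτ, bτ⟩ := exists_state (bag c) μ (Satisfied C bag Y μ)
    have h₁ : ∀ g, (∀ y ∈ Y, g ∉ bag y) → Satisfied C bag (X ∪ Y) μ g →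
        Satisfied C bag X μ g :=
      fun g hg h => (Satisfied.union.mp h).elim id fun h => h.weak hg X
    have h₂ : ∀ g, (∀ x ∈ X, g ∉ bag x) → Satisfied C bag (X ∪ Y) μ g →
        Satisfied C bag Y μ g :=
      fun g hg h => (Satisfied.union.mp h).elim (fun h => h.weak hg Y) id
    refine ⟨σ, τ, fun g hg => ?_, ⟨hρ, fun g hg => ?_⟩, ⟨hσ, μ, ⟨⟨fun x hx => ?_, ?_⟩, ?_, bσ⟩⟩,
      ⟨hτ, μ, ⟨⟨fun x hx => ?_, ?_⟩, ?_, bτ⟩⟩⟩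
    · split_ifs with hgp
      · rw [(bσ g hgp).1, (bτ g hg).1]
      · exact (bτ g hg).2.mpr (h₂ g (fun x hx hgx => hgp (hi x hx c hc g hgx hg).1)
          (w.sol.sat c (.inr hc) g hg hgp))
    · refine ⟨(w.bits g hg).1.trans (bσ g hg).1.symm, ?_⟩
      rw [(w.bits g hg).2, Satisfied.union, (bσ g hg).2]
      by_cases hgc : g ∈ bag c
      · simp [hgc, (bτ g hgc).2]
      · simp only [hgc, false_and, or_false]
        refine ⟨fun h => h.elim id fun h => h.weak (fun y hy hgy => ?_) X, .inl⟩
        exact hgc (hi p hp y hy g hg hgy).2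
    · exact w.sol.loc x (.inl hx)
    · intro x hx g hg hgp
      refine h₁ g (fun y hy hgy => hgp (hi x hx y hy g hg hgy).1) (w.sol.sat x (.inl hx) g hg hgp)
    · exact fun x hx => w.out x (.inl hx)
    · exact w.sol.loc x (.inr hx)
    · intro y hy g hg hgc
      have hgX : ∀ x ∈ X, g ∉ bag x := fun x hx hgx => hgc (hi x hx y hy g hgx hg).2
      exact h₂ g hgX (w.sol.sat y (.inr hy) g hg (hgX p hp))
    · exact fun x hx => w.out x (.inr hx)
  · rintro ⟨σ, τ, hC, hJ, ⟨_, μ₁, w₁⟩, ⟨_, μ₂, w₂⟩⟩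
    obtain ⟨μ, w, _, _⟩ := w₁.glue hp hc hi w₂ hC hJ
    exact ⟨hJ.1, μ, w⟩

/-- Under a given valuation of the variables, each state of the union is reached in only one way. This
makes the disjunctions deterministic. -/
theorem join_unique (E : NormalDec C n nn bag par) {X Y : Set ℕ} (hX : ∀ x ∈ X ∪ Y, x < nn)
    {p c : ℕ} (hp : p ∈ X) (hc : c ∈ Y) (hi : Interface bag X Y p c)
    (hs : Separated bag nn (X ∪ Y) p) {ν : ℕ → Bool} {ρ σ τ σ' τ' : ℕ}
    (hC : Compat (bag p) (bag c) σ τ) (hJ : IsJoin (bag p) (bag c) σ τ ρ)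
    (h₁ : Holds C n bag X p ν σ) (h₂ : Holds C n bag Y c ν τ)
    (hC' : Compat (bag p) (bag c) σ' τ') (hJ' : IsJoin (bag p) (bag c) σ' τ' ρ)
    (h₁' : Holds C n bag X p ν σ') (h₂' : Holds C n bag Y c ν τ') : σ = σ' ∧ τ = τ' := by
  obtain ⟨l₁, μ₁, w₁⟩ := h₁
  obtain ⟨l₂, μ₂, w₂⟩ := h₂
  obtain ⟨l₁', μ₁', w₁'⟩ := h₁'
  obtain ⟨l₂', μ₂', w₂'⟩ := h₂'
  obtain ⟨μ, w, u₁, u₂⟩ := w₁.glue hp hc hi w₂ hC hJ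
  obtain ⟨μ', w', u₁', u₂'⟩ := w₁'.glue hp hc hi w₂' hC' hJ'
  have he := w.sol.unique E hX hs w'.sol fun g hg => by
    rw [← (w.bits g hg).1, ← (w'.bits g hg).1]
  have v₁ := u₁.congr hp fun x hx => he x (.inl hx)
  have v₂ := u₂.congr hc fun x hx => he x (.inr hx)
  constructor
  · refine state_ext (E.nodup p (hX p (.inl hp))) l₁ l₁' fun g hg => ⟨?_, ?_⟩
    · rw [(v₁.bits g hg).1, (u₁'.bits g hg).1]
    · rw [Bool.eq_iff_iff, (v₁.bits g hg).2, (u₁'.bits g hg).2]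
  · refine state_ext (E.nodup c (hX c (.inr hc))) l₂ l₂' fun g hg => ⟨?_, ?_⟩
    · rw [(v₂.bits g hg).1, (u₂'.bits g hg).1]
    · rw [Bool.eq_iff_iff, (v₂.bits g hg).2, (u₂'.bits g hg).2]

/-- For all nodes together, the only state of the empty bag of the root is reached when the circuit
evaluates to true. -/
theorem holds_root (E : NormalDec C n nn bag par) (ν : ℕ → Bool) :
    Holds C n bag {x | x < nn} n ν 0 ↔ C.eval ν C.output = true := by
  obtain ⟨b, hb, hob⟩ := E.gate _ C.output_mem
  constructor
  · rintro ⟨_, μ, w⟩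
    have := w.sol.unique E (fun _ h => h) (fun x _ g _ _ y hy _ => hy) (sol_eval E ν)
      (by simp [E.bag_root]) b (hb.trans E.lt) _ hob
    rw [← this]
    exact w.out b (hb.trans E.lt) hb.le hob
  · exact fun h => ⟨by positivity, _, sol_eval E ν, fun _ _ _ _ => h, by simp [E.bag_root]⟩

/-- The state `σ` of the bag of `b` is consistent with the wires inside the bag. -/
def LocallyOk (C : Circuit) (l : List ℕ) (σ : ℕ) : Prop :=
  ∀ g ∈ l, (∀ h ∈ l, C.Wire h g → Tolerates (C.kind g) (valBit l σ g) (valBit l σ h)) ∧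
    (satBit l σ g = true ↔ Weak (C.kind g) (valBit l σ g) ∨
      ∃ h ∈ l, C.Wire h g ∧ valBit l σ h = valBit l σ g) ∧
    (g = C.output → valBit l σ g = true)

/-- In a single node of the given tree, a state arises exactly if it is consistent with the wires in
the bag, whatever the valuation is. -/
theorem holds_singleton {b : ℕ} (hb : b ≤ n) {ν : ℕ → Bool} {σ : ℕ}
    (hσ : σ < 4 ^ (bag b).length) :
    Holds C n bag {b} b ν σ ↔ LocallyOk C (bag b) σ := by
  constructor
  · rintro ⟨_, μ, w⟩ g hg
    refine ⟨fun h hh hw => ?_, ?_, ?_⟩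
    · rw [(w.bits g hg).1, (w.bits h hh).1]
      exact (w.sol.loc b rfl).1 hb g hg h hh hw
    · rw [(w.bits g hg).2, (w.bits g hg).1, Satisfied]
      refine or_congr Iff.rfl ⟨?_, ?_⟩
      · rintro ⟨x, rfl, _, h, hh, hw, he⟩
        exact ⟨h, hh, hw, by rwa [(w.bits h hh).1]⟩
      · rintro ⟨h, hh, hw, he⟩
        exact ⟨b, rfl, hg, h, hh, hw, by rwa [(w.bits h hh).1] at he⟩
    · rintro rfl
      rw [(w.bits _ hg).1]
      exact w.out b rfl hb hg
  · refine fun h => ⟨hσ, valBit (bag b) σ, ⟨⟨?_, ?_⟩, ?_, fun g hg => ⟨rfl, ?_⟩⟩⟩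
    · rintro x rfl
      exact ⟨fun _ g hg i hi hw => (h g hg).1 i hi hw, fun hx => absurd hx (by omega)⟩
    · rintro x rfl g hg hgb
      exact absurd hg hgb
    · rintro x rfl _ ho
      exact (h _ ho).2.2 rfl
    · rw [(h g hg).2.1, Satisfied]
      refine or_congr Iff.rfl ⟨?_, ?_⟩
      · rintro ⟨i, hi, hw, he⟩
        exact ⟨b, rfl, hg, i, hi, hw, he⟩
      · rintro ⟨x, rfl, _, i, hi, hw, he⟩
        exact ⟨i, hi, hw, he⟩

/-- In the leaf of the variable `u`, the state is determined by the value of `u`: the digit of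
satisfaction is one, because a variable gate needs no justification. -/
theorem holds_leaf {b u : ℕ} (hb : n < b) (hu : C.kind u = .var) (hl : bag b = [u])
    {ν : ℕ → Bool} {σ : ℕ} :
    Holds C n bag {b} b ν σ ↔ σ = 2 + (ν u).toNat := by
  have hs : ∀ μ, Satisfied C bag {b} μ u := fun μ => .inl (by simp [hu, Weak])
  constructor
  · rintro ⟨hσ, μ, w⟩
    have h1 := w.bits u (by simp [hl])
    have h2 := (w.sol.loc b rfl).2 hb u (by simp [hl])
    simp only [hl, valBit, satBit, hs, iff_true, List.idxOf_cons_self, h2] at h1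
    simp only [hl, List.length_singleton, pow_one] at hσ
    revert h1
    interval_cases σ <;> cases ν u <;> simp [Nat.testBit]
  · rintro rfl
    refine ⟨?_, ν, ⟨⟨?_, ?_⟩, ?_, fun g hg => ?_⟩⟩
    · rw [hl]; cases ν u <;> simp
    · rintro x rfl
      exact ⟨fun hx => absurd hx (by omega), fun _ _ _ => rfl⟩
    · rintro x rfl g hg hgb
      exact absurd hg hgb
    · rintro x rfl hx
      omega
    · rw [hl, List.mem_singleton] at hg
      subst hg
      simp only [hl, valBit, satBit, hs, iff_true, List.idxOf_cons_self]
      cases ν g <;> decide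

end

/-! ### Circuits that are built gate by gate -/

/-- A gate with its name, its type and the names of its inputs. -/
structure Entry where
  name : ℕ
  kind : GateKind
  ins : List ℕ

/-- A circuit as the list of its gates, the latest first; the inputs of a gate come after it. -/
abbrev Net := List Entry

namespace Net

def names (L : Net) : List ℕ := L.map Entry.name

/-- The value of the gate `g` under the valuation `ν` of the variable gates. -/
def ev : Net → (ℕ → Bool) → ℕ → Bool
  | [], _, _ => false
  | e :: L, ν, g => if g = e.name then
      match e.kind with
      | .var => ν e.name
      | .not => e.ins.any fun h => !ev L ν h
      | .or => e.ins.any fun h => ev L ν h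
      | .and => e.ins.all fun h => ev L ν h
    else ev L ν g

/-- The variable gates below the gate `g`. -/
def below : Net → ℕ → Finset ℕ
  | [], _ => ∅
  | e :: L, g => if g = e.name then
      if e.kind = .var then {e.name} else e.ins.toFinset.biUnion (below L)
    else below L g

/-- The gate `e` may be added to `L`: its name is new, its inputs are present, and it respects the
conditions on negation normal form, decomposability and determinism. -/
structure Addable (L : Net) (e : Entry) : Prop where
  fresh : e.name ∉ L.names
  ins : ∀ h ∈ e.ins, h ∈ L.names
  nodup : e.ins.Nodup
  var : e.kind = .var → e.ins = []
  not : e.kind = .not → ∃ v, e.ins = [v] ∧ ∃ f ∈ L, f.name = v ∧ f.kind = .var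
  dec : e.kind = .and → ∀ h₁ ∈ e.ins, ∀ h₂ ∈ e.ins, h₁ ≠ h₂ → Disjoint (L.below h₁) (L.below h₂)
  det : e.kind = .or → ∀ h₁ ∈ e.ins, ∀ h₂ ∈ e.ins, h₁ ≠ h₂ →
    ∀ ν, ¬ (L.ev ν h₁ = true ∧ L.ev ν h₂ = true)

/-- Each gate may be added to the gates after it in the list. -/
def Ok : Net → Prop
  | [] => True
  | e :: L => Ok L ∧ Addable L e

theorem names_cons (e : Entry) (L : Net) : names (e :: L) = e.name :: L.names := rfl

theorem ev_cons_self (e : Entry) (L : Net) (ν : ℕ → Bool) : ev (e :: L) ν e.name =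
    match e.kind with
      | .var => ν e.name
      | .not => e.ins.any fun h => !ev L ν h
      | .or => e.ins.any fun h => ev L ν h
      | .and => e.ins.all fun h => ev L ν h := by
  simp [ev]

theorem ev_cons {e : Entry} {L : Net} (h : e.name ∉ L.names) {g : ℕ} (hg : g ∈ L.names)
    (ν : ℕ → Bool) : ev (e :: L) ν g = L.ev ν g := by
  rw [ev, if_neg]
  rintro rfl
  exact h hg

theorem below_cons {e : Entry} {L : Net} (h : e.name ∉ L.names) {g : ℕ} (hg : g ∈ L.names) :
    below (e :: L) g = L.below g := by
  rw [below, if_neg]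
  rintro rfl
  exact h hg

theorem Ok.nodup {L : Net} (h : L.Ok) : L.names.Nodup := by
  induction L with
  | nil => exact List.nodup_nil
  | cons e L ih => exact List.nodup_cons.mpr ⟨h.2.fresh, ih h.1⟩

theorem Ok.suffix {L L' : Net} (h : L.Ok) (hs : L' <:+ L) : L'.Ok := by
  induction L with
  | nil => rw [List.suffix_nil.mp hs]; trivial
  | cons e L ih =>
    rcases List.suffix_cons_iff.mp hs with rfl | hs
    · exact h
    · exact ih h.1 hs

theorem Ok.eq_of_name {L : Net} (h : L.Ok) {e f : Entry} (he : e ∈ L) (hf : f ∈ L)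
    (hn : e.name = f.name) : e = f :=
  List.inj_on_of_nodup_map h.nodup he hf hn

theorem Ok.suffix_ev_below {L L' : Net} (h : L.Ok) (hs : L' <:+ L) {g : ℕ} (hg : g ∈ L'.names) :
    (∀ ν, L.ev ν g = L'.ev ν g) ∧ L.below g = L'.below g := by
  induction L with
  | nil => rw [List.suffix_nil.mp hs]; simp
  | cons e L ih =>
    rcases List.suffix_cons_iff.mp hs with rfl | hs
    · simp
    · have hgL : g ∈ names L := (hs.map Entry.name).subset hg
      exact ⟨fun ν => (ev_cons h.2.fresh hgL ν).trans ((ih h.1 hs).1 ν),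
        (below_cons h.2.fresh hgL).trans (ih h.1 hs).2⟩

/-- The wires, in the order in which they are written. -/
def wireList (L : Net) : List (ℕ × ℕ) := L.reverse.flatMap fun e => e.ins.map fun h => (h, e.name)

theorem mem_wireList {L : Net} {w : ℕ × ℕ} :
    w ∈ L.wireList ↔ ∃ e ∈ L, w.1 ∈ e.ins ∧ w.2 = e.name := by
  simp only [wireList, List.mem_flatMap, List.mem_reverse, List.mem_map]
  constructor
  · rintro ⟨e, he, h, hh, rfl⟩
    exact ⟨e, he, hh, rfl⟩
  · rintro ⟨e, he, h1, h2⟩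
    exact ⟨e, he, w.1, h1, by rw [← h2]⟩

theorem wireList_cons (e : Entry) (L : Net) :
    wireList (e :: L) = L.wireList ++ e.ins.map fun h => (h, e.name) := by
  simp [wireList]

theorem Ok.wireList_nodup {L : Net} (h : L.Ok) : L.wireList.Nodup := by
  induction L with
  | nil => simp [wireList]
  | cons e L ih =>
    rw [wireList_cons, List.nodup_append']
    refine ⟨ih h.1, h.2.nodup.map fun _ _ hh => congrArg Prod.fst hh, ?_⟩
    intro w hw hw'
    obtain ⟨f, hf, _, h2⟩ := mem_wireList.mp hw
    simp only [List.mem_map] at hw'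
    obtain ⟨_, _, rfl⟩ := hw'
    exact h.2.fresh (List.mem_map.mpr ⟨f, hf, h2.symm⟩)

/-- The type of the gate `g`. -/
def kindOf : Net → ℕ → GateKind
  | [], _ => .var
  | e :: L, g => if g = e.name then e.kind else kindOf L g

theorem Ok.kindOf_name {L : Net} (h : L.Ok) {e : Entry} (he : e ∈ L) :
    L.kindOf e.name = e.kind := by
  induction L with
  | nil => simp at he
  | cons f L ih =>
    rw [kindOf]
    split_ifs with hn
    · rw [h.eq_of_name he List.mem_cons_self hn]
    · rcases List.mem_cons.mp he with rfl | he
      · exact absurd rfl hn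
      · exact ih h.1 he

/-- The number of gates that were present when `g` was added. -/
def rank : Net → ℕ → ℕ
  | [], _ => 0
  | e :: L, g => if g = e.name then L.length else rank L g

theorem rank_lt {L : Net} {g : ℕ} (hg : g ∈ L.names) : L.rank g < L.length := by
  induction L with
  | nil => simp [names] at hg
  | cons e L ih =>
    rw [rank, List.length_cons]
    split_ifs with hn
    · exact Nat.lt_succ_self _
    · rw [names_cons, List.mem_cons] at hg
      exact (ih (hg.resolve_left hn)).trans (Nat.lt_succ_self _)

theorem Ok.rank_ins {L : Net} (h : L.Ok) {e : Entry} (he : e ∈ L) {i : ℕ} (hi : i ∈ e.ins) :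
    i ∈ L.names ∧ L.rank i < L.rank e.name := by
  induction L with
  | nil => simp at he
  | cons f L ih =>
    rw [names_cons, List.mem_cons, rank, rank]
    rcases List.mem_cons.mp he with rfl | he
    · have hiL := h.2.ins i hi
      have hne : i ≠ e.name := fun hh => h.2.fresh (hh ▸ hiL)
      rw [if_neg hne, if_pos rfl]
      exact ⟨.inr hiL, rank_lt hiL⟩
    · obtain ⟨hiL, hr⟩ := ih h.1 he
      have hne : i ≠ f.name := fun hh => h.2.fresh (hh ▸ hiL)
      have hne' : e.name ≠ f.name := fun hh => h.2.fresh (hh ▸ List.mem_map_of_mem he)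
      rw [if_neg hne, if_neg hne']
      exact ⟨.inr hiL, hr⟩

theorem Ok.ins_nodup {L : Net} (h : L.Ok) {e : Entry} (he : e ∈ L) : ∃ L', e :: L' <:+ L := by
  obtain ⟨s, t, rfl⟩ := List.append_of_mem he
  exact ⟨t, s, rfl⟩

/-- The circuit with the gates `L` and the output gate `o`. -/
def toCircuit (L : Net) (hL : L.Ok) (o : ℕ) (ho : o ∈ L.names) : Circuit where
  gates := L.names.toFinset
  wires := L.wireList.toFinset
  output := o
  kind := L.kindOf
  output_mem := List.mem_toFinset.mpr ho
  wires_mem h g hw := by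
    obtain ⟨e, he, h1, h2⟩ := mem_wireList.mp (List.mem_toFinset.mp hw)
    simp only at h1 h2
    rw [List.mem_toFinset, List.mem_toFinset, h2]
    exact ⟨(hL.rank_ins he h1).1, List.mem_map_of_mem he⟩
  acyclic g hg := by
    have key : ∀ a b, Relation.TransGen (fun a b => (a, b) ∈ L.wireList.toFinset) a b →
        L.rank a < L.rank b := by
      intro a b hab
      have step : ∀ a b, (a, b) ∈ L.wireList.toFinset → L.rank a < L.rank b := by
        intro a b hw
        obtain ⟨e, he, h1, h2⟩ := mem_wireList.mp (List.mem_toFinset.mp hw)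
        simp only at h1 h2
        rw [h2]
        exact (hL.rank_ins he h1).2
      induction hab with
      | single h => exact step _ _ h
      | tail _ h ih => exact ih.trans (step _ _ h)
    exact lt_irrefl _ (key g g hg)
  not_fanin g hg hk := by
    obtain ⟨e, he, rfl⟩ := List.mem_map.mp (List.mem_toFinset.mp hg)
    rw [hL.kindOf_name he] at hk
    obtain ⟨L', hL'⟩ := hL.ins_nodup he
    obtain ⟨v, hv, _⟩ := (hL.suffix hL').2.not hk
    rw [Finset.card_eq_one]
    refine ⟨(v, e.name), Finset.ext fun w => ?_⟩
    rw [Finset.mem_filter, Finset.mem_singleton, List.mem_toFinset, mem_wireList]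
    constructor
    · rintro ⟨⟨f, hf, h1, h2⟩, h3⟩
      have := hL.eq_of_name hf he (by rw [← h2, h3])
      subst this
      rw [hv, List.mem_singleton] at h1
      exact Prod.ext h1 h2
    · rintro rfl
      exact ⟨⟨e, he, by simp [hv], rfl⟩, rfl⟩
  var_fanin g hg hk := by
    obtain ⟨e, he, rfl⟩ := List.mem_map.mp (List.mem_toFinset.mp hg)
    rw [hL.kindOf_name he] at hk
    obtain ⟨L', hL'⟩ := hL.ins_nodup he
    have hv := (hL.suffix hL').2.var hk
    rw [Finset.card_eq_zero, Finset.filter_eq_empty_iff]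
    intro w hw hn
    obtain ⟨f, hf, h1, h2⟩ := mem_wireList.mp (List.mem_toFinset.mp hw)
    have := hL.eq_of_name hf he (by rw [← h2, hn])
    subst this
    rw [hv] at h1
    simp at h1

section

variable {L : Net} {hL : L.Ok} {o : ℕ} {ho : o ∈ L.names}

theorem toCircuit_kind {e : Entry} (he : e ∈ L) : (L.toCircuit hL o ho).kind e.name = e.kind :=
  hL.kindOf_name he

theorem toCircuit_wire {e : Entry} (he : e ∈ L) {h : ℕ} :
    (L.toCircuit hL o ho).Wire h e.name ↔ h ∈ e.ins := by
  rw [Circuit.Wire, toCircuit, List.mem_toFinset, mem_wireList]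
  constructor
  · rintro ⟨f, hf, h1, h2⟩
    rwa [hL.eq_of_name he hf h2]
  · exact fun hh => ⟨e, he, hh, rfl⟩

theorem mem_toCircuit_gates {g : ℕ} :
    g ∈ (L.toCircuit hL o ho).gates ↔ ∃ e ∈ L, e.name = g := by
  rw [toCircuit, List.mem_toFinset, names, List.mem_map]

theorem mem_toCircuit_inputs {e : Entry} (he : e ∈ L) {h : ℕ} :
    h ∈ (L.toCircuit hL o ho).inputs e.name ↔ h ∈ e.ins := by
  rw [Circuit.inputs, Finset.mem_filter, ← toCircuit_wire (hL := hL) (ho := ho) he, Circuit.Wire]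
  exact ⟨fun h => h.2, fun h => ⟨((L.toCircuit hL o ho).wires_mem _ _ h).1, h⟩⟩

theorem mem_toCircuit_vars {g : ℕ} :
    g ∈ (L.toCircuit hL o ho).vars ↔ ∃ e ∈ L, e.name = g ∧ e.kind = .var := by
  rw [Circuit.vars, Finset.mem_filter, mem_toCircuit_gates]
  constructor
  · rintro ⟨⟨e, he, rfl⟩, hk⟩
    exact ⟨e, he, rfl, by rwa [← toCircuit_kind (hL := hL) (ho := ho) he]⟩
  · rintro ⟨e, he, rfl, hk⟩
    exact ⟨⟨e, he, rfl⟩, by rwa [toCircuit_kind he]⟩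

open Classical in
theorem toCircuit_eval (ν : ℕ → Bool) {g : ℕ} (hg : g ∈ L.names) :
    (L.toCircuit hL o ho).eval ν g = L.ev ν g := by
  have key : ∀ L' : Net, L' <:+ L → ∀ g ∈ names L',
      (L.toCircuit hL o ho).eval ν g = ev L' ν g := by
    intro L'
    induction L' with
    | nil => simp [names]
    | cons e L' ih =>
      intro hs g hg
      have hs' : L' <:+ L := (List.suffix_cons _ _).trans hs
      have he : e ∈ L := hs.subset List.mem_cons_self
      have hok := (hL.suffix hs).2
      by_cases hn : g = e.name
      · subst hn
        have hi : ∀ h ∈ e.ins, (L.toCircuit hL o ho).eval ν h = ev L' ν h :=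
          fun h hh => ih hs' h (hok.ins h hh)
        rw [ev_cons_self, Circuit.eval_eq, toCircuit_kind he]
        simp only [toCircuit_wire he]
        cases e.kind with
        | var => rfl
        | not =>
          rw [Bool.eq_iff_iff]
          simp only [decide_eq_true_eq, exists_prop, List.any_eq_true, Bool.not_eq_true']
          exact exists_congr fun h => and_congr_right fun hh => by rw [hi h hh]
        | or =>
          rw [Bool.eq_iff_iff]
          simp only [decide_eq_true_eq, exists_prop, List.any_eq_true]
          exact exists_congr fun h => and_congr_right fun hh => by rw [hi h hh]
        | and =>
          rw [Bool.eq_iff_iff]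
          simp only [decide_eq_true_eq, List.all_eq_true]
          exact forall_congr' fun h => forall_congr' fun hh => by rw [hi h hh]
      · have hg' : g ∈ names L' := by
          rw [names_cons, List.mem_cons] at hg
          exact hg.resolve_left hn
        rw [ih hs' g hg', ev_cons hok.fresh hg']
  exact key L (List.suffix_refl L) g hg

open Classical in
theorem varsBelow_subset {g : ℕ} :
    (L.toCircuit hL o ho).varsBelow g ⊆ L.below g := by
  intro u hu
  rw [Circuit.varsBelow, Finset.mem_filter] at hu
  obtain ⟨hu, hp⟩ := hu
  obtain ⟨e, he, rfl, hk⟩ := mem_toCircuit_vars.mp hu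
  have hself : ∀ f ∈ L, ∃ L', f :: L' <:+ L ∧
      L.below f.name = if f.kind = .var then {f.name} else f.ins.toFinset.biUnion (below L') := by
    intro f hf
    obtain ⟨L', hL'⟩ := hL.ins_nodup hf
    refine ⟨L', hL', ?_⟩
    rw [(hL.suffix_ev_below hL' (by simp [names_cons])).2, below, if_pos rfl]
  induction hp with
  | refl =>
    obtain ⟨L', _, h⟩ := hself e he
    rw [h, if_pos hk]
    exact Finset.mem_singleton_self _
  | @tail b c _ hw ih =>
    obtain ⟨f, hf, rfl⟩ := mem_toCircuit_gates.mp (Circuit.wires_mem _ _ _ hw).2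
    have hb := (toCircuit_wire hf).mp hw
    obtain ⟨L', hL', h⟩ := hself f hf
    have hok := (hL.suffix hL').2
    have hv : f.kind ≠ .var := fun hv => by rw [hok.var hv] at hb; simp at hb
    rw [h, if_neg hv, Finset.mem_biUnion]
    refine ⟨b, List.mem_toFinset.mpr hb, ?_⟩
    rwa [← (hL.suffix_ev_below ((List.suffix_cons _ _).trans hL') (hok.ins b hb)).2]

/-- The AND-gates with inputs have two of them, which respect a node of a v-tree among those in
`P`. -/
def Structured (L : Net) (P : BinTree → Prop) : Prop :=
  ∀ e ∈ L, e.kind = .and → e.ins ≠ [] → ∃ x y, e.ins = [x, y] ∧ ∃ l r, P (.two l r) ∧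
    L.below x ⊆ l.leaves.toFinset ∧ L.below y ⊆ r.leaves.toFinset

theorem toCircuit_structures {V : VTree} (hV : V.leaves.Nodup)
    (hV' : ∀ u, u ∈ V.leaves ↔ ∃ e ∈ L, e.name = u ∧ e.kind = .var)
    (hs : L.Structured (· ∈ V.subtrees)) : V.Structures (L.toCircuit hL o ho) := by
  refine ⟨⟨hV, Finset.ext fun u => ?_⟩, fun g hg hk hne => ?_⟩
  · rw [List.mem_toFinset, hV', mem_toCircuit_vars]
  · obtain ⟨e, he, rfl⟩ := mem_toCircuit_gates.mp hg
    rw [toCircuit_kind he] at hk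
    obtain ⟨h, hh⟩ := hne
    rw [mem_toCircuit_inputs he] at hh
    obtain ⟨x, y, hxy, l, r, hP, hx, hy⟩ := hs e he hk (List.ne_nil_of_mem hh)
    obtain ⟨L', hL'⟩ := hL.ins_nodup he
    refine ⟨_, hP, [x, y], hxy ▸ (hL.suffix hL').2.nodup, Finset.ext fun i => ?_, ?_⟩
    · rw [mem_toCircuit_inputs he, List.mem_toFinset, hxy]
    · exact .cons (varsBelow_subset.trans hx) (.cons (varsBelow_subset.trans hy) .nil)

theorem toCircuit_isDSDNNF {V : VTree} (hV : V.Structures (L.toCircuit hL o ho)) :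
    (L.toCircuit hL o ho).IsDSDNNF := by
  refine ⟨fun g hg hk h hh => ?_, fun g hg hk h₁ hh₁ h₂ hh₂ hne => ?_,
    fun g hg hk h₁ hh₁ h₂ hh₂ hne ν => ?_, V, hV⟩ <;>
  obtain ⟨e, he, rfl⟩ := mem_toCircuit_gates.mp hg <;>
  rw [toCircuit_kind he] at hk <;>
  obtain ⟨L', hL'⟩ := hL.ins_nodup he <;>
  have hok := (hL.suffix hL').2 <;>
  have hs := (List.suffix_cons _ _).trans hL'
  · rw [mem_toCircuit_inputs he] at hh
    obtain ⟨v, hv, f, hf, rfl, hfk⟩ := hok.not hk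
    rw [hv, List.mem_singleton] at hh
    rw [hh, toCircuit_kind (hs.subset hf), hfk]
  · rw [mem_toCircuit_inputs he] at hh₁ hh₂
    refine (hok.dec hk h₁ hh₁ h₂ hh₂ hne).mono ?_ ?_
    · rw [← (hL.suffix_ev_below hs (hok.ins _ hh₁)).2]; exact varsBelow_subset
    · rw [← (hL.suffix_ev_below hs (hok.ins _ hh₂)).2]; exact varsBelow_subset
  · rw [mem_toCircuit_inputs he] at hh₁ hh₂
    have hi : ∀ h ∈ e.ins, (L.toCircuit hL o ho).eval ν h = ev L' ν h := fun h hh => by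
      rw [toCircuit_eval ν ((hs.map Entry.name).subset (hok.ins _ hh)),
        (hL.suffix_ev_below hs (hok.ins _ hh)).1]
    rw [hi _ hh₁, hi _ hh₂]
    exact hok.det hk h₁ hh₁ h₂ hh₂ hne ν

/-- The part of the output that describes the gates. -/
def gateCode (L : Net) : List ℕ := L.reverse.flatMap fun e => [e.name, e.kind.code]

/-- The part of the output that describes the wires. -/
def wireCode (L : Net) : List ℕ := L.wireList.flatMap fun w => [w.1, w.2]

theorem gateCode_cons (e : Entry) (L : Net) :
    gateCode (e :: L) = L.gateCode ++ [e.name, e.kind.code] := by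
  simp [gateCode]

theorem wireCode_cons (e : Entry) (L : Net) :
    wireCode (e :: L) = L.wireCode ++ e.ins.flatMap fun h => [h, e.name] := by
  simp [wireCode, wireList_cons, List.flatMap_map]

theorem toCircuit_representedBy : (L.toCircuit hL o ho).RepresentedBy
    ([L.gateCode.length / 2, L.wireCode.length / 2, o] ++ L.gateCode ++ L.wireCode) := by
  refine ⟨L.names.reverse, L.wireList, List.nodup_reverse.mpr hL.nodup, by simp [toCircuit],
    hL.wireList_nodup, rfl, ?_⟩
  have h1 : (L.names.reverse.flatMap fun g => [g, ((L.toCircuit hL o ho).kind g).code]) =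
      L.gateCode := by
    rw [gateCode, names, ← List.map_reverse, List.flatMap_map]
    refine List.flatMap_congr fun e he => ?_
    rw [toCircuit_kind (List.mem_reverse.mp he)]
  have h2 : ∀ (l : List (ℕ × ℕ)), (l.flatMap fun w => [w.1, w.2]).length = 2 * l.length := by
    intro l; simp [List.length_flatMap]; ring
  have h3 : L.gateCode.length = 2 * L.length := by
    simp [gateCode, List.length_flatMap]; ring
  rw [h1, h3, wireCode, h2]
  simp [toCircuit, names]

end

end Net

/-! ### Gates for the states of a bag -/

/-- The v-tree with the two given v-trees below its root, unless one of them is empty. -/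
def VTree.merge : VTree → VTree → VTree
  | some l, some r => some (.two l r)
  | none, V => V
  | V, none => V

theorem VTree.leaves_merge (V W : VTree) : (V.merge W).leaves = V.leaves ++ W.leaves := by
  cases V <;> cases W <;> simp [merge, leaves, BinTree.leaves]

theorem BinTree.self_mem_subtrees (t : BinTree) : t ∈ t.subtrees := by
  cases t <;> simp [subtrees]

theorem VTree.subtrees_merge {V W : VTree} {t : BinTree} (h : t ∈ V.subtrees ∨ t ∈ W.subtrees) :
    t ∈ (V.merge W).subtrees := by
  cases V <;> cases W <;> simp_all [merge, subtrees, BinTree.subtrees]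

namespace Net

/-- The gates of `L` have names below `fr`. -/
structure Good (L : Net) (fr : ℕ) : Prop where
  ok : L.Ok
  lt : ∀ g ∈ L.names, g < fr

/-- The table entry `e` stands for the Boolean function `P` of the variables in `V`: it is the
successor of the name of a gate that computes it, or zero if the function is constantly false. Over
the empty set of variables it is zero only in this case. -/
structure Repr (L : Net) (V : VTree) (P : (ℕ → Bool) → Prop) (e : ℕ) : Prop where
  zero : e = 0 → ∀ ν, ¬ P ν
  mem : 0 < e → e - 1 ∈ L.names
  ev : 0 < e → ∀ ν, L.ev ν (e - 1) = true ↔ P ν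
  below : 0 < e → L.below (e - 1) ⊆ V.leaves.toFinset
  none : 0 < e → V = none → ∀ ν, P ν

theorem Repr.suffix {L L' : Net} {V : VTree} {P : (ℕ → Bool) → Prop} {e : ℕ} (h : L.Repr V P e)
    (hL : L'.Ok) (hs : L <:+ L') : L'.Repr V P e where
  zero := h.zero
  mem he := (hs.map Entry.name).subset (h.mem he)
  ev he ν := by rw [(hL.suffix_ev_below hs (h.mem he)).1]; exact h.ev he ν
  below he := by rw [(hL.suffix_ev_below hs (h.mem he)).2]; exact h.below he
  none := h.none

theorem Repr.congr {L : Net} {V : VTree} {P Q : (ℕ → Bool) → Prop} {e : ℕ} (h : L.Repr V P e)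
    (hPQ : ∀ ν, P ν ↔ Q ν) : L.Repr V Q e := by
  have : P = Q := funext fun ν => propext (hPQ ν)
  rwa [← this]

theorem Structured.mono {L : Net} {P Q : BinTree → Prop} (h : L.Structured P)
    (hPQ : ∀ t, P t → Q t) : L.Structured Q := by
  intro e he hk hn
  obtain ⟨x, y, hxy, l, r, hP, hx, hy⟩ := h e he hk hn
  exact ⟨x, y, hxy, l, r, hPQ _ hP, hx, hy⟩

theorem Structured.cons {L : Net} {P : BinTree → Prop} {e : Entry} (h : L.Structured P)
    (hL : Ok (e :: L)) (he : e.kind = .and → e.ins ≠ [] → ∃ x y, e.ins = [x, y] ∧ ∃ l r,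
      P (.two l r) ∧ L.below x ⊆ l.leaves.toFinset ∧ L.below y ⊆ r.leaves.toFinset) :
    Structured (e :: L) P := by
  intro f hf hk hn
  rcases List.mem_cons.mp hf with rfl | hf
  · obtain ⟨x, y, hxy, l, r, hP, hx, hy⟩ := he hk hn
    refine ⟨x, y, hxy, l, r, hP, ?_, ?_⟩
    · rwa [below_cons hL.2.fresh (hL.2.ins x (by simp [hxy]))]
    · rwa [below_cons hL.2.fresh (hL.2.ins y (by simp [hxy]))]
  · obtain ⟨x, y, hxy, l, r, hP, hx, hy⟩ := h f hf hk hn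
    refine ⟨x, y, hxy, l, r, hP, ?_, ?_⟩
    · rwa [below_cons hL.2.fresh (hL.1.rank_ins hf (by simp [hxy])).1]
    · rwa [below_cons hL.2.fresh (hL.1.rank_ins hf (by simp [hxy])).1]

theorem Good.cons {L : Net} {fr : ℕ} (h : L.Good fr) {e : Entry} (he : L.Addable e) (hn : e.name = fr) :
    Good (e :: L) (fr + 1) := by
  refine ⟨⟨h.ok, he⟩, fun g hg => ?_⟩
  rcases List.mem_cons.mp hg with rfl | hg
  · rw [← hn]; exact Nat.lt_succ_self _
  · exact (h.lt g hg).trans (Nat.lt_succ_self _)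

theorem Good.not_mem {L : Net} {fr : ℕ} (h : L.Good fr) : fr ∉ L.names :=
  fun hg => lt_irrefl _ (h.lt _ hg)

/-- Adding an OR-gate with one input. -/
theorem Good.copy {L : Net} {fr w : ℕ} (h : L.Good fr) (hw : w ∈ L.names) {V : VTree}
    {P : (ℕ → Bool) → Prop} (hr : L.Repr V P (w + 1)) :
    Good (⟨fr, .or, [w]⟩ :: L) (fr + 1) ∧ Repr (⟨fr, .or, [w]⟩ :: L) V P (fr + 1) := by
  have hg : Good (⟨fr, .or, [w]⟩ :: L) (fr + 1) :=
    h.cons ⟨h.not_mem, by simpa using hw, by simp, by simp, by simp, by simp, by simp⟩ rfl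
  refine ⟨hg, by simp, fun _ => by simp [names], fun _ ν => ?_, fun _ => ?_, fun _ => hr.none (by simp)⟩
  · rw [← hr.ev (by simp) ν]
    simp [Net.ev]
  · simpa [Net.below] using hr.below (by simp)

/-- Adding a conjunction. -/
theorem Good.and {L : Net} {fr x y : ℕ} (h : L.Good fr) (hxy : x ≠ y) {l r : BinTree}
    {P Q : (ℕ → Bool) → Prop} (hx : L.Repr (some l) P (x + 1)) (hy : L.Repr (some r) Q (y + 1))
    (hd : List.Disjoint l.leaves r.leaves) {T : BinTree → Prop} (hT : T (.two l r))
    (hs : L.Structured T) :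
    Good (⟨fr, .and, [x, y]⟩ :: L) (fr + 1) ∧
      Repr (⟨fr, .and, [x, y]⟩ :: L) (some (.two l r)) (fun ν => P ν ∧ Q ν) (fr + 1) ∧
      Structured (⟨fr, .and, [x, y]⟩ :: L) T := by
  have mx := hx.mem (by simp)
  have my := hy.mem (by simp)
  have bx := hx.below (by simp)
  have byy := hy.below (by simp)
  simp only [Nat.add_sub_cancel] at mx my bx byy
  have hdd : Disjoint (L.below x) (L.below y) := by
    refine Disjoint.mono bx byy ?_
    rw [Finset.disjoint_left]
    intro u hu hu'
    exact hd (List.mem_toFinset.mp hu) (List.mem_toFinset.mp hu')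
  have hg : Good (⟨fr, .and, [x, y]⟩ :: L) (fr + 1) :=
    h.cons ⟨h.not_mem, by simp [mx, my], by simp [hxy], by simp, by simp,
      fun _ => by simp [hxy, hxy.symm, hdd, hdd.symm], by simp⟩ rfl
  refine ⟨hg, ⟨by simp, fun _ => by simp [names], fun _ ν => ?_, fun _ => ?_, by simp⟩,
    hs.cons hg.ok fun _ _ => ⟨x, y, rfl, l, r, hT, bx, byy⟩⟩
  · rw [← hx.ev (by simp) ν, ← hy.ev (by simp) ν]
    simp [Net.ev]
  · intro u hu
    simp only [Net.below, Nat.add_sub_cancel, if_true, reduceCtorEq, if_false, List.toFinset_cons,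
      List.toFinset_nil, insert_empty_eq, Finset.biUnion_insert, Finset.singleton_biUnion,
      Finset.mem_union] at hu
    simp only [VTree.leaves, BinTree.leaves, List.toFinset_append, Finset.mem_union]
    exact hu.imp (fun h => bx h) (fun h => byy h)

/-- Adding a deterministic disjunction. -/
theorem Good.or {L : Net} {fr x y : ℕ} (h : L.Good fr) (hxy : x ≠ y) {V : VTree}
    {P Q : (ℕ → Bool) → Prop} (hx : L.Repr V P (x + 1)) (hy : L.Repr V Q (y + 1))
    (hPQ : ∀ ν, ¬ (P ν ∧ Q ν)) :
    Good (⟨fr, .or, [x, y]⟩ :: L) (fr + 1) ∧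
      Repr (⟨fr, .or, [x, y]⟩ :: L) V (fun ν => P ν ∨ Q ν) (fr + 1) := by
  have mx := hx.mem (by simp)
  have my := hy.mem (by simp)
  have bx := hx.below (by simp)
  have byy := hy.below (by simp)
  have ex := hx.ev (by simp)
  have ey := hy.ev (by simp)
  simp only [Nat.add_sub_cancel] at mx my bx byy ex ey
  have hg : Good (⟨fr, .or, [x, y]⟩ :: L) (fr + 1) := by
    refine h.cons ⟨h.not_mem, by simp [mx, my], by simp [hxy], by simp, by simp, by simp,
      fun _ h₁ hh₁ h₂ hh₂ hne ν hν => ?_⟩ rfl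
    simp only [List.mem_cons, List.not_mem_nil, or_false] at hh₁ hh₂
    rcases hh₁ with rfl | rfl <;> rcases hh₂ with rfl | rfl
    · exact hne rfl
    · exact hPQ ν ⟨(ex ν).mp hν.1, (ey ν).mp hν.2⟩
    · exact hPQ ν ⟨(ex ν).mp hν.2, (ey ν).mp hν.1⟩
    · exact hne rfl
  refine ⟨hg, ⟨by simp, fun _ => by simp [names], fun _ ν => ?_, fun _ => ?_, fun _ hV ν =>
    .inl (hx.none (by simp) hV ν)⟩⟩
  · rw [← ex ν, ← ey ν]
    simp [Net.ev]
  · intro u hu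
    simp only [Net.below, Nat.add_sub_cancel, if_true, reduceCtorEq, if_false, List.toFinset_cons,
      List.toFinset_nil, insert_empty_eq, Finset.biUnion_insert, Finset.singleton_biUnion,
      Finset.mem_union] at hu
    exact hu.elim (fun h => bx h) (fun h => byy h)

/-- The gates for a pair of table entries, and the name of the last of them. An OR-gate as a copy of
the second input guarantees that the conjunction has two different inputs. -/
def conj (L : Net) (fr e f vp vc : ℕ) : Net × ℕ :=
  let L₁ : Net := ⟨fr, .or, [if 0 < vc then f - 1 else e - 1]⟩ :: L
  if 0 < vp ∧ 0 < vc then (⟨fr + 1, .and, [e - 1, fr]⟩ :: L₁, fr + 1) else (L₁, fr)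

/-- The gates of `conj` compute the conjunction of the functions represented by `e` and `f`. Its
AND-gate, present if both v-trees are nonempty, belongs to the root of the merged v-tree. -/
theorem Good.conj {L : Net} {fr e f vp vc : ℕ} (h : L.Good fr) {V W : VTree}
    (hV : V = none ↔ vp = 0) (hW : W = none ↔ vc = 0) {P Q : (ℕ → Bool) → Prop}
    (he : 0 < e) (hf : 0 < f) (hx : L.Repr V P e) (hy : L.Repr W Q f)
    (hd : List.Disjoint V.leaves W.leaves) {T : BinTree → Prop} (hT : ∀ t ∈ (V.merge W).subtrees, T t)
    (hs : L.Structured T) :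
    (L.conj fr e f vp vc).1.Good ((L.conj fr e f vp vc).2 + 1) ∧
      (L.conj fr e f vp vc).1.Repr (V.merge W) (fun ν => P ν ∧ Q ν) ((L.conj fr e f vp vc).2 + 1) ∧
      (L.conj fr e f vp vc).1.Structured T ∧ L <:+ (L.conj fr e f vp vc).1 ∧
      fr ≤ (L.conj fr e f vp vc).2 := by
  obtain ⟨x, rfl⟩ : ∃ x, e = x + 1 := ⟨e - 1, by omega⟩
  obtain ⟨y, rfl⟩ : ∃ y, f = y + 1 := ⟨f - 1, by omega⟩
  have mx := hx.mem he
  have my := hy.mem hf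
  simp only [Nat.add_sub_cancel] at mx my
  have hor : ∀ w : ℕ, (⟨fr, .or, [w]⟩ : Entry).kind = .and → (⟨fr, .or, [w]⟩ : Entry).ins ≠ [] →
    ∃ x y, (⟨fr, .or, [w]⟩ : Entry).ins = [x, y] ∧ ∃ l r,
      T (.two l r) ∧ L.below x ⊆ l.leaves.toFinset ∧ L.below y ⊆ r.leaves.toFinset := by simp
  cases W with
  | none =>
    have hvc : vc = 0 := hW.mp rfl
    obtain ⟨g₁, r₁⟩ := h.copy mx hx
    simp only [Net.conj, hvc, lt_irrefl, and_false, if_false, Nat.add_sub_cancel]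
    refine ⟨g₁, ?_, hs.cons g₁.ok (hor _), List.suffix_cons _ _, le_rfl⟩
    have : V.merge none = V := by cases V <;> rfl
    rw [this]
    exact r₁.congr fun ν => by simp [hy.none hf rfl ν]
  | some r =>
    have hvc : 0 < vc := Nat.pos_of_ne_zero fun h0 => by simpa using hW.mpr h0
    obtain ⟨g₁, r₁⟩ := h.copy my hy
    cases V with
    | none =>
      have hvp : vp = 0 := hV.mp rfl
      simp only [Net.conj, hvp, hvc, lt_irrefl, false_and, if_false, if_true, Nat.add_sub_cancel]
      refine ⟨g₁, ?_, hs.cons g₁.ok (hor _), List.suffix_cons _ _, le_rfl⟩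
      exact r₁.congr fun ν => by simp [hx.none he rfl ν]
    | some l =>
      have hvp : 0 < vp := Nat.pos_of_ne_zero fun h0 => by simpa using hV.mpr h0
      simp only [Net.conj, hvp, hvc, and_self, if_true, Nat.add_sub_cancel]
      have hne : x ≠ fr := fun hh => h.not_mem (hh ▸ mx)
      obtain ⟨g₂, r₂, s₂⟩ := g₁.and hne (hx.suffix g₁.ok (List.suffix_cons _ _)) r₁ hd
        (hT _ (BinTree.self_mem_subtrees _)) (hs.cons g₁.ok (hor _))
      exact ⟨g₂, r₂, s₂, (List.suffix_cons _ _).trans (List.suffix_cons _ _), Nat.le_succ _⟩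

/-- The disjunction of the former entry `w` of a table with a new gate `z`. -/
def disj (L : Net) (z w : ℕ) : Net × ℕ :=
  if 0 < w then (⟨z + 1, .or, [w - 1, z]⟩ :: L, z + 1) else (L, z)

theorem Good.disj {L : Net} {z w : ℕ} (h : L.Good (z + 1)) {V : VTree}
    {P Q : (ℕ → Bool) → Prop} (hw : L.Repr V P w) (hz : L.Repr V Q (z + 1)) (hne : w ≠ z + 1)
    (hPQ : ∀ ν, ¬ (P ν ∧ Q ν)) {T : BinTree → Prop} (hs : L.Structured T) :
    (L.disj z w).1.Good ((L.disj z w).2 + 1) ∧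
      (L.disj z w).1.Repr V (fun ν => P ν ∨ Q ν) ((L.disj z w).2 + 1) ∧
      (L.disj z w).1.Structured T ∧ L <:+ (L.disj z w).1 := by
  rcases Nat.eq_zero_or_pos w with rfl | h0
  · simp only [Net.disj, lt_irrefl, if_false]
    exact ⟨h, hz.congr fun ν => by simp [hw.zero rfl ν], hs, List.suffix_refl _⟩
  · obtain ⟨x, rfl⟩ : ∃ x, w = x + 1 := ⟨w - 1, by omega⟩
    obtain ⟨g, r⟩ := h.or (by omega : x ≠ z) hw hz hPQ
    simp only [Net.disj, h0, if_true, Nat.add_sub_cancel]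
    exact ⟨g, r, hs.cons g.ok (by simp), List.suffix_cons _ _⟩

end Net

/-! ### Lists and trees in arrays -/

/-- The first `n` elements of an array. -/
def pre (A : ℕ → ℕ) (n : ℕ) : List ℕ := (List.range n).map A

theorem pre_length (A : ℕ → ℕ) (n : ℕ) : (pre A n).length = n := by simp [pre]

theorem pre_succ (A : ℕ → ℕ) (n : ℕ) : pre A (n + 1) = pre A n ++ [A n] := by
  simp [pre, List.range_succ]

theorem pre_congr {A B : ℕ → ℕ} {n : ℕ} (h : ∀ i < n, A i = B i) : pre A n = pre B n :=
  List.map_congr_left fun i hi => h i (List.mem_range.mp hi)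

theorem getElem_pre (A : ℕ → ℕ) (n i : ℕ) (h : i < (pre A n).length) : (pre A n)[i] = A i := by
  simp [pre]

theorem mem_pre {A : ℕ → ℕ} {n a : ℕ} : a ∈ pre A n ↔ ∃ i < n, A i = a := by
  simp [pre]

theorem pre_update (A : ℕ → ℕ) {n k a : ℕ} (h : n ≤ k) :
    pre (Function.update A k a) n = pre A n :=
  pre_congr fun i hi => Function.update_of_ne (by omega) _ _

theorem pre_push (A : ℕ → ℕ) (n a : ℕ) : pre (Function.update A n a) (n + 1) = pre A n ++ [a] := by
  rw [pre_succ, pre_update _ le_rfl, Function.update_self]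

theorem pre_push₂ (A : ℕ → ℕ) (n a b : ℕ) :
    pre (Function.update (Function.update A n a) (n + 1) b) (n + 2) = pre A n ++ [a, b] := by
  rw [pre_push, pre_push, List.append_assoc]; rfl

/-- The arrays contain the code of the gates and wires of `L`. -/
structure NetRep (L : Net) (gl wl : ℕ) (go wo : ℕ → ℕ) : Prop where
  gate : pre go gl = L.gateCode
  wire : pre wo wl = L.wireCode

/-- The node `a` of the heap is the root of the tree `t`; nodes are positive numbers, with their
children in `vl` and `vr`, except that leaves have zero in `vl` and their label in `vr`. -/
def TreeRep (vl vr : ℕ → ℕ) (nv : ℕ) : ℕ → BinTree → Prop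
  | a, .leaf u => (0 < a ∧ a ≤ nv) ∧ vl a = 0 ∧ vr a = u
  | _, .one _ => False
  | a, .two l r => (0 < a ∧ a ≤ nv) ∧ 0 < vl a ∧ TreeRep vl vr nv (vl a) l ∧
      TreeRep vl vr nv (vr a) r

/-- The same for v-trees, with zero for the empty tree. -/
def VTreeRep (vl vr : ℕ → ℕ) (nv : ℕ) (a : ℕ) : VTree → Prop
  | none => a = 0
  | some t => TreeRep vl vr nv a t

theorem TreeRep.pos {vl vr : ℕ → ℕ} {nv a : ℕ} {t : BinTree} (h : TreeRep vl vr nv a t) :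
    0 < a ∧ a ≤ nv := by
  cases t with
  | one t => exact h.elim
  | _ => exact h.1

theorem TreeRep.write {vl vr : ℕ → ℕ} {nv nv' a x y : ℕ} {t : BinTree} (h : TreeRep vl vr nv a t)
    (hnv : nv ≤ nv') :
    TreeRep (Function.update vl (nv + 1) x) (Function.update vr (nv + 1) y) nv' a t := by
  induction t generalizing a with
  | leaf u =>
    obtain ⟨h1, h2, h3⟩ := h
    have : a ≠ nv + 1 := by omega
    exact ⟨by omega, by rwa [Function.update_of_ne this], by rwa [Function.update_of_ne this]⟩
  | one t => exact h.elim
  | two l r ihl ihr =>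
    obtain ⟨h1, h2, h3, h4⟩ := h
    have : a ≠ nv + 1 := by omega
    refine ⟨by omega, ?_, ?_, ?_⟩ <;> simp only [Function.update_of_ne this]
    exacts [h2, ihl h3, ihr h4]

theorem VTreeRep.write {vl vr : ℕ → ℕ} {nv nv' a x y : ℕ} {V : VTree} (h : VTreeRep vl vr nv a V)
    (hnv : nv ≤ nv') :
    VTreeRep (Function.update vl (nv + 1) x) (Function.update vr (nv + 1) y) nv' a V := by
  cases V with
  | none => exact h
  | some t => exact TreeRep.write h hnv

theorem VTreeRep.eq_none_iff {vl vr : ℕ → ℕ} {nv a : ℕ} {V : VTree} (h : VTreeRep vl vr nv a V) :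
    V = none ↔ a = 0 := by
  cases V with
  | none => exact iff_of_true rfl h
  | some t => exact iff_of_false (by simp) (TreeRep.pos h).1.ne'

/-! ### Decoding and checking states -/

/-- The array `G` overwritten by `F` at the indices in `l`. -/
def patch (l : List ℕ) (F G : ℕ → ℕ) (g : ℕ) : ℕ := if g ∈ l then F g else G g

theorem patch_nil (F G : ℕ → ℕ) : patch [] F G = G := by
  funext g; simp [patch]

theorem update_patch (f F G : ℕ → ℕ) (i : ℕ) :
    Function.update (patch (pre f i) F G) (f i) (F (f i)) = patch (pre f (i + 1)) F G := by
  funext g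
  simp only [patch, pre_succ]
  by_cases hg : g = f i
  · subst hg; simp
  · rw [Function.update_of_ne hg]
    simp [hg, patch]

theorem digit_val (x i : ℕ) :
    x / 4 ^ i - (x / 4 ^ i / 2 + x / 4 ^ i / 2) = (x.testBit (2 * i)).toNat := by
  rw [Nat.toNat_testBit, show (2 : ℕ) ^ (2 * i) = 4 ^ i by rw [pow_mul]; norm_num]
  omega

theorem digit_sat (x i : ℕ) :
    x / 4 ^ i / 2 - (x / 4 ^ (i + 1) + x / 4 ^ (i + 1)) = (x.testBit (2 * i + 1)).toNat := by
  rw [Nat.toNat_testBit, pow_succ, pow_succ, pow_mul, ← Nat.div_div_eq_div_mul,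
    ← Nat.div_div_eq_div_mul, show (2 : ℕ) ^ 2 = 4 by norm_num]
  omega

theorem digit_next (x i : ℕ) : x / 4 ^ i / 2 / 2 = x / 4 ^ (i + 1) := by
  rw [pow_succ, ← Nat.div_div_eq_div_mul, Nat.div_div_eq_div_mul _ 2 2]

theorem idxOf_pre {f : ℕ → ℕ} {m i : ℕ} (hl : (pre f m).Nodup) (hi : i < m) :
    (pre f m).idxOf (f i) = i := by
  have h := hl.idxOf_getElem i (by rwa [pre_length])
  rwa [getElem_pre] at h

/-- The values of the gates of the bag `l` in the state `x`, plus one. -/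
def valArr (l : List ℕ) (x : ℕ) (A : ℕ → ℕ) : ℕ → ℕ :=
  patch l (fun g => 1 + (valBit l x g).toNat) A

/-- Whether the gates of the bag `l` are satisfied in the state `x`. -/
def satArr (l : List ℕ) (x : ℕ) (A : ℕ → ℕ) : ℕ → ℕ :=
  patch l (fun g => (satBit l x g).toNat) A

theorem decodeA_spec (s : S) {l : List ℕ} (hl : l = pre (fun j => s.inp (s.b + j)) s.m)
    (hn : l.Nodup) : Spec decodeA s (40 * s.m + 10) fun s' => ∃ j t g h,
      s' = { s with j := j, t := t, g := g, h := h,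
                    va := valArr l s.x s.va, sa := satArr l s.x s.sa } := by
  subst hl
  set f := fun j => s.inp (s.b + j)
  unfold decodeA
  refine Spec.mono (Spec.seq (t₁ := 4) (t₂ := s.m * (33 + 3) + 2)
    (R := fun s' => s' = { s with j := 0, t := s.x }) (.straight rfl (by decide) rfl) ?_)
    (fun _ h => h) (by omega)
  rintro _ rfl
  refine .rep (fun i s' => ∃ g h, s' = { s with
      j := i, t := s.x / 4 ^ i, g := g, h := h,
      va := patch (pre f i) (fun g => 1 + (valBit (pre f s.m) s.x g).toNat) s.va,
      sa := patch (pre f i) (fun g => (satBit (pre f s.m) s.x g).toNat) s.sa })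
    s.m rfl ⟨s.g, s.h, ?_⟩ ?_ ?_
  · simp only [pre, List.range_zero, List.map_nil, patch_nil, pow_zero, Nat.div_one]
  · rintro i hi _ ⟨g, h, rfl⟩
    refine .straight rfl (by decide) ⟨f i, s.x / 4 ^ i / 2, ?_⟩
    rw [← update_patch f, ← update_patch f]
    simp only [valBit, satBit, idxOf_pre hn hi, ← digit_val, ← digit_sat, ← digit_next]
    simp only [decodeDigitA, Cmd.den, Expr.eval, Expr.eval_add, Expr.eval_sub, Expr.eval_ofNat, S.get, S.set,
      S.getA, S.setA]
    rfl
  · rintro _ ⟨g, h, rfl⟩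
    exact ⟨_, _, _, _, rfl⟩

theorem decodeB_spec (s : S) {l : List ℕ} (hl : l = pre (fun j => s.inp (s.bc + j)) s.mc)
    (hn : l.Nodup) : Spec decodeB s (40 * s.mc + 10) fun s' => ∃ j t g h,
      s' = { s with j := j, t := t, g := g, h := h,
                    vb := valArr l s.y s.vb, sb := satArr l s.y s.sb } := by
  subst hl
  set f := fun j => s.inp (s.bc + j)
  unfold decodeB
  refine Spec.mono (Spec.seq (t₁ := 4) (t₂ := s.mc * (33 + 3) + 2)
    (R := fun s' => s' = { s with j := 0, t := s.y }) (.straight rfl (by decide) rfl) ?_)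
    (fun _ h => h) (by omega)
  rintro _ rfl
  refine .rep (fun i s' => ∃ g h, s' = { s with
      j := i, t := s.y / 4 ^ i, g := g, h := h,
      vb := patch (pre f i) (fun g => 1 + (valBit (pre f s.mc) s.y g).toNat) s.vb,
      sb := patch (pre f i) (fun g => (satBit (pre f s.mc) s.y g).toNat) s.sb })
    s.mc rfl ⟨s.g, s.h, ?_⟩ ?_ ?_
  · simp only [pre, List.range_zero, List.map_nil, patch_nil, pow_zero, Nat.div_one]
  · rintro i hi _ ⟨g, h, rfl⟩
    refine .straight rfl (by decide) ⟨f i, s.y / 4 ^ i / 2, ?_⟩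
    rw [← update_patch f, ← update_patch f]
    simp only [valBit, satBit, idxOf_pre hn hi, ← digit_val, ← digit_sat, ← digit_next]
    simp only [decodeDigitB, Cmd.den, Expr.eval, Expr.eval_add, Expr.eval_sub, Expr.eval_ofNat, S.get, S.set,
      S.getA, S.setA]
    rfl
  · rintro _ ⟨g, h, rfl⟩
    exact ⟨_, _, _, _, rfl⟩

theorem clearA_spec (s : S) {l : List ℕ} (hl : l = pre (fun j => s.inp (s.b + j)) s.m) :
    Spec clearA s (30 * s.m + 10) fun s' => ∃ j g, s' = { s with
      j := j, g := g, va := patch l (fun _ => 0) s.va, sa := patch l (fun _ => 0) s.sa } := by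
  subst hl
  set f := fun j => s.inp (s.b + j)
  unfold clearA
  refine Spec.mono (Spec.seq (t₁ := 2) (t₂ := s.m * (16 + 3) + 2)
    (R := fun s' => s' = { s with j := 0 }) (.straight rfl (by decide) rfl) ?_)
    (fun _ h => h) (by omega)
  rintro _ rfl
  refine .rep (fun i s' => ∃ g, s' = { s with
      j := i, g := g, va := patch (pre f i) (fun _ => 0) s.va, sa := patch (pre f i) (fun _ => 0) s.sa })
    s.m rfl ⟨s.g, ?_⟩ ?_ ?_
  · simp only [pre, List.range_zero, List.map_nil, patch_nil]
  · rintro i hi _ ⟨g, rfl⟩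
    refine .straight rfl (by decide) ⟨f i, ?_⟩
    rw [← update_patch f, ← update_patch f]
    rfl
  · rintro _ ⟨g, rfl⟩
    exact ⟨_, _, rfl⟩

theorem clearB_spec (s : S) {l : List ℕ} (hl : l = pre (fun j => s.inp (s.bc + j)) s.mc) :
    Spec clearB s (30 * s.mc + 10) fun s' => ∃ j g, s' = { s with
      j := j, g := g, vb := patch l (fun _ => 0) s.vb, sb := patch l (fun _ => 0) s.sb } := by
  subst hl
  set f := fun j => s.inp (s.bc + j)
  unfold clearB
  refine Spec.mono (Spec.seq (t₁ := 2) (t₂ := s.mc * (16 + 3) + 2)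
    (R := fun s' => s' = { s with j := 0 }) (.straight rfl (by decide) rfl) ?_)
    (fun _ h => h) (by omega)
  rintro _ rfl
  refine .rep (fun i s' => ∃ g, s' = { s with
      j := i, g := g, vb := patch (pre f i) (fun _ => 0) s.vb, sb := patch (pre f i) (fun _ => 0) s.sb })
    s.mc rfl ⟨s.g, ?_⟩ ?_ ?_
  · simp only [pre, List.range_zero, List.map_nil, patch_nil]
  · rintro i hi _ ⟨g, rfl⟩
    refine .straight rfl (by decide) ⟨f i, ?_⟩
    rw [← update_patch f, ← update_patch f]
    rfl
  · rintro _ ⟨g, rfl⟩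
    exact ⟨_, _, rfl⟩

/-- The input gates, their types and wires, and the digits of the state `x`, as they are used by the
check of a state. -/
structure Checkable (C : Circuit) (l : List ℕ) (x : ℕ) (inp kd off ix wm va sa : ℕ → ℕ)
    (b m oG : ℕ) : Prop where
  bag : l = pre (fun j => inp (b + j)) m
  va : ∀ g ∈ l, va g = 1 + (valBit l x g).toNat
  sa : ∀ g ∈ l, sa g = (satBit l x g).toNat
  kd : ∀ g ∈ l, kd g = (C.kind g).code
  wm : ∀ h ∈ l, ∀ g ∈ l, 0 < wm (off h + ix g) ↔ C.Wire h g
  oG : oG = C.output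

/-- A gate with inputs is a NOT-gate if `k < 2`; it is violated by an input of the same value, any other
gate by an input of a different value if its own value is weak. -/
theorem checkPair_den (s : S) {k : GateKind} {a b : Bool} {P : Prop} (hk : s.k = k.code)
    (hb : s.va (s.inp (s.b + s.y)) = 1 + b.toNat) (ha : s.va s.g = 1 + a.toNat)
    (hw : 0 < s.wm (s.off (s.inp (s.b + s.y)) + s.ix s.g) ↔ P) (hP : k = .var → ¬ P)
    (hwk : 0 < s.wk ↔ Weak k a) (hsg : s.sg ≤ 1) (hws : 0 < s.wk → 0 < s.sg) :
    ∃ h w f ok sg,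
      checkPair.den s = { s with h := h, w := w, f := f, ok := ok, sg := sg, y := s.y + 1 } ∧
      sg ≤ 1 ∧ (0 < ok ↔ 0 < s.ok ∧ (P → Tolerates k a b)) ∧ (0 < sg ↔ 0 < s.sg ∨ P ∧ b = a) := by
  simp only [checkPair, Cmd.den, Expr.eval, Expr.eval_add, Expr.eval_sub, Expr.eval_ofNat, S.get, S.set,
    S.getA, S.setA]
  refine ⟨_, _, _, _, _, rfl, ?_⟩
  simp only [sel, hk, hb, ha]
  by_cases hwi : P
  · have hnw := fun hk => hP hk hwi
    simp only [hw.mpr hwi, if_true, hwi, true_and, true_imp_iff]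
    by_cases h0 : 0 < s.wk
    · have h1 := hws h0
      have h2 := hwk.mp h0
      revert hnw h2
      cases k <;> cases b <;> cases a <;> simp [GateKind.code, Tolerates, Weak, h0, h1, hsg]
    · have h2 := fun hh => h0 (hwk.mpr hh)
      revert hnw h2
      cases k <;> cases b <;> cases a <;> simp [GateKind.code, Tolerates, Weak, h0, hsg]
  · simp [hw.not.mpr hwi, hwi, hsg]

theorem checkPairs_spec {C : Circuit} {l : List ℕ} {x : ℕ} (s : S)
    (hs : Checkable C l x s.inp s.kd s.off s.ix s.wm s.va s.sa s.b s.m s.oG) (hg : s.g ∈ l)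
    (hk : s.k = (C.kind s.g).code) (hwk : 0 < s.wk ↔ Weak (C.kind s.g) (valBit l x s.g))
    (hsg : s.sg = s.wk) (hsg' : s.wk ≤ 1) (hy : s.y = 0) :
    Spec (.rep (.v .m) checkPair) s (80 * s.m + 10) fun s' => ∃ h w f ok sg y,
      s' = { s with h := h, w := w, f := f, ok := ok, sg := sg, y := y } ∧ sg ≤ 1 ∧
      (0 < ok ↔ 0 < s.ok ∧
        ∀ h ∈ l, C.Wire h s.g → Tolerates (C.kind s.g) (valBit l x s.g) (valBit l x h)) ∧
      (0 < sg ↔ Weak (C.kind s.g) (valBit l x s.g) ∨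
        ∃ h ∈ l, C.Wire h s.g ∧ valBit l x h = valBit l x s.g) := by
  have hl := hs.bag
  set f := fun j => s.inp (s.b + j) with hf
  refine Spec.mono (.rep (t := 70) (fun i s' => ∃ h w f' ok sg,
      s' = { s with h := h, w := w, f := f', ok := ok, sg := sg, y := i } ∧ sg ≤ 1 ∧
      (0 < ok ↔ 0 < s.ok ∧
        ∀ h ∈ pre f i, C.Wire h s.g → Tolerates (C.kind s.g) (valBit l x s.g) (valBit l x h)) ∧
      (0 < sg ↔ Weak (C.kind s.g) (valBit l x s.g) ∨
        ∃ h ∈ pre f i, C.Wire h s.g ∧ valBit l x h = valBit l x s.g))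
    s.m rfl ⟨s.h, s.w, s.f, s.ok, s.sg, ?_⟩ ?_ (fun _ h => h)) ?_ ?_
  · refine ⟨by rw [← hy], by omega, by simp [pre], ?_⟩
    rw [hsg, hwk]
    simp [pre]
  · rintro i hi _ ⟨h, w, f', ok, sg, rfl, h1, h2, h3⟩
    have hil : f i ∈ l := by rw [hl]; exact mem_pre.mpr ⟨i, hi, rfl⟩
    refine .straight rfl (by decide) ?_
    obtain ⟨h', w', f'', ok', sg', e, h1', h2', h3'⟩ := checkPair_den
      { s with h := h, w := w, f := f', ok := ok, sg := sg, y := i } hk (hs.va _ hil) (hs.va _ hg)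
      (hs.wm _ hil _ hg) not_wire_of_var hwk h1 fun h0 => h3.mpr (.inl (hwk.mp h0))
    refine ⟨h', w', f'', ok', sg', e, h1', ?_, ?_⟩
    · rw [h2', h2, pre_succ, and_assoc]
      simp only [List.mem_append, List.mem_singleton, or_imp, forall_and, forall_eq, hf]
    · rw [h3', h3, pre_succ, or_assoc]
      simp only [List.mem_append, List.mem_singleton, or_and_right, exists_or, exists_eq_left, hf]
  · rintro _ ⟨h, w, f', ok, sg, rfl, h1, h2, h3⟩
    rw [← hl] at h2 h3
    exact ⟨_, _, _, _, _, _, rfl, h1, h2, h3⟩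
  · simp only [Expr.cost]; omega

theorem checkGate_spec {C : Circuit} {l : List ℕ} {x : ℕ} (s : S)
    (hs : Checkable C l x s.inp s.kd s.off s.ix s.wm s.va s.sa s.b s.m s.oG) (hj : s.j < s.m) :
    Spec checkGate s (80 * s.m + 80) fun s' => ∃ g k wk h w f ok sg y,
      s' = { s with g := g, k := k, wk := wk, h := h, w := w, f := f, ok := ok, sg := sg, y := y,
                    j := s.j + 1 } ∧
      (0 < ok ↔ 0 < s.ok ∧
        (∀ h ∈ l, C.Wire h (s.inp (s.b + s.j)) → Tolerates (C.kind (s.inp (s.b + s.j)))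
          (valBit l x (s.inp (s.b + s.j))) (valBit l x h)) ∧
        (satBit l x (s.inp (s.b + s.j)) = true ↔
          Weak (C.kind (s.inp (s.b + s.j))) (valBit l x (s.inp (s.b + s.j))) ∨
          ∃ h ∈ l, C.Wire h (s.inp (s.b + s.j)) ∧
            valBit l x h = valBit l x (s.inp (s.b + s.j))) ∧
        (s.inp (s.b + s.j) = C.output → valBit l x (s.inp (s.b + s.j)) = true)) := by
  have hg : s.inp (s.b + s.j) ∈ l := by rw [hs.bag]; exact mem_pre.mpr ⟨s.j, hj, rfl⟩
  have hk := hs.kd _ hg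
  have hv := hs.va _ hg
  generalize hgd : s.inp (s.b + s.j) = g at *
  unfold checkGate
  refine Spec.mono (Spec.seq (t₁ := 30) (t₂ := (80 * s.m + 10) + 40)
    (R := fun s' => ∃ wk, s' = { s with
      g := g, k := (C.kind g).code, wk := wk, sg := wk, y := 0 } ∧ wk ≤ 1 ∧
      (0 < wk ↔ Weak (C.kind g) (valBit l x g)))
    (.straight rfl (by decide) ?_) ?_) (fun _ h => h) (by omega)
  · simp only [checkStart, Cmd.den, Expr.eval, Expr.eval_add, Expr.eval_sub, Expr.eval_ofNat, S.get, S.set,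
    S.getA, S.setA]
    rw [hgd, hk, hv]
    refine ⟨_, rfl, ?_⟩
    simp only [sel]
    cases C.kind g <;> cases valBit l x g <;> simp [GateKind.code, Weak]
  · rintro _ ⟨wk, rfl, hwk1, hwk⟩
    refine Spec.seq (checkPairs_spec _ hs hg rfl hwk rfl hwk1 rfl) ?_
    rintro _ ⟨h, w, f, ok, sg, y, rfl, hsg1, hok, hsg⟩
    refine .straight rfl (by decide) ?_
    simp only [checkEnd, Cmd.den, Expr.eval, Expr.eval_add, Expr.eval_sub, Expr.eval_ofNat, S.get, S.set,
      S.getA, S.setA]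
    refine ⟨_, _, _, _, _, _, _, _, _, rfl, ?_⟩
    have hsa := hs.sa g hg
    simp only [sel]
    rw [← hsg, ← and_assoc, ← hok, hsa, hv, hs.oG]
    rcases lt_trichotomy g C.output with h1 | h1 | h1
    · simp only [h1, h1.ne, if_true, false_imp_iff, and_true]
      cases satBit l x g <;> rcases (by omega : sg = 0 ∨ sg = 1) with h2 | h2 <;>
        simp [h2]
    · subst h1
      simp only [lt_irrefl, if_false, true_imp_iff]
      cases satBit l x C.output <;> rcases (by omega : sg = 0 ∨ sg = 1) with h2 | h2 <;>
        cases valBit l x C.output <;> simp [h2]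
    · simp only [h1, h1.ne', h1.not_gt, if_true, if_false, false_imp_iff, and_true]
      cases satBit l x g <;> rcases (by omega : sg = 0 ∨ sg = 1) with h2 | h2 <;>
        simp [h2]

theorem checkState_spec {C : Circuit} {l : List ℕ} {x : ℕ} (s : S)
    (hs : Checkable C l x s.inp s.kd s.off s.ix s.wm s.va s.sa s.b s.m s.oG) :
    Spec checkState s (s.m * (80 * s.m + 90) + 20) fun s' => ∃ g k wk h w f ok sg y j,
      s' = { s with g := g, k := k, wk := wk, h := h, w := w, f := f, ok := ok, sg := sg, y := y,
                    j := j } ∧ (0 < ok ↔ LocallyOk C l x) := by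
  have hl := hs.bag
  unfold checkState
  refine Spec.mono (Spec.seq (t₁ := 4) (t₂ := s.m * ((80 * s.m + 80) + 3) + 2)
    (R := fun s' => s' = { s with ok := 1, j := 0 }) (.straight rfl (by decide) rfl) ?_)
    (fun _ h => h) (by ring_nf; omega)
  rintro _ rfl
  refine .rep (fun i s' => ∃ g k wk h w f ok sg y,
    s' = { s with
      g := g, k := k, wk := wk, h := h, w := w, f := f, ok := ok, sg := sg, y := y, j := i } ∧
    (0 < ok ↔ ∀ g ∈ pre (fun j => s.inp (s.b + j)) i,
      (∀ h ∈ l, C.Wire h g → Tolerates (C.kind g) (valBit l x g) (valBit l x h)) ∧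
      (satBit l x g = true ↔ Weak (C.kind g) (valBit l x g) ∨
        ∃ h ∈ l, C.Wire h g ∧ valBit l x h = valBit l x g) ∧
      (g = C.output → valBit l x g = true))) s.m rfl ?_ ?_ ?_
  · exact ⟨_, _, _, _, _, _, _, _, _, rfl, by simp [pre]⟩
  · rintro i hi _ ⟨g, k, wk, h, w, f, ok, sg, y, rfl, hok⟩
    refine (checkGate_spec { s with
      g := g, k := k, wk := wk, h := h, w := w, f := f, ok := ok, sg := sg, y := y, j := i }
      hs hi).mono ?_ le_rfl
    rintro _ ⟨g', k', wk', h', w', f', ok', sg', y', rfl, hok'⟩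
    refine ⟨_, _, _, _, _, _, _, _, _, rfl, (hok'.trans (and_congr_left' hok)).trans ?_⟩
    rw [pre_succ, List.forall_mem_append, List.forall_mem_singleton]
  · rintro _ ⟨g, k, wk, h, w, f, ok, sg, y, rfl, hok⟩
    refine ⟨_, _, _, _, _, _, _, _, _, _, rfl, ?_⟩
    rw [hok, ← hl]
    rfl

theorem compat_spec {l l' : List ℕ} {x y : ℕ} (s : S)
    (hl : l' = pre (fun j => s.inp (s.bc + j)) s.mc)
    (hva : ∀ g, s.va g = if g ∈ l then 1 + (valBit l x g).toNat else 0)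
    (hvb : ∀ g ∈ l', s.vb g = 1 + (valBit l' y g).toNat)
    (hsb : ∀ g ∈ l', s.sb g = (satBit l' y g).toNat) :
    Spec compat s (60 * s.mc + 20) fun s' => ∃ g ok j,
      s' = { s with g := g, ok := ok, j := j } ∧ (0 < ok ↔ Compat l l' x y) := by
  unfold compat
  refine Spec.mono (Spec.seq (t₁ := 4) (t₂ := s.mc * (50 + 3) + 2)
    (R := fun s' => s' = { s with ok := 1, j := 0 }) (.straight rfl (by decide) rfl) ?_)
    (fun _ h => h) (by omega)
  rintro _ rfl
  refine .rep (fun i s' => ∃ g ok, s' = { s with g := g, ok := ok, j := i } ∧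
    (0 < ok ↔ ∀ g ∈ pre (fun j => s.inp (s.bc + j)) i,
      if g ∈ l then valBit l x g = valBit l' y g else satBit l' y g = true)) s.mc rfl ?_ ?_ ?_
  · exact ⟨_, _, rfl, by simp [pre]⟩
  · rintro i hi _ ⟨g, ok, rfl, hok⟩
    refine .straight rfl (by decide) ?_
    simp only [compatGate, Cmd.den, Expr.eval, Expr.eval_add, Expr.eval_sub, Expr.eval_ofNat, S.get, S.set,
      S.getA, S.setA]
    refine ⟨_, _, rfl, ?_⟩
    have hg : s.inp (s.bc + i) ∈ l' := by rw [hl]; exact mem_pre.mpr ⟨i, hi, rfl⟩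
    rw [pre_succ, List.forall_mem_append, List.forall_mem_singleton, ← hok, hvb _ hg, hsb _ hg,
      hva]
    simp only [sel]
    by_cases h : s.inp (s.bc + i) ∈ l
    · simp only [h, if_true]
      cases valBit l x (s.inp (s.bc + i)) <;> cases valBit l' y (s.inp (s.bc + i)) <;> simp
    · simp only [h, if_false]
      cases satBit l' y (s.inp (s.bc + i)) <;> simp
  · rintro _ ⟨g, ok, rfl, hok⟩
    refine ⟨_, _, _, rfl, ?_⟩
    rw [hok, ← hl]
    rfl

theorem testBit_push {r k : ℕ} (h : r < 2 ^ k) (b : Bool) :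
    (if b = true then r + 2 ^ k else r) < 2 ^ (k + 1) ∧
    (∀ i < k, (if b = true then r + 2 ^ k else r).testBit i = r.testBit i) ∧
    (if b = true then r + 2 ^ k else r).testBit k = b := by
  cases b
  · simp only [Bool.false_eq_true, if_false, implies_true, true_and]
    exact ⟨by rw [pow_succ]; omega, Nat.testBit_lt_two_pow h⟩
  · simp only [if_true]
    refine ⟨by rw [pow_succ]; omega, fun i hi => ?_, ?_⟩
    · rw [add_comm, Nat.testBit_two_pow_add_gt hi]
    · rw [add_comm, Nat.testBit_two_pow_add_eq, Nat.testBit_lt_two_pow h]; rfl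

theorem encode_spec {l l' : List ℕ} {x y : ℕ} (s : S)
    (hl : l = pre (fun j => s.inp (s.b + j)) s.m) (hn : l.Nodup)
    (hva : ∀ g ∈ l, s.va g = 1 + (valBit l x g).toNat)
    (hsa : ∀ g ∈ l, s.sa g = (satBit l x g).toNat)
    (hsb : ∀ g, s.sb g = if g ∈ l' then (satBit l' y g).toNat else 0) :
    Spec encode s (60 * s.m + 20) fun s' => ∃ r pw j g,
      s' = { s with r := r, pw := pw, j := j, g := g } ∧ IsJoin l l' x y r := by
  unfold encode
  refine Spec.mono (Spec.seq (t₁ := 6) (t₂ := s.m * (50 + 3) + 2)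
    (R := fun s' => s' = { s with r := 0, pw := 1, j := 0 }) (.straight rfl (by decide) rfl) ?_)
    (fun _ h => h) (by omega)
  rintro _ rfl
  subst hl
  set f := fun j => s.inp (s.b + j) with hf
  refine .rep (fun i s' => ∃ r g,
    s' = { s with r := r, pw := 2 ^ (2 * i), j := i, g := g } ∧ r < 2 ^ (2 * i) ∧
    ∀ k < i, r.testBit (2 * k) = valBit (pre f s.m) x (f k) ∧
      (r.testBit (2 * k + 1) = true ↔ satBit (pre f s.m) x (f k) = true ∨
        f k ∈ l' ∧ satBit l' y (f k) = true)) s.m rfl ?_ ?_ ?_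
  · exact ⟨_, _, rfl, by simp, by simp⟩
  · rintro i hi _ ⟨r, g, rfl, hr, hbits⟩
    refine .straight rfl (by decide) ?_
    simp only [encodeDigit, Cmd.den, Expr.eval, Expr.eval_add, Expr.eval_sub, Expr.eval_ofNat, S.get, S.set,
      S.getA, S.setA]
    have hg : f i ∈ pre f s.m := mem_pre.mpr ⟨i, hi, rfl⟩
    have h1 : ∀ (b : Bool) (u v : ℕ), sel 1 (1 + b.toNat) u v = if b = true then u else v := by
      intro b u v; cases b <;> simp [sel]
    have h2 : sel 0 (s.sa (f i) + s.sb (f i)) = fun u v : ℕ =>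
        if (satBit (pre f s.m) x (f i) || (decide (f i ∈ l') && satBit l' y (f i))) = true
          then u else v := by
      funext u v
      rw [hsa _ hg, hsb]
      by_cases h : f i ∈ l' <;> cases satBit (pre f s.m) x (f i) <;>
        cases satBit l' y (f i) <;> simp [h, sel]
    have e1 : (2 : ℕ) ^ (2 * i) + 2 ^ (2 * i) = 2 ^ (2 * i + 1) := by rw [pow_succ]; omega
    have e2 : (2 : ℕ) ^ (2 * i + 1) + 2 ^ (2 * i + 1) = 2 ^ (2 * (i + 1)) := by
      rw [Nat.mul_succ, pow_succ, pow_succ, pow_succ]; omega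
    simp only [hf] at hg h2
    simp only [hva _ hg, h1, h2, e1, e2]
    refine ⟨_, _, rfl, ?_⟩
    obtain ⟨p1, p2, p3⟩ := testBit_push hr (valBit (pre f s.m) x (s.inp (s.b + i)))
    obtain ⟨q1, q2, q3⟩ := testBit_push p1 (satBit (pre f s.m) x (s.inp (s.b + i)) ||
      (decide (s.inp (s.b + i) ∈ l') && satBit l' y (s.inp (s.b + i))))
    refine ⟨q1, fun k hk => ?_⟩
    rcases Nat.lt_succ_iff_lt_or_eq.mp hk with hk | rfl
    · rw [q2 _ (by omega), q2 _ (by omega), p2 _ (by omega), p2 _ (by omega)]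
      exact hbits k hk
    · rw [q2 _ (by omega), p3, q3]
      exact ⟨rfl, by simp [hf]⟩
  · rintro _ ⟨r, g, rfl, hr, hbits⟩
    refine ⟨_, _, _, _, rfl, ?_, fun g hg => ?_⟩
    · rw [pre_length, show 4 = 2 ^ 2 by norm_num, ← pow_mul]; exact hr
    · obtain ⟨k, hk, rfl⟩ := mem_pre.mp hg
      have := hbits k hk
      simp only [valBit, satBit, idxOf_pre hn hk] at this ⊢
      exact this

theorem NetRep.cons₁ {L : Net} {gl wl : ℕ} {go wo : ℕ → ℕ} (h : NetRep L gl wl go wo)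
    (nm x : ℕ) (k : GateKind) : NetRep (⟨nm, k, [x]⟩ :: L) (gl + 2) (wl + 2)
      (Function.update (Function.update go gl nm) (gl + 1) k.code)
      (Function.update (Function.update wo wl x) (wl + 1) nm) :=
  ⟨by rw [pre_push₂, h.gate, Net.gateCode_cons], by rw [pre_push₂, h.wire, Net.wireCode_cons]; rfl⟩

theorem NetRep.cons₀ {L : Net} {gl wl : ℕ} {go wo : ℕ → ℕ} (h : NetRep L gl wl go wo)
    (nm : ℕ) (k : GateKind) : NetRep (⟨nm, k, []⟩ :: L) (gl + 2) wl
      (Function.update (Function.update go gl nm) (gl + 1) k.code) wo :=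
  ⟨by rw [pre_push₂, h.gate, Net.gateCode_cons], by rw [h.wire, Net.wireCode_cons]; simp⟩

theorem NetRep.cons₂ {L : Net} {gl wl : ℕ} {go wo : ℕ → ℕ} (h : NetRep L gl wl go wo)
    (nm x y : ℕ) (k : GateKind) : NetRep (⟨nm, k, [x, y]⟩ :: L) (gl + 2) (wl + 2 + 2)
      (Function.update (Function.update go gl nm) (gl + 1) k.code)
      (Function.update (Function.update (Function.update (Function.update wo wl x) (wl + 1) nm)
        (wl + 2) y) (wl + 2 + 1) nm) :=
  ⟨by rw [pre_push₂, h.gate, Net.gateCode_cons],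
    by rw [pre_push₂, pre_push₂, h.wire, Net.wireCode_cons, List.append_assoc]; rfl⟩

/-- On the side of circuits, `joinGates` is `Net.conj` followed by `Net.disj`. -/
theorem joinGates_den (s : S) {L : Net} (h : NetRep L s.gl s.wl s.go s.wo) :
    ∃ w z gl wl go wo, joinGates.den s = { s with
        w := w, z := z, fr := z + 1, gl := gl, wl := wl, go := go, wo := wo,
        tab := Function.update s.tab (s.tt + s.r) (z + 1) } ∧
      z = ((L.conj s.fr s.e s.f s.vp s.vc).1.disj (L.conj s.fr s.e s.f s.vp s.vc).2
        (s.tab (s.tt + s.r))).2 ∧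
      NetRep ((L.conj s.fr s.e s.f s.vp s.vc).1.disj (L.conj s.fr s.e s.f s.vp s.vc).2
        (s.tab (s.tt + s.r))).1 gl wl go wo := by
  unfold joinGates newGate newWire useName
  by_cases hc : 0 < s.vc <;> by_cases hp : 0 < s.vp <;> by_cases ht : 0 < s.tab (s.tt + s.r) <;>
    simp only [sel, hc, hp, ht, if_true, if_false, Cmd.den, Expr.eval, Expr.eval_add, Expr.eval_sub, Expr.eval_ofNat, S.get, S.set,
      S.getA, S.setA] <;>
    simp only [Net.conj, Net.disj, hc, hp, ht, and_self, and_true, and_false, true_and, false_and,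
      if_true, if_false]
  · exact ⟨_, _, _, _, _, _, rfl, rfl, ((h.cons₁ _ _ .or).cons₂ _ _ _ .and).cons₂ _ _ _ .or⟩
  · exact ⟨_, _, _, _, _, _, rfl, rfl, (h.cons₁ _ _ .or).cons₂ _ _ _ .and⟩
  · exact ⟨_, _, _, _, _, _, rfl, rfl, (h.cons₁ _ _ .or).cons₂ _ _ _ .or⟩
  · exact ⟨_, _, _, _, _, _, rfl, rfl, h.cons₁ _ _ .or⟩
  · exact ⟨_, _, _, _, _, _, rfl, rfl, (h.cons₁ _ _ .or).cons₂ _ _ _ .or⟩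
  · exact ⟨_, _, _, _, _, _, rfl, rfl, h.cons₁ _ _ .or⟩
  · exact ⟨_, _, _, _, _, _, rfl, rfl, (h.cons₁ _ _ .or).cons₂ _ _ _ .or⟩
  · exact ⟨_, _, _, _, _, _, rfl, rfl, h.cons₁ _ _ .or⟩

/-! ### Merging two tables -/

section Join

variable (T : BinTree → Prop) (V W : VTree) (F G : ℕ → (ℕ → Bool) → Prop) (l l' : List ℕ)

/-- The tables at `tp` and `tc` describe two families `F` and `G` of Boolean functions, over the
variables of `V` and `W`, such that at most one pair of states leads to a given state. -/
structure JoinSetup (vp vc tt tp tc : ℕ) (L₀ : Net) (tab₀ : ℕ → ℕ) : Prop where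
  none₁ : V = none ↔ vp = 0
  none₂ : W = none ↔ vc = 0
  disj : List.Disjoint V.leaves W.leaves
  sub : ∀ t ∈ (V.merge W).subtrees, T t
  nodup₁ : l.Nodup
  nodup₂ : l'.Nodup
  table₁ : ∀ σ < 4 ^ l.length, L₀.Repr V (F σ) (tab₀ (tp + σ))
  table₂ : ∀ τ < 4 ^ l'.length, L₀.Repr W (G τ) (tab₀ (tc + τ))
  le₁ : tp + 4 ^ l.length ≤ tt
  le₂ : tc + 4 ^ l'.length ≤ tt
  bound₁ : ∀ σ ν, F σ ν → σ < 4 ^ l.length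
  bound₂ : ∀ τ ν, G τ ν → τ < 4 ^ l'.length
  unique : ∀ ν ρ σ τ σ' τ', Compat l l' σ τ → IsJoin l l' σ τ ρ → F σ ν → G τ ν →
    Compat l l' σ' τ' → IsJoin l l' σ' τ' ρ → F σ' ν → G τ' ν → σ = σ' ∧ τ = τ'

/-- The state `ρ` arises from a pair of states in `D`. -/
def Joined (D : ℕ → ℕ → Prop) (ρ : ℕ) (ν : ℕ → Bool) : Prop :=
  ∃ σ τ, D σ τ ∧ Compat l l' σ τ ∧ IsJoin l l' σ τ ρ ∧ F σ ν ∧ G τ ν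

/-- The situation when the pairs of states in `D` have been treated. -/
structure JoinInv (tt : ℕ) (L₀ : Net) (tab₀ : ℕ → ℕ) (D : ℕ → ℕ → Prop) (L : Net)
    (fr gl wl : ℕ) (go wo tab : ℕ → ℕ) : Prop where
  good : L.Good fr
  str : L.Structured T
  rep : NetRep L gl wl go wo
  suf : L₀ <:+ L
  var : ∀ e ∈ L, e.kind = .var → e ∈ L₀
  old : ∀ k < tt, tab k = tab₀ k
  new : ∀ k, tt + 4 ^ l.length ≤ k → tab k = 0
  table : ∀ ρ < 4 ^ l.length, L.Repr (V.merge W) (Joined F G l l' D ρ) (tab (tt + ρ))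

end Join

section

variable {T : BinTree → Prop} {V W : VTree} {F G : ℕ → (ℕ → Bool) → Prop} {l l' : List ℕ}
  {vp vc tt tp tc : ℕ} {L₀ : Net} {tab₀ : ℕ → ℕ} {D D' : ℕ → ℕ → Prop} {L : Net}
  {fr gl wl : ℕ} {go wo tab : ℕ → ℕ}

theorem Net.mem_of_mem_disj {L : Net} {fr e f vp vc w : ℕ} {u : Entry}
    (hu : u ∈ ((L.conj fr e f vp vc).1.disj (L.conj fr e f vp vc).2 w).1) (hk : u.kind = .var) :
    u ∈ L := by
  simp only [Net.conj, Net.disj] at hu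
  split_ifs at hu <;> simp only [List.mem_cons] at hu <;> aesop

theorem JoinInv.congr (I : JoinInv T V W F G l l' tt L₀ tab₀ D L fr gl wl go wo tab)
    (h : ∀ σ τ ν, Compat l l' σ τ → F σ ν → G τ ν → (D σ τ ↔ D' σ τ)) :
    JoinInv T V W F G l l' tt L₀ tab₀ D' L fr gl wl go wo tab :=
  { I with
    table := fun ρ hρ => (I.table ρ hρ).congr fun ν => exists_congr fun σ => exists_congr fun τ =>
      ⟨fun ⟨a, b, c, d, e⟩ => ⟨(h σ τ ν b d e).mp a, b, c, d, e⟩,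
        fun ⟨a, b, c, d, e⟩ => ⟨(h σ τ ν b d e).mpr a, b, c, d, e⟩⟩ }

/-- A pair of compatible states adds the conjunction of their functions to the function of the state
that it leads to. -/
theorem JoinInv.step (St : JoinSetup T V W F G l l' vp vc tt tp tc L₀ tab₀)
    (I : JoinInv T V W F G l l' tt L₀ tab₀ D L fr gl wl go wo tab)
    {x y r e f : ℕ} (hx : x < 4 ^ l.length) (hy : y < 4 ^ l'.length) (hC : Compat l l' x y)
    (hJ : IsJoin l l' x y r) (hD : ¬ D x y) (he : e = tab₀ (tp + x)) (he0 : 0 < e)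
    (hf : f = tab₀ (tc + y)) (hf0 : 0 < f) {L' : Net} {z gl' wl' : ℕ} {go' wo' : ℕ → ℕ}
    (hL' : L' = ((L.conj fr e f vp vc).1.disj (L.conj fr e f vp vc).2 (tab (tt + r))).1)
    (hz : z = ((L.conj fr e f vp vc).1.disj (L.conj fr e f vp vc).2 (tab (tt + r))).2)
    (hr : NetRep L' gl' wl' go' wo') :
    JoinInv T V W F G l l' tt L₀ tab₀ (fun σ τ => D σ τ ∨ σ = x ∧ τ = y) L' (z + 1) gl' wl' go' wo'
      (Function.update tab (tt + r) (z + 1)) := by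
  have hrl := hJ.1
  obtain ⟨g₁, r₁, s₁, u₁, hle⟩ := I.good.conj St.none₁ St.none₂ he0 hf0
    ((he ▸ St.table₁ x hx).suffix I.good.ok I.suf) ((hf ▸ St.table₂ y hy).suffix I.good.ok I.suf)
    St.disj St.sub I.str
  have hw := (I.table r hrl).suffix g₁.ok u₁
  have hne : tab (tt + r) ≠ (L.conj fr e f vp vc).2 + 1 := by
    intro hh
    have := I.good.lt _ ((I.table r hrl).mem (by omega))
    omega
  obtain ⟨g₂, r₂, s₂, u₂⟩ := g₁.disj hw r₁ hne (T := T) (fun ν ⟨⟨σ, τ, h1, h2, h3, h4, h5⟩, h6, h7⟩ => by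
    obtain ⟨rfl, rfl⟩ := St.unique ν r σ τ x y h2 h3 h4 h5 hC hJ h6 h7
    exact hD h1) s₁
  rw [← hL', ← hz] at g₂ r₂
  rw [← hL'] at s₂ u₂
  refine ⟨g₂, s₂, hr, I.suf.trans (u₁.trans u₂), fun u hu hk => I.var u
    (Net.mem_of_mem_disj (hL' ▸ hu) hk) hk, fun k hk => ?_, fun k hk => ?_, fun ρ hρ => ?_⟩
  · rw [Function.update_of_ne (by omega)]; exact I.old k hk
  · rw [Function.update_of_ne (by omega)]; exact I.new k hk
  · by_cases h : ρ = r
    · subst h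
      rw [Function.update_self]
      refine r₂.congr fun ν => ⟨?_, ?_⟩
      · rintro (⟨σ, τ, h1, h2⟩ | ⟨h1, h2⟩)
        exacts [⟨σ, τ, .inl h1, h2⟩, ⟨x, y, .inr ⟨rfl, rfl⟩, hC, hJ, h1, h2⟩]
      · rintro ⟨σ, τ, h1 | ⟨rfl, rfl⟩, h2⟩
        exacts [.inl ⟨σ, τ, h1, h2⟩, .inr h2.2.2]
    · rw [Function.update_of_ne (by omega)]
      refine ((I.table ρ hρ).suffix g₂.ok (u₁.trans u₂)).congr fun ν => ⟨?_, ?_⟩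
      · rintro ⟨σ, τ, h1, h2⟩
        exact ⟨σ, τ, .inl h1, h2⟩
      · rintro ⟨σ, τ, h1 | ⟨rfl, rfl⟩, h2⟩
        · exact ⟨σ, τ, h1, h2⟩
        · exact absurd (h2.2.1.unique St.nodup₁ hJ) h

theorem patch_patch (l : List ℕ) (F F' A : ℕ → ℕ) : patch l F (patch l F' A) = patch l F A := by
  funext g; simp only [patch]; split_ifs <;> rfl

theorem patch_zero (l : List ℕ) (F : ℕ → ℕ) : patch l (fun _ => 0) (patch l F fun _ => 0) = fun _ => 0 := by
  funext g; simp only [patch]; split_ifs <;> rfl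

theorem joinPair_spec (s : S) (St : JoinSetup T V W F G l l' s.vp s.vc s.tt s.tp s.tc L₀ tab₀)
    (I : JoinInv T V W F G l l' s.tt L₀ tab₀ D L s.fr s.gl s.wl s.go s.wo s.tab)
    (hl : l = pre (fun j => s.inp (s.b + j)) s.m) (hl' : l' = pre (fun j => s.inp (s.bc + j)) s.mc)
    (hx : s.x < 4 ^ l.length) (hy : s.y < 4 ^ l'.length)
    (hva : s.va = valArr l s.x fun _ => 0) (hsa : s.sa = satArr l s.x fun _ => 0)
    (hvb : ∃ A, s.vb = patch l' A fun _ => 0) (hsb : ∃ A, s.sb = patch l' A fun _ => 0)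
    (he : s.e = tab₀ (s.tp + s.x)) (he0 : 0 < s.e) (hD : ¬ D s.x s.y) :
    Spec joinPair s (100 * (s.m + s.mc) + 400) fun s' =>
      ∃ fr gl wl j t g h ok f w z r pw, ∃ go wo tab vb sb : ℕ → ℕ,
      s' = { s with
        fr := fr, gl := gl, wl := wl, j := j, t := t, g := g, h := h, ok := ok, f := f, w := w
        z := z, r := r, pw := pw, go := go, wo := wo, tab := tab, vb := vb, sb := sb, y := s.y + 1 } ∧
      (∃ L', JoinInv T V W F G l l' s.tt L₀ tab₀ (fun σ τ => D σ τ ∨ σ = s.x ∧ τ = s.y) L' fr gl wl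
        go wo tab) ∧ (∃ A, vb = patch l' A fun _ => 0) ∧ ∃ A, sb = patch l' A fun _ => 0 := by
  obtain ⟨A, hA⟩ := hvb
  obtain ⟨B, hB⟩ := hsb
  have hf : s.tab (s.tc + s.y) = tab₀ (s.tc + s.y) := I.old _ (by have := St.le₂; omega)
  unfold joinPair
  refine Spec.mono (Spec.seq (t₁ := 6) (t₂ := (100 * (s.m + s.mc) + 380) + 4)
    (R := fun s' => s' = { s with f := s.tab (s.tc + s.y) }) (.straight rfl (by decide) rfl) ?_)
    (fun _ h => h) (by omega)
  rintro _ rfl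
  refine Spec.seq (R := fun s' =>
      ∃ fr gl wl j t g h ok f w z r pw, ∃ go wo tab vb sb : ℕ → ℕ,
      s' = { s with
        fr := fr, gl := gl, wl := wl, j := j, t := t, g := g, h := h, ok := ok, f := f, w := w
        z := z, r := r, pw := pw, go := go, wo := wo, tab := tab, vb := vb, sb := sb } ∧
      (∃ L', JoinInv T V W F G l l' s.tt L₀ tab₀ (fun σ τ => D σ τ ∨ σ = s.x ∧ τ = s.y) L' fr gl wl
        go wo tab) ∧ (∃ A, vb = patch l' A fun _ => 0) ∧ ∃ A, sb = patch l' A fun _ => 0) ?_ ?_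
  · refine Spec.mono (Spec.ite (t := 100 * (s.m + s.mc) + 370) ?_ ?_) (fun _ h => h)
      (by simp only [Expr.cost]; show 1 + 1 + _ + 1 ≤ _; omega)
    · intro h0
      replace h0 : 0 < s.tab (s.tc + s.y) := h0
      refine Spec.mono (Spec.seq (decodeB_spec _ hl' St.nodup₂) (t₂ := 60 * s.mc + 60 * s.m + 340) ?_)
        (fun _ h => h) (by show 40 * s.mc + 10 + _ ≤ _; omega)
      rintro _ ⟨j, t, g, h, rfl⟩
      simp only [hA, hB, valArr, satArr, patch_patch]
      refine Spec.mono (Spec.seq (compat_spec (x := s.x) (y := s.y) (l := l) (l' := l') _ hl' ?_ ?_ ?_)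
        (t₂ := 60 * s.m + 320) ?_) (fun _ h => h) (by show 60 * s.mc + 20 + _ ≤ _; omega)
      · intro g; simp only [hva]; rfl
      · intro g hg; simp only [patch, hg, if_true]
      · intro g hg; simp only [patch, hg, if_true]
      rintro _ ⟨g, ok, j, rfl, hok⟩
      refine Spec.mono (Spec.ite (t := 60 * s.m + 310) ?_ ?_) (fun _ h => h)
        (by simp only [Expr.cost]; show 1 + 1 + _ + 1 ≤ _; omega)
      · intro hk
        have hC := hok.mp hk
        refine Spec.mono (Spec.seq (encode_spec (x := s.x) (y := s.y) (l := l) (l' := l') _ hl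
          St.nodup₁ ?_ ?_ ?_)
          (t₂ := 290) ?_) (fun _ h => h) (by show 60 * s.m + 20 + _ ≤ _; omega)
        · intro g hg; simp only [hva, valArr, patch, hg, if_true]
        · intro g hg; simp only [hsa, satArr, patch, hg, if_true]
        · intro g; rfl
        rintro _ ⟨r, pw, j, g, rfl, hJ⟩
        refine .straight rfl (by decide) ?_
        obtain ⟨w, z, gl, wl, go, wo, hden, hz, hrep⟩ := joinGates_den { s with
          f := s.tab (s.tc + s.y), t := t, g := g, h := h, ok := ok, j := j, r := r, pw := pw
          vb := patch l' (fun g => 1 + (valBit l' s.y g).toNat) fun _ => 0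
          sb := patch l' (fun g => (satBit l' s.y g).toNat) fun _ => 0 } (L := L) I.rep
        rw [hden]
        exact ⟨_, _, _, _, _, _, _, _, _, _, _, _, _, _, _, _, _, _, rfl,
          ⟨_, I.step St hx hy hC hJ hD he he0 hf h0 rfl hz hrep⟩, ⟨_, rfl⟩, ⟨_, rfl⟩⟩
      · intro hk
        have hC : ¬ Compat l l' s.x s.y := fun h => hk (hok.mpr h)
        refine .straight rfl (by show 0 ≤ _; omega) ?_
        refine ⟨_, _, _, _, _, _, _, _, _, _, _, _, _, _, _, _, _, _, rfl, ⟨L, ?_⟩, ⟨_, rfl⟩, ⟨_, rfl⟩⟩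
        refine I.congr fun σ τ ν h1 _ _ => ⟨.inl, fun h => h.resolve_right ?_⟩
        rintro ⟨rfl, rfl⟩
        exact hC h1
    · intro h0
      replace h0 : ¬ 0 < s.tab (s.tc + s.y) := h0
      refine .straight rfl (by show 0 ≤ _; omega) ?_
      refine ⟨_, _, _, _, _, _, _, _, _, _, _, _, _, _, _, _, _, _, rfl, ⟨L, ?_⟩, ⟨A, hA⟩, ⟨B, hB⟩⟩
      refine I.congr fun σ τ ν _ _ h1 => ⟨.inl, fun h => h.resolve_right ?_⟩
      rintro ⟨rfl, rfl⟩
      exact (St.table₂ s.y hy).zero (by omega) ν h1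
  · rintro _ ⟨fr, gl, wl, j, t, g, h, ok, f, w, z, r, pw, go, wo, tab, vb, sb, rfl, h1⟩
    exact .straight rfl (by decide)
      ⟨_, _, _, _, _, _, _, _, _, _, _, _, _, _, _, _, _, _, rfl, h1⟩

/-- The pairs are processed in lexicographic order: before the pair `x`, `i` these are the pairs `σ`, `τ`
with `σ < x`, or `σ = x` and `τ < i`. -/
theorem joinRow_spec (s : S) (St : JoinSetup T V W F G l l' s.vp s.vc s.tt s.tp s.tc L₀ tab₀)
    (I : JoinInv T V W F G l l' s.tt L₀ tab₀ (fun σ _ => σ < s.x) L s.fr s.gl s.wl s.go s.wo s.tab)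
    (hl : l = pre (fun j => s.inp (s.b + j)) s.m) (hl' : l' = pre (fun j => s.inp (s.bc + j)) s.mc)
    (hx : s.x < 4 ^ l.length) (hpc : s.pc = 4 ^ l'.length)
    (hva : ∃ A, s.va = patch l A fun _ => 0) (hsa : ∃ A, s.sa = patch l A fun _ => 0)
    (hvb : ∃ A, s.vb = patch l' A fun _ => 0) (hsb : ∃ A, s.sb = patch l' A fun _ => 0) :
    Spec joinRow s (s.pc * (100 * (s.m + s.mc) + 410) + 40 * s.m + 50) fun s' =>
      ∃ fr gl wl j t g h ok e f w z r pw y, ∃ go wo tab va sa vb sb : ℕ → ℕ,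
      s' = { s with
        fr := fr, gl := gl, wl := wl, j := j, t := t, g := g, h := h, ok := ok, e := e, f := f, w := w
        z := z, r := r, pw := pw, go := go, wo := wo, tab := tab, va := va, sa := sa, vb := vb, sb := sb
        y := y, x := s.x + 1 } ∧
      (∃ L', JoinInv T V W F G l l' s.tt L₀ tab₀ (fun σ _ => σ < s.x + 1) L' fr gl wl
        go wo tab) ∧ (∃ A, va = patch l A fun _ => 0) ∧ (∃ A, sa = patch l A fun _ => 0) ∧
        (∃ A, vb = patch l' A fun _ => 0) ∧ ∃ A, sb = patch l' A fun _ => 0 := by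
  obtain ⟨A, hA⟩ := hva
  obtain ⟨B, hB⟩ := hsa
  have he : s.tab (s.tp + s.x) = tab₀ (s.tp + s.x) := I.old _ (by have := St.le₁; omega)
  unfold joinRow
  refine Spec.mono (Spec.seq (t₁ := 6) (t₂ := (s.pc * (100 * (s.m + s.mc) + 403) + 40 * s.m + 25) + 4)
    (R := fun s' => s' = { s with e := s.tab (s.tp + s.x) }) (.straight rfl (by decide) rfl) ?_)
    (fun _ h => h) (by nlinarith)
  rintro _ rfl
  refine Spec.seq (R := fun s' =>
      ∃ fr gl wl j t g h ok e f w z r pw y, ∃ go wo tab va sa vb sb : ℕ → ℕ,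
      s' = { s with
        fr := fr, gl := gl, wl := wl, j := j, t := t, g := g, h := h, ok := ok, e := e, f := f, w := w
        z := z, r := r, pw := pw, go := go, wo := wo, tab := tab, va := va, sa := sa, vb := vb, sb := sb
        y := y } ∧
      (∃ L', JoinInv T V W F G l l' s.tt L₀ tab₀ (fun σ _ => σ < s.x + 1) L' fr gl wl
        go wo tab) ∧ (∃ A, va = patch l A fun _ => 0) ∧ (∃ A, sa = patch l A fun _ => 0) ∧
        (∃ A, vb = patch l' A fun _ => 0) ∧ ∃ A, sb = patch l' A fun _ => 0) ?_ ?_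
  · refine Spec.mono (Spec.ite (t := s.pc * (100 * (s.m + s.mc) + 403) + 40 * s.m + 20) ?_ ?_)
      (fun _ h => h) (by simp only [Expr.cost]; show 1 + 1 + _ + 1 ≤ _; omega)
    · intro h0
      replace h0 : 0 < s.tab (s.tp + s.x) := h0
      refine Spec.mono (Spec.seq (decodeA_spec _ hl St.nodup₁)
        (t₂ := 2 + (s.pc * (100 * (s.m + s.mc) + 400 + 3) + 2)) ?_)
        (fun _ h => h) (by show 40 * s.m + 10 + _ ≤ _; linarith)
      rintro _ ⟨j, t, g, h, rfl⟩
      simp only [hA, hB, valArr, satArr, patch_patch]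
      refine Spec.seq (R := fun s' => s' = { s with
          e := s.tab (s.tp + s.x), j := j, t := t, g := g, h := h, y := 0,
          va := valArr l s.x fun _ => 0, sa := satArr l s.x fun _ => 0 })
        (.straight rfl (by decide) rfl) ?_
      rintro _ rfl
      refine .rep (fun i s' => ∃ fr gl wl j t g h ok f w z r pw, ∃ go wo tab vb sb : ℕ → ℕ,
        s' = { s with
          fr := fr, gl := gl, wl := wl, j := j, t := t, g := g, h := h, ok := ok, f := f, w := w
          z := z, r := r, pw := pw, go := go, wo := wo, tab := tab, vb := vb, sb := sb, y := i
          e := s.tab (s.tp + s.x), va := valArr l s.x fun _ => 0, sa := satArr l s.x fun _ => 0 } ∧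
        (∃ L', JoinInv T V W F G l l' s.tt L₀ tab₀ (fun σ τ => σ < s.x ∨ σ = s.x ∧ τ < i) L' fr gl wl
          go wo tab) ∧ (∃ A, vb = patch l' A fun _ => 0) ∧ ∃ A, sb = patch l' A fun _ => 0) s.pc rfl
        ?_ ?_ ?_
      · exact ⟨_, _, _, _, _, _, _, _, _, _, _, _, _, _, _, _, _, _, rfl,
          ⟨L, I.congr fun σ τ ν _ _ _ => by simp⟩, hvb, hsb⟩
      · rintro i hi _ ⟨fr, gl, wl, j, t, g, h, ok, f, w, z, r, pw, go, wo, tab, vb, sb, rfl,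
          ⟨L', I'⟩, hvb, hsb⟩
        refine Spec.mono (joinPair_spec _ St I' hl hl' hx (hpc ▸ hi) rfl rfl hvb hsb he h0 ?_) ?_ le_rfl
        · simp
        · rintro _ ⟨fr, gl, wl, j, t, g, h, ok, f, w, z, r, pw, go, wo, tab, vb, sb, rfl, ⟨L', I'⟩, h1⟩
          refine ⟨_, _, _, _, _, _, _, _, _, _, _, _, _, _, _, _, _, _, rfl, ⟨L', I'.congr ?_⟩, h1⟩
          intro σ τ ν _ _ _
          show (σ < s.x ∨ σ = s.x ∧ τ < i) ∨ σ = s.x ∧ τ = i ↔ _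
          omega
      · rintro _ ⟨fr, gl, wl, j, t, g, h, ok, f, w, z, r, pw, go, wo, tab, vb, sb, rfl,
          ⟨L', I'⟩, h1⟩
        refine ⟨_, _, _, _, _, _, _, _, _, _, _, _, _, _, _, _, _, _, _, _, _, _, rfl,
          ⟨L', I'.congr ?_⟩, ⟨_, rfl⟩, ⟨_, rfl⟩, h1⟩
        intro σ τ ν _ _ hG
        have := St.bound₂ τ ν hG
        rw [← hpc] at this
        show σ < s.x ∨ σ = s.x ∧ τ < s.pc ↔ _
        omega
    · intro h0
      replace h0 : ¬ 0 < s.tab (s.tp + s.x) := h0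
      refine .straight rfl (by show 0 ≤ _; omega) ?_
      refine ⟨_, _, _, _, _, _, _, _, _, _, _, _, _, _, _, _, _, _, _, _, _, _, rfl, ⟨L, ?_⟩,
        ⟨A, hA⟩, ⟨B, hB⟩, hvb, hsb⟩
      refine I.congr fun σ τ ν _ hF _ => ?_
      have : σ ≠ s.x := by
        rintro rfl
        exact (St.table₁ s.x hx).zero (by omega) ν hF
      omega
  · rintro _ ⟨fr, gl, wl, j, t, g, h, ok, e, f, w, z, r, pw, y, go, wo, tab, va, sa, vb, sb, rfl, h1⟩
    exact .straight rfl (by decide)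
      ⟨_, _, _, _, _, _, _, _, _, _, _, _, _, _, _, _, _, _, _, _, _, _, rfl, h1⟩

end

/-! ### Merging a node into its parent -/

/-- The two nodes with the numbers `vp` and `vc` of the heap get a new parent, unless one of them is
missing. -/
theorem VTreeRep.merge {vl vr : ℕ → ℕ} {nv vp vc : ℕ} {V W : VTree} (hV : VTreeRep vl vr nv vp V)
    (hW : VTreeRep vl vr nv vc W) :
    VTreeRep (Function.update vl (nv + 1) vp) (Function.update vr (nv + 1) vc)
      (sel 0 vc (sel 0 vp (nv + 1) nv) nv) (sel 0 vc (sel 0 vp (nv + 1) vc) vp) (V.merge W) := by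
  have hnv : nv ≤ sel 0 vc (sel 0 vp (nv + 1) nv) nv := by
    simp only [sel]; split_ifs <;> omega
  cases W with
  | none =>
    have hvc : vc = 0 := hW
    subst hvc
    have : V.merge none = V := by cases V <;> rfl
    rw [this]
    exact hV.write hnv
  | some r =>
    have hvc := (TreeRep.pos hW).1
    cases V with
    | none =>
      have hvp : vp = 0 := hV
      subst hvp
      have h := hW.write (x := 0) (y := vc) hnv
      simp only [sel, hvc, lt_irrefl, if_true, if_false] at h ⊢
      exact h
    | some l =>
      have hvp := (TreeRep.pos hV).1
      simp only [sel, hvc, hvp, if_true]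
      refine ⟨⟨by omega, le_rfl⟩, ?_, ?_, ?_⟩
      · rwa [Function.update_self]
      · rw [Function.update_self]; exact TreeRep.write hV (Nat.le_succ _)
      · rw [Function.update_self]; exact TreeRep.write hW (Nat.le_succ _)

/-- A bound on the time for merging a node into its parent, if all bags have at most `M` gates. -/
def absorbTime (M : ℕ) : ℕ := 16 ^ M * (300 * M + 1000)

theorem absorbTime_bound {m mc M : ℕ} (hm : m ≤ M) (hmc : mc ≤ M) :
    4 ^ m * (4 ^ mc * (100 * (m + mc) + 410) + 40 * m + 53) + 30 * m + 30 * mc + 250 ≤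
      absorbTime M := by
  have h1 : (4 : ℕ) ^ m ≤ 4 ^ M := Nat.pow_le_pow_right (by norm_num) hm
  have h2 : (4 : ℕ) ^ mc ≤ 4 ^ M := Nat.pow_le_pow_right (by norm_num) hmc
  have h3 : 1 ≤ (4 : ℕ) ^ M := Nat.one_le_pow _ _ (by norm_num)
  have h4 : (16 : ℕ) ^ M = 4 ^ M * 4 ^ M := by rw [← mul_pow]; norm_num
  rw [absorbTime, h4]
  generalize (4 : ℕ) ^ M = X at *
  have h5 : X ≤ X * X := Nat.le_mul_self X
  calc _ ≤ X * (X * (100 * (M + M) + 410) + 40 * M + 53) + 30 * M + 30 * M + 250 := by gcongr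
    _ = X * X * (200 * M + 410) + X * (40 * M + 53) + 1 * (60 * M + 250) := by ring
    _ ≤ X * X * (200 * M + 410) + X * X * (40 * M + 53) + X * X * (60 * M + 250) := by
        gcongr; exact h3.trans h5
    _ ≤ _ := by nlinarith

section

variable {T : BinTree → Prop} {V W : VTree} {F G : ℕ → (ℕ → Bool) → Prop} {l l' : List ℕ} {L : Net}

theorem absorb_spec (s : S) {c p M : ℕ} (hc : s.q s.i = c) (hp : s.par c = p)
    (hl : l = pre (fun j => s.inp (s.st p + j)) (s.sz p))
    (hl' : l' = pre (fun j => s.inp (s.st c + j)) (s.sz c)) (hlM : l.length ≤ M) (hlM' : l'.length ≤ M)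
    (hpp : s.pw4 p = 4 ^ l.length) (hpc : s.pw4 c = 4 ^ l'.length)
    (hva : s.va = fun _ => 0) (hsa : s.sa = fun _ => 0) (hvb : s.vb = fun _ => 0)
    (hsb : s.sb = fun _ => 0)
    (St : JoinSetup T V W F G l l' (s.vt p) (s.vt c) s.tt (s.tb p) (s.tb c) L s.tab)
    (good : L.Good s.fr) (str : L.Structured T) (rep : NetRep L s.gl s.wl s.go s.wo)
    (htab : ∀ k, s.tt ≤ k → s.tab k = 0) :
    Spec absorb s (absorbTime M) fun s' =>
      ∃ fr gl wl j t g h ok e f w z r pw y x m b mc bc pp pc tp tc vp vc, ∃ go wo tab : ℕ → ℕ,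
      s' = { s with
        fr := fr, gl := gl, wl := wl, j := j, t := t, g := g, h := h, ok := ok, e := e, f := f, w := w
        z := z, r := r, pw := pw, y := y, x := x, c := c, p := p, m := m, b := b, mc := mc, bc := bc
        pp := pp, pc := pc, tp := tp, tc := tc, vp := vp, vc := vc, go := go, wo := wo, tab := tab
        tb := Function.update s.tb p s.tt, tt := s.tt + 4 ^ l.length
        vl := Function.update s.vl (s.nv + 1) (s.vt p), vr := Function.update s.vr (s.nv + 1) (s.vt c)
        vt := Function.update s.vt p (sel 0 (s.vt c) (sel 0 (s.vt p) (s.nv + 1) (s.vt c)) (s.vt p))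
        nv := sel 0 (s.vt c) (sel 0 (s.vt p) (s.nv + 1) s.nv) s.nv, i := s.i + 1
        va := fun _ => 0, sa := fun _ => 0, vb := fun _ => 0, sb := fun _ => 0 } ∧
      ∃ L', JoinInv T V W F G l l' s.tt L s.tab (fun _ _ => True) L' fr gl wl go wo tab := by
  have hm : s.sz p = l.length := by rw [hl, pre_length]
  have hmc : s.sz c = l'.length := by rw [hl', pre_length]
  unfold absorb
  refine Spec.mono (Spec.seq (t₁ := 60)
    (t₂ := (4 ^ l.length * ((4 ^ l'.length * (100 * (l.length + l'.length) + 410) + 40 * l.length + 50) + 3)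
      + 1 + 1) + ((30 * l.length + 10) + ((30 * l'.length + 10) + 100)))
    (R := fun s' => s' = { s with
      c := c, p := p, m := s.sz p, b := s.st p, mc := s.sz c, bc := s.st c, pp := s.pw4 p, pc := s.pw4 c
      tp := s.tb p, tc := s.tb c, vp := s.vt p, vc := s.vt c, x := 0 })
    (.straight rfl (by decide) (by subst hp hc; simp only [absorbStart, Cmd.den, Expr.eval, Expr.eval_add, Expr.eval_sub, Expr.eval_ofNat, S.get, S.set,
      S.getA, S.setA])) ?_) (fun _ h => h) ?_
  swap
  · refine le_trans ?_ (absorbTime_bound hlM hlM')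
    have : 4 ^ l.length * ((4 ^ l'.length * (100 * (l.length + l'.length) + 410) + 40 * l.length + 50) + 3)
      = 4 ^ l.length * (4 ^ l'.length * (100 * (l.length + l'.length) + 410) + 40 * l.length + 53) := rfl
    omega
  rintro _ rfl
  refine Spec.seq (R := fun s' =>
      ∃ fr gl wl j t g h ok e f w z r pw y x, ∃ go wo tab va sa vb sb : ℕ → ℕ,
      s' = { s with
        c := c, p := p, m := s.sz p, b := s.st p, mc := s.sz c, bc := s.st c, pp := s.pw4 p, pc := s.pw4 c
        tp := s.tb p, tc := s.tb c, vp := s.vt p, vc := s.vt c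
        fr := fr, gl := gl, wl := wl, j := j, t := t, g := g, h := h, ok := ok, e := e, f := f, w := w
        z := z, r := r, pw := pw, go := go, wo := wo, tab := tab, va := va, sa := sa, vb := vb, sb := sb
        y := y, x := x } ∧
      (∃ L', JoinInv T V W F G l l' s.tt L s.tab (fun _ _ => True) L' fr gl wl go wo tab) ∧
        (∃ A, va = patch l A fun _ => 0) ∧ (∃ A, sa = patch l A fun _ => 0) ∧
        (∃ A, vb = patch l' A fun _ => 0) ∧ ∃ A, sb = patch l' A fun _ => 0) ?_ ?_
  · refine .rep (fun i s' => ∃ fr gl wl j t g h ok e f w z r pw y, ∃ go wo tab va sa vb sb : ℕ → ℕ,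
      s' = { s with
        c := c, p := p, m := s.sz p, b := s.st p, mc := s.sz c, bc := s.st c, pp := s.pw4 p, pc := s.pw4 c
        tp := s.tb p, tc := s.tb c, vp := s.vt p, vc := s.vt c
        fr := fr, gl := gl, wl := wl, j := j, t := t, g := g, h := h, ok := ok, e := e, f := f, w := w
        z := z, r := r, pw := pw, go := go, wo := wo, tab := tab, va := va, sa := sa, vb := vb, sb := sb
        y := y, x := i } ∧
      (∃ L', JoinInv T V W F G l l' s.tt L s.tab (fun σ _ => σ < i) L' fr gl wl go wo tab) ∧
        (∃ A, va = patch l A fun _ => 0) ∧ (∃ A, sa = patch l A fun _ => 0) ∧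
        (∃ A, vb = patch l' A fun _ => 0) ∧ ∃ A, sb = patch l' A fun _ => 0) (4 ^ l.length) hpp ?_ ?_ ?_
    · have hz : ∀ l, ∃ A, (fun _ : ℕ => 0) = patch l A fun _ => 0 :=
        fun l => ⟨fun _ => 0, by funext g; simp [patch]⟩
      refine ⟨_, _, _, _, _, _, _, _, _, _, _, _, _, _, _, _, _, _, _, _, _, _, rfl, ⟨L, ?_⟩,
        hva ▸ hz l, hsa ▸ hz l, hvb ▸ hz l', hsb ▸ hz l'⟩
      refine ⟨good, str, rep, List.suffix_refl _, fun _ h _ => h, fun _ _ => rfl, fun k hk => htab k (by omega),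
        fun ρ hρ => ?_⟩
      have h0 : s.tab (s.tt + ρ) = 0 := htab _ (by omega)
      refine ⟨?_, ?_, ?_, ?_, ?_⟩
      · rintro - ν ⟨σ, τ, h1, -⟩
        omega
      all_goals exact fun h1 => absurd h1 (by rw [h0]; omega)
    · rintro i hi _ ⟨fr, gl, wl, j, t, g, h, ok, e, f, w, z, r, pw, y, go, wo, tab, va, sa, vb, sb, rfl,
        ⟨L', I⟩, h1, h2, h3, h4⟩
      refine Spec.mono (joinRow_spec _ St I hl hl' hi hpc h1 h2 h3 h4) ?_ ?_
      · rintro _ ⟨fr, gl, wl, j, t, g, h, ok, e, f, w, z, r, pw, y, go, wo, tab, va, sa, vb, sb, rfl, h1⟩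
        exact ⟨_, _, _, _, _, _, _, _, _, _, _, _, _, _, _, _, _, _, _, _, _, _, rfl, h1⟩
      · show s.pw4 c * (100 * (s.sz p + s.sz c) + 410) + 40 * s.sz p + 50 ≤ _
        rw [hpc, hm, hmc]
    · rintro _ ⟨fr, gl, wl, j, t, g, h, ok, e, f, w, z, r, pw, y, go, wo, tab, va, sa, vb, sb, rfl,
        ⟨L', I⟩, h1⟩
      exact ⟨_, _, _, _, _, _, _, _, _, _, _, _, _, _, _, _, _, _, _, _, _, _, _, rfl,
        ⟨L', I.congr fun σ τ ν _ hF _ => iff_of_true (St.bound₁ σ ν hF) trivial⟩, h1⟩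
  rintro _ ⟨fr, gl, wl, j, t, g, h, ok, e, f, w, z, r, pw, y, x, go, wo, tab, va, sa, vb, sb, rfl,
    ⟨L', I⟩, ⟨A₁, h1⟩, ⟨A₂, h2⟩, ⟨A₃, h3⟩, ⟨A₄, h4⟩⟩
  refine Spec.seq (Spec.mono (clearA_spec _ hl) (fun _ h => h) (by
    show 30 * s.sz p + 10 ≤ _; rw [hm])) ?_
  rintro _ ⟨j, g, rfl⟩
  refine Spec.seq (Spec.mono (clearB_spec _ hl') (fun _ h => h) (by
    show 30 * s.sz c + 10 ≤ _; rw [hmc])) ?_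
  rintro _ ⟨j, g, rfl⟩
  simp only [h1, h2, h3, h4, patch_zero]
  refine .straight rfl (by decide) ?_
  simp only [absorbEnd, Cmd.den, Expr.eval, Expr.eval_add, Expr.eval_sub, Expr.eval_ofNat, S.get, S.set,
    S.getA, S.setA]
  rw [hpp]
  exact ⟨_, _, _, _, _, _, _, _, _, _, _, _, _, _, _, _, _, _, _, _, _, _, _, _, _, _, _, _, _,
    rfl, L', I⟩
end

/-! ### Merging all nodes into the root -/

/-- The nodes that have been merged into `b`, when the nodes in `D` have been merged into their
parents. -/
inductive Cluster (par : ℕ → ℕ) (D : Set ℕ) (b : ℕ) : ℕ → Prop where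
  | self : Cluster par D b b
  | step {x : ℕ} (hx : x ∈ D) (h : Cluster par D b (par x)) : Cluster par D b x

section

variable {par : ℕ → ℕ} {D : Set ℕ} {b b' c x : ℕ}

theorem Cluster.unique (h : Cluster par D b x) (h' : Cluster par D b' x) (hb : b ∉ D) (hb' : b' ∉ D) :
    b = b' := by
  induction h with
  | self =>
    cases h' with
    | self => rfl
    | step hx _ => exact absurd hx hb
  | step hx h ih =>
    cases h' with
    | self => exact absurd hx hb'
    | step _ h' => exact ih h'

theorem Cluster.mono {D' : Set ℕ} (h : Cluster par D b x) (hD : D ⊆ D') : Cluster par D' b x := by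
  induction h with
  | self => exact .self
  | step hx _ ih => exact .step (hD hx) ih

theorem Cluster.lt {nn : ℕ} (h : Cluster par D b x) (hb : b < nn) (hD : ∀ x ∈ D, x < nn) : x < nn := by
  cases h with
  | self => exact hb
  | step hx _ => exact hD _ hx

theorem cluster_insert_par (hc : c ∉ D) :
    Cluster par (insert c D) (par c) x ↔ Cluster par D (par c) x ∨ Cluster par D c x := by
  constructor
  · intro h
    induction h with
    | self => exact .inl .self
    | step hx _ ih =>
      rcases hx with rfl | hx
      · exact .inr .self
      · exact ih.imp (.step hx) (.step hx)
  · rintro (h | h)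
    · exact h.mono (Set.subset_insert _ _)
    · induction h with
      | self => exact .step (Set.mem_insert _ _) .self
      | step hx _ ih => exact .step (Set.mem_insert_of_mem _ hx) ih

theorem cluster_insert_of_ne (hb : b ≠ par c) (hp : par c ∉ D) :
    Cluster par (insert c D) b x ↔ Cluster par D b x := by
  refine ⟨fun h => ?_, fun h => h.mono (Set.subset_insert _ _)⟩
  induction h with
  | self => exact .self
  | step hx _ ih =>
    rcases hx with rfl | hx
    · cases ih with
      | self => exact absurd rfl hb
      | step hx _ => exact absurd hx hp
    · exact .step hx ih

theorem cluster_of_reach {n nn : ℕ} (hn : ∀ x < nn, par x < nn) (hD : ∀ x < nn, x ≠ n → x ∈ D) {j : ℕ}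
    (hx : x < nn) (h : par^[j] x = n) : Cluster par D n x := by
  induction j generalizing x with
  | zero => rw [← show x = n from h]; exact .self
  | succ j ih =>
    by_cases hxn : x = n
    · rw [hxn]; exact .self
    · exact .step (hD x hx hxn) (ih (hn x hx) h)

/-- If nodes are merged into their parents after their children, then the gates that a cluster shares
with other nodes are in the bag of its top node. -/
theorem NormalDec.separated {C : Circuit} {n nn : ℕ} {bag : ℕ → List ℕ} (E : NormalDec C n nn bag par)
    (hD : ∀ x ∈ D, x < nn) (hc : ∀ x ∈ D, ∀ y < nn, par y = x → y ∈ D) (hb : b < nn)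
    (hbD : b ∉ D) : Separated bag nn {x | Cluster par D b x} b := by
  intro x hx g hg hgb y hy hgy
  refine E.conn g _ (fun z hz hgz hgp => ⟨fun h => ?_, fun h => ?_⟩) x hx (hx.lt hb hD) hg y hy hgy
  · cases h with
    | self => exact absurd hgz hgb
    | step _ h => exact h
  · have hp : par z ∈ D := by
      cases h' : h with
      | self => exact absurd hgp hgb
      | step hx _ => exact hx
    exact Cluster.step (hc _ hp z hz rfl) h

end

/-- The bags as lists, in arrays with the start and the length of each list. -/
def bagOf (inp st sz : ℕ → ℕ) (b : ℕ) : List ℕ := pre (fun j => inp (st b + j)) (sz b)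

/-- The nodes except `n` are listed in `q`, children before their parents. -/
structure IsOrder (n nn : ℕ) (par q : ℕ → ℕ) : Prop where
  lt : ∀ i < nn - 1, q i < nn
  ne : ∀ i < nn - 1, q i ≠ n
  inj : ∀ i < nn - 1, ∀ j < nn - 1, q i = q j → i = j
  all : ∀ b < nn, b ≠ n → ∃ i < nn - 1, q i = b
  child : ∀ i < nn - 1, ∀ y < nn, par y = q i → ∃ j < i, q j = y

/-- The part of the memory that describes the tree decomposition; all bags have at most `M` gates. -/
structure Setting (C : Circuit) (M : ℕ) (s : S) : Prop where
  dec : NormalDec C s.n s.nn (bagOf s.inp s.st s.sz) s.par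
  card : ∀ b < s.nn, s.sz b ≤ M
  pw4 : ∀ b < s.nn, s.pw4 b = 4 ^ s.sz b
  va : s.va = fun _ => 0
  sa : s.sa = fun _ => 0
  vb : s.vb = fun _ => 0
  sb : s.sb = fun _ => 0
  out : s.out = []
  sk : s.sk = 0
  vars : C.vars.card ≤ s.nG

/-- The gates made so far, and the table and the v-tree of each node that is not in `D`, when the nodes
in `D` have been merged into their parents. -/
structure Forest (C : Circuit) (n nn : ℕ) (bag : ℕ → List ℕ) (par : ℕ → ℕ) (D : Set ℕ) (L : Net)
    (V : ℕ → VTree) (s : S) : Prop where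
  good : L.Good s.fr
  str : L.Structured fun t => ∃ b < nn, b ∉ D ∧ t ∈ (V b).subtrees
  rep : NetRep L s.gl s.wl s.go s.wo
  vars : ∀ u, u ∈ C.vars ↔ ∃ e ∈ L, e.name = u ∧ e.kind = .var
  tree : ∀ b < nn, b ∉ D → VTreeRep s.vl s.vr s.nv (s.vt b) (V b)
  nodup : ∀ b < nn, b ∉ D → (V b).leaves.Nodup
  leaves : ∀ b < nn, b ∉ D → ∀ u, u ∈ (V b).leaves ↔
    ∃ x, n < x ∧ x < nn ∧ Cluster par D b x ∧ bag x = [u]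
  le : ∀ b < nn, b ∉ D → s.tb b + 4 ^ (bag b).length ≤ s.tt
  zero : ∀ k, s.tt ≤ k → s.tab k = 0
  table : ∀ b < nn, b ∉ D → ∀ σ < 4 ^ (bag b).length,
    L.Repr (V b) (fun ν => Holds C n bag {x | Cluster par D b x} b ν σ) (s.tab (s.tb b + σ))

/-- The situation when the first `i` nodes of the list `q` have been merged into their parents. -/
structure Stage (C : Circuit) (M i : ℕ) (s : S) : Prop where
  setting : Setting C M s
  order : IsOrder s.n s.nn s.par s.q
  index : s.i = i
  forest : ∃ L V, Forest C s.n s.nn (bagOf s.inp s.st s.sz) s.par {x | ∃ j < i, s.q j = x} L V s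

theorem bagOf_length (inp st sz : ℕ → ℕ) (b : ℕ) : (bagOf inp st sz b).length = sz b := pre_length _ _

/-- Merging the part of the next node into the part of its parent keeps the invariant. -/
theorem Stage.absorb {C : Circuit} {M i : ℕ} {s : S} (h : Stage C M i s) (hi : i < s.nn - 1) :
    Spec absorb s (absorbTime M) fun s' => Stage C M (i + 1) s' ∧ s'.nn = s.nn := by
  obtain ⟨St, O, hsi, L, V, Fo⟩ := h
  subst hsi
  have E := St.dec
  generalize hbag : bagOf s.inp s.st s.sz = bag at *
  set D : Set ℕ := {x | ∃ j < s.i, s.q j = x} with hDdef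
  obtain ⟨c, hcq⟩ : ∃ c, s.q s.i = c := ⟨_, rfl⟩
  obtain ⟨p, hp⟩ : ∃ p, s.par c = p := ⟨_, rfl⟩
  have hc : c < s.nn := hcq ▸ O.lt _ hi
  have hpn : p < s.nn := hp ▸ E.par_lt c hc
  have hDlt : ∀ x ∈ D, x < s.nn := by
    rintro _ ⟨j, hj, rfl⟩; exact O.lt _ (by omega)
  have hcD : c ∉ D := by
    rintro ⟨j, hj, h⟩
    have := O.inj j (by omega) s.i hi (h.trans hcq.symm)
    omega
  have hD' : {x | ∃ j < s.i + 1, s.q j = x} = insert c D := by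
    ext x
    simp only [Set.mem_ofPred_eq, Set.mem_insert_iff, Nat.lt_succ_iff_lt_or_eq, hDdef]
    constructor
    · rintro ⟨j, hj | rfl, hx⟩
      exacts [.inr ⟨j, hj, hx⟩, .inl (hx.symm.trans hcq)]
    · rintro (rfl | ⟨j, hj, hx⟩)
      exacts [⟨_, .inr rfl, hcq⟩, ⟨j, .inl hj, hx⟩]
  have hchild : ∀ i ≤ s.nn - 1, ∀ x ∈ {x | ∃ j < i, s.q j = x}, ∀ y < s.nn, s.par y = x →
      y ∈ {x | ∃ j < i, s.q j = x} := by
    rintro i hi _ ⟨j, hj, rfl⟩ y hy hpy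
    obtain ⟨k, hk, h⟩ := O.child j (by omega) y hy hpy
    exact ⟨k, hk.trans hj, h⟩
  have hpD' : p ∉ insert c D := by
    rw [← hD']
    rintro ⟨j, hj, h⟩
    obtain ⟨k, hk, h'⟩ := O.child j (by omega) c hc (hp.trans h.symm)
    have := O.inj k (by omega) s.i hi (h'.trans hcq.symm)
    omega
  have hpc : p ≠ c := fun h => hpD' (h ▸ Set.mem_insert _ _)
  have hpD : p ∉ D := fun h => hpD' (Set.mem_insert_of_mem _ h)
  have hD'lt : ∀ x ∈ insert c D, x < s.nn := by
    rintro x (rfl | hx)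
    exacts [hc, hDlt x hx]
  -- A gate that occurs in a part but not in the bag of its top node occurs in no other part, because
  -- the nodes with this gate are connected.
  have hsep : ∀ b < s.nn, b ∉ D → Separated bag s.nn {x | Cluster s.par D b x} b :=
    fun b hb hbD => E.separated hDlt (hchild s.i hi.le) hb hbD
  have hunion : {x | Cluster s.par D p x} ∪ {x | Cluster s.par D c x} =
      {x | Cluster s.par (insert c D) p x} := by
    ext x; subst hp; exact (cluster_insert_par hcD).symm
  have hdisj : ∀ x, Cluster s.par D p x → Cluster s.par D c x → False :=
    fun x h h' => hpc (h.unique h' hpD hcD)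
  have hint : Interface bag {x | Cluster s.par D p x} {x | Cluster s.par D c x} p c := by
    intro x hx y hy g hgx hgy
    constructor
    · by_contra h
      exact hdisj y (hsep p hpn hpD x hx g hgx h y (hy.lt hc hDlt) hgy) hy
    · by_contra h
      exact hdisj x hx (hsep c hc hcD y hy g hgy h x (hx.lt hpn hDlt) hgx)
  have hsepu : Separated bag s.nn ({x | Cluster s.par D p x} ∪ {x | Cluster s.par D c x}) p := by
    rw [hunion]
    refine E.separated hD'lt ?_ hpn hpD'
    rw [← hD']
    exact hchild _ hi
  have hlive : ∀ b, b ∉ insert c D → b ∉ D := fun b hb h => hb (Set.mem_insert_of_mem _ h)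
  set V' : ℕ → VTree := Function.update V p ((V p).merge (V c)) with hV'
  -- AND-gates may use the nodes of all v-trees that are present after the merge.
  set T : BinTree → Prop := fun t => ∃ b < s.nn, b ∉ insert c D ∧ t ∈ (V' b).subtrees with hT
  have hTp : ∀ t ∈ ((V p).merge (V c)).subtrees, T t := fun t ht =>
    ⟨p, hpn, hpD', by rw [hV', Function.update_self]; exact ht⟩
  -- A variable in both v-trees would have its only leaf node in both parts.
  have hdl : List.Disjoint (V p).leaves (V c).leaves := by
    intro u h1 h2
    obtain ⟨x, hnx, hx, hxp, hbx⟩ := (Fo.leaves p hpn hpD u).mp h1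
    obtain ⟨y, hny, hy, hyc, hby⟩ := (Fo.leaves c hc hcD u).mp h2
    have := E.leaf_unique x y u hnx hx hny hy hbx hby
    subst this
    exact hdisj x hxp hyc
  have hlen : ∀ b, (bag b).length = s.sz b := fun b => by rw [← hbag, bagOf_length]
  have JS : JoinSetup T (V p) (V c) (fun σ ν => Holds C s.n bag {x | Cluster s.par D p x} p ν σ)
      (fun τ ν => Holds C s.n bag {x | Cluster s.par D c x} c ν τ) (bag p) (bag c) (s.vt p) (s.vt c)
      s.tt (s.tb p) (s.tb c) L s.tab :=
    { none₁ := (Fo.tree p hpn hpD).eq_none_iff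
      none₂ := (Fo.tree c hc hcD).eq_none_iff
      disj := hdl
      sub := hTp
      nodup₁ := E.nodup p hpn
      nodup₂ := E.nodup c hc
      table₁ := Fo.table p hpn hpD
      table₂ := Fo.table c hc hcD
      le₁ := Fo.le p hpn hpD
      le₂ := Fo.le c hc hcD
      bound₁ := fun σ ν h => h.1
      bound₂ := fun σ ν h => h.1
      unique := fun ν ρ σ τ σ' τ' h1 h2 h3 h4 h1' h2' h3' h4' =>
        join_unique E (fun x hx => hx.elim (·.lt hpn hDlt) (·.lt hc hDlt)) .self .self hint hsepu
          h1 h2 h3 h4 h1' h2' h3' h4' }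
  have hstr : L.Structured T := Fo.str.mono fun t ⟨b, hb, hbD, ht⟩ => by
    by_cases h1 : b = p
    · subst h1
      exact hTp t (VTree.subtrees_merge (.inl ht))
    by_cases h2 : b = c
    · subst h2
      exact hTp t (VTree.subtrees_merge (.inr ht))
    · refine ⟨b, hb, ?_, ?_⟩
      · rintro (h | h)
        exacts [h2 h, hbD h]
      · rwa [hV', Function.update_of_ne h1]
  refine Spec.mono (absorb_spec s hcq hp (l := bag p) (l' := bag c) (by rw [← hbag]; rfl)
    (by rw [← hbag]; rfl) (by rw [hlen]; exact St.card p hpn) (by rw [hlen]; exact St.card c hc)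
    (by rw [hlen]; exact St.pw4 p hpn) (by rw [hlen]; exact St.pw4 c hc) St.va St.sa St.vb St.sb JS
    Fo.good hstr Fo.rep Fo.zero) ?_ le_rfl
  rintro _ ⟨fr, gl, wl, j, t, g, h, ok, e, f, w, z, r, pw, y, x, m, b, mc, bc, pp, pc, tp, tc, vp, vc,
    go, wo, tab, rfl, L', I⟩
  refine ⟨⟨⟨hbag ▸ E, St.card, St.pw4, rfl, rfl, rfl, rfl, St.out, St.sk, St.vars⟩, O, rfl, L', V', ?_⟩, rfl⟩
  show Forest C s.n s.nn (bagOf s.inp s.st s.sz) s.par {x | ∃ j < s.i + 1, s.q j = x} L' V' _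
  rw [hbag, hD']
  have hmerge := (Fo.tree p hpn hpD).merge (Fo.tree c hc hcD)
  have hnv : s.nv ≤ sel 0 (s.vt c) (sel 0 (s.vt p) (s.nv + 1) s.nv) s.nv := by
    simp only [sel]; split_ifs <;> omega
  refine ⟨I.good, I.str, I.rep, fun u => (Fo.vars u).trans ⟨?_, ?_⟩, fun b hb hbD => ?_,
    fun b hb hbD => ?_, fun b hb hbD u => ?_, fun b hb hbD => ?_, fun k hk => ?_,
    fun b hb hbD σ hσ => ?_⟩
  · rintro ⟨e, he, h1, h2⟩
    exact ⟨e, I.suf.subset he, h1, h2⟩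
  · rintro ⟨e, he, h1, h2⟩
    exact ⟨e, I.var e he h2, h1, h2⟩
  · by_cases h1 : b = p
    · subst h1
      simp only [hV', Function.update_self]
      exact hmerge
    · simp only [hV', Function.update_of_ne h1]
      exact (Fo.tree b hb (hlive b hbD)).write hnv
  · by_cases h1 : b = p
    · subst h1
      rw [hV', Function.update_self, VTree.leaves_merge]
      exact List.Nodup.append (Fo.nodup b hpn hpD) (Fo.nodup c hc hcD) hdl
    · rw [hV', Function.update_of_ne h1]
      exact Fo.nodup b hb (hlive b hbD)
  · by_cases h1 : b = p
    · subst h1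
      rw [hV', Function.update_self, VTree.leaves_merge, List.mem_append, Fo.leaves b hpn hpD,
        Fo.leaves c hc hcD, ← exists_or]
      refine exists_congr fun x => ?_
      have : Cluster s.par (insert c D) b x ↔ _ := Set.ext_iff.mp hunion.symm x
      rw [this]
      constructor
      · rintro (⟨a, b, c, d⟩ | ⟨a, b, c, d⟩)
        exacts [⟨a, b, .inl c, d⟩, ⟨a, b, .inr c, d⟩]
      · rintro ⟨a, b, c | c, d⟩
        exacts [.inl ⟨a, b, c, d⟩, .inr ⟨a, b, c, d⟩]
    · rw [hV', Function.update_of_ne h1, Fo.leaves b hb (hlive b hbD)]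
      refine exists_congr fun x => ?_
      rw [cluster_insert_of_ne (hp.symm ▸ h1) (hp.symm ▸ hpD)]
  · by_cases h1 : b = p
    · subst h1
      simp only [Function.update_self, le_refl]
    · simp only [Function.update_of_ne h1]
      exact (Fo.le b hb (hlive b hbD)).trans (Nat.le_add_right _ _)
  · exact I.new k hk
  · by_cases h1 : b = p
    · subst h1
      simp only [hV', Function.update_self]
      refine (I.table σ hσ).congr fun ν => ?_
      rw [← hunion, holds_union .self .self hint]
      simp only [Joined, true_and]
    · simp only [hV', Function.update_of_ne h1]
      have h2 := Fo.le b hb (hlive b hbD)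
      rw [I.old _ (by omega)]
      have h3 : {x | Cluster s.par (insert c D) b x} = {x | Cluster s.par D b x} := by
        ext x; exact cluster_insert_of_ne (hp.symm ▸ h1) (hp.symm ▸ hpD)
      rw [h3]
      exact (Fo.table b hb (hlive b hbD) σ hσ).suffix I.good.ok I.suf

theorem Stage.absorbAll {C : Circuit} {M : ℕ} {s : S} (h : Stage C M 0 { s with i := 0 }) :
    Spec absorbAll s (s.nn * (absorbTime M + 3) + 10) fun s' =>
      Stage C M (s'.nn - 1) s' ∧ s'.nn = s.nn := by
  unfold KC.absorbAll
  refine Spec.mono (Spec.seq (t₁ := 2) (t₂ := (s.nn - 1) * (absorbTime M + 3) + 3 + 1)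
    (R := fun s' => s' = { s with i := 0 }) (.straight rfl (by decide) rfl) ?_) (fun _ h => h) ?_
  · rintro _ rfl
    refine .rep (fun i s' => Stage C M i s' ∧ s'.nn = s.nn) (s.nn - 1) rfl ⟨h, rfl⟩ ?_ ?_
    · rintro i hi s' ⟨h1, h2⟩
      refine (h1.absorb (h2.symm ▸ hi)).mono ?_ le_rfl
      rintro s'' ⟨h3, h4⟩
      exact ⟨h3, h4.trans h2⟩
    · rintro s' ⟨h1, h2⟩
      exact ⟨h2.symm ▸ h1, h2⟩
  · have : (s.nn - 1) * (absorbTime M + 3) ≤ s.nn * (absorbTime M + 3) := by gcongr; omega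
    omega

/-! ### The tables of the given nodes -/

/-- A rooted tree decomposition with nodes `0, …, n`, given by their bags and parents, whose root `n`
has an empty bag and is its own parent. -/
structure RawDec (C : Circuit) (n : ℕ) (bag : ℕ → List ℕ) (par : ℕ → ℕ) : Prop where
  par_le : ∀ b ≤ n, par b ≤ n
  par_root : par n = n
  reach : ∀ b ≤ n, ∃ j, par^[j] b = n
  nodup : ∀ b ≤ n, (bag b).Nodup
  sub : ∀ b ≤ n, ∀ g ∈ bag b, g ∈ C.gates
  bag_root : bag n = []
  wire : ∀ h g, C.Wire h g → ∃ b < n, h ∈ bag b ∧ g ∈ bag b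
  gate : ∀ g ∈ C.gates, ∃ b < n, g ∈ bag b
  conn : ∀ (g : ℕ) (X : Set ℕ),
    (∀ x ≤ n, g ∈ bag x → g ∈ bag (par x) → (x ∈ X ↔ par x ∈ X)) →
    ∀ x ∈ X, x ≤ n → g ∈ bag x → ∀ y ≤ n, g ∈ bag y → y ∈ X

/-- What is known about the memory during the initialization. -/
structure Base (C : Circuit) (M : ℕ) (bag : ℕ → List ℕ) (par : ℕ → ℕ) (s : S) : Prop where
  raw : RawDec C s.n bag par
  bag_eq : ∀ b ≤ s.n, bagOf s.inp s.st s.sz b = bag b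
  par_eq : ∀ b ≤ s.n, s.par b = par b
  card : ∀ b ≤ s.n, s.sz b ≤ M
  kd : ∀ g ∈ C.gates, s.kd g = (C.kind g).code
  va : s.va = fun _ => 0
  sa : s.sa = fun _ => 0
  vb : s.vb = fun _ => 0
  sb : s.sb = fun _ => 0
  out : s.out = []
  sk : s.sk = 0
  cnt : s.cnt = fun _ => 0
  qt : s.qt = 0
  vars : C.vars.card ≤ s.nG

/-- The memory after the input has been read. -/
structure InputOk (C : Circuit) (M : ℕ) (bag : ℕ → List ℕ) (par : ℕ → ℕ) (s : S) : Prop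
    extends Base C M bag par s where
  lt : ∀ g ∈ C.gates, g < s.fr
  wm : ∀ h ∈ C.gates, ∀ g ∈ C.gates, 0 < s.wm (s.off h + s.ix g) ↔ C.Wire h g
  oG : s.oG = C.output
  tab : s.tab = fun _ => 0
  seen : s.seen = fun _ => 0
  vt : s.vt = fun _ => 0
  gl : s.gl = 0
  wl : s.wl = 0

/-- The gates, tables and v-trees when leaves have been added for the variables in `P`. The leaf `x`
has the bag of one gate at the index `st x`. -/
structure Seeds (C : Circuit) (M fr₀ : ℕ) (bag : ℕ → List ℕ) (par : ℕ → ℕ) (P : Set ℕ) (L : Net)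
    (s : S) : Prop extends Base C M bag par s where
  lt : ∀ g ∈ C.gates, g < fr₀
  le : fr₀ ≤ s.fr
  good : L.Good s.fr
  str : L.Structured fun _ => False
  rep : NetRep L s.gl s.wl s.go s.wo
  zero : ∀ k, s.tt ≤ k → s.tab k = 0
  names : ∀ a ∈ L.names, a < fr₀ → a ∈ P
  seen : ∀ a, 0 < s.seen a ↔ a ∈ P
  var : ∀ u, u ∈ P ↔ ∃ e ∈ L, e.name = u ∧ e.kind = .var
  sub : ∀ u ∈ P, u ∈ C.vars
  nn : s.n < s.nn
  node : ∀ b ≤ s.n, s.tb b + 4 ^ s.sz b ≤ s.tt ∧ s.pw4 b = 4 ^ s.sz b ∧ s.vt b = 0 ∧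
    ∀ σ < 4 ^ s.sz b, L.Repr none (fun _ => LocallyOk C (bag b) σ) (s.tab (s.tb b + σ))
  leaf : ∀ x, s.n < x → x < s.nn → s.inp (s.st x) ∈ P ∧ s.sz x = 1 ∧ s.par x < s.n ∧
    s.inp (s.st x) ∈ bag (s.par x) ∧ s.tb x + 4 ≤ s.tt ∧ s.pw4 x = 4 ∧
    TreeRep s.vl s.vr s.nv (s.vt x) (.leaf (s.inp (s.st x))) ∧
    ∀ σ < 4, L.Repr (some (.leaf (s.inp (s.st x))))
      (fun ν => σ = 2 + (ν (s.inp (s.st x))).toNat) (s.tab (s.tb x + σ))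
  exists_leaf : ∀ u ∈ P, ∃ x, s.n < x ∧ x < s.nn ∧ s.inp (s.st x) = u
  unique : ∀ x, s.n < x → x < s.nn → ∀ y, s.n < y → y < s.nn → s.inp (s.st x) = s.inp (s.st y) → x = y

section

variable {C : Circuit} {l : List ℕ}

theorem initEntry_spec (s : S) (hl : l = pre (fun j => s.inp (s.b + j)) s.m) (hn : l.Nodup)
    (hkd : ∀ g ∈ l, s.kd g = (C.kind g).code)
    (hwm : ∀ h ∈ l, ∀ g ∈ l, 0 < s.wm (s.off h + s.ix g) ↔ C.Wire h g) (hoG : s.oG = C.output)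
    (hva : ∃ A, s.va = patch l A fun _ => 0) (hsa : ∃ A, s.sa = patch l A fun _ => 0) :
    Spec initEntry s (s.m * (80 * s.m + 130) + 60) fun s' => ∃ j t g h k wk sg ok w f y u, ∃ va sa,
      s' = { s with
        j := j, t := t, g := g, h := h, k := k, wk := wk, sg := sg, ok := ok, w := w, f := f, y := y
        va := va, sa := sa, tab := Function.update s.tab (s.tt + s.x) u, x := s.x + 1 } ∧
      (u = 0 ∨ u = s.tru + 1) ∧ (0 < u ↔ LocallyOk C l s.x) ∧ (∃ A, va = patch l A fun _ => 0) ∧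
      ∃ A, sa = patch l A fun _ => 0 := by
  obtain ⟨A, hA⟩ := hva
  obtain ⟨B, hB⟩ := hsa
  unfold initEntry
  refine Spec.mono (Spec.seq (decodeA_spec s hl hn) (t₂ := (s.m * (80 * s.m + 90) + 20) + 20) ?_)
    (fun _ h => h) (by linarith)
  rintro _ ⟨j, t, g, h, rfl⟩
  simp only [hA, hB, valArr, satArr, patch_patch]
  refine Spec.seq (checkState_spec (C := C) (l := l) (x := s.x) _ ⟨hl, ?_, ?_, hkd, hwm, hoG⟩) ?_
  · intro g hg; simp only [patch, hg, if_true]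
  · intro g hg; simp only [patch, hg, if_true]
  rintro _ ⟨g, k, wk, h, w, f, ok, sg, y, j, rfl, hok⟩
  refine .straight rfl (by decide) ?_
  refine ⟨_, _, _, _, _, _, _, _, _, _, _, sel 0 ok (s.tru + 1) 0, _, _, rfl, ?_, ?_, ⟨_, rfl⟩, ⟨_, rfl⟩⟩
  · simp only [sel]; split_ifs <;> simp
  · rw [← hok]; simp only [sel]; split_ifs with h <;> simp [h]

/-- A bound on the time for the table of a bag with at most `M` gates. -/
def initTime (M : ℕ) : ℕ := 4 ^ M * (80 * M * M + 200 * M + 200)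

theorem initTime_bound {m M : ℕ} (hm : m ≤ M) :
    4 ^ m * (m * (80 * m + 130) + 63) + 50 * m + 100 ≤ initTime M := by
  have h1 : (4 : ℕ) ^ m ≤ 4 ^ M := Nat.pow_le_pow_right (by norm_num) hm
  have h3 : 1 ≤ (4 : ℕ) ^ M := Nat.one_le_pow _ _ (by norm_num)
  rw [initTime]
  generalize (4 : ℕ) ^ M = X at *
  calc _ ≤ X * (M * (80 * M + 130) + 63) + 1 * (50 * M + 100) := by rw [one_mul, add_assoc]; gcongr
    _ ≤ X * (M * (80 * M + 130) + 63) + X * (50 * M + 100) := by gcongr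
    _ ≤ _ := by nlinarith

theorem initNode_spec (s : S) {M : ℕ} (hl : l = bagOf s.inp s.st s.sz s.i) (hn : l.Nodup)
    (hM : s.sz s.i ≤ M) (hkd : ∀ g ∈ l, s.kd g = (C.kind g).code)
    (hwm : ∀ h ∈ l, ∀ g ∈ l, 0 < s.wm (s.off h + s.ix g) ↔ C.Wire h g) (hoG : s.oG = C.output)
    (hva : s.va = fun _ => 0) (hsa : s.sa = fun _ => 0) (hz : ∀ k, s.tt ≤ k → s.tab k = 0) :
    Spec initNode s (initTime M) fun s' => ∃ j t g h k wk sg ok w f y m b pw x, ∃ tab : ℕ → ℕ,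
      s' = { s with
        j := j, t := t, g := g, h := h, k := k, wk := wk, sg := sg, ok := ok, w := w, f := f, y := y
        m := m, b := b, pw := pw, x := x, tab := tab, i := s.i + 1, tt := s.tt + 4 ^ s.sz s.i
        tb := Function.update s.tb s.i s.tt, pw4 := Function.update s.pw4 s.i (4 ^ s.sz s.i) } ∧
      (∀ k < s.tt, tab k = s.tab k) ∧ (∀ k, s.tt + 4 ^ s.sz s.i ≤ k → tab k = 0) ∧
      ∀ σ < 4 ^ s.sz s.i, (tab (s.tt + σ) = 0 ∨ tab (s.tt + σ) = s.tru + 1) ∧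
        (0 < tab (s.tt + σ) ↔ LocallyOk C l σ) := by
  have hm : s.sz s.i = l.length := by rw [hl, bagOf_length]
  rw [hm] at hM ⊢
  unfold initNode
  refine Spec.mono (Spec.seq (t₁ := 12) (t₂ := (l.length * (9 + 3) + 2) + (6 +
    ((4 ^ l.length * ((l.length * (80 * l.length + 130) + 60) + 3) + 2) + ((30 * l.length + 10) + 20))))
    (R := fun s' => s' = { s with
      tb := Function.update s.tb s.i s.tt, m := l.length, b := s.st s.i, pw := 1 })
    (.straight rfl (by decide) (by rw [← hm]; rfl)) ?_) (fun _ h => h) ?_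
  swap
  · refine le_trans ?_ (initTime_bound hM)
    linarith
  rintro _ rfl
  refine Spec.seq (R := fun s' => s' = { s with
      tb := Function.update s.tb s.i s.tt, m := l.length, b := s.st s.i, pw := 4 ^ l.length }) ?_ ?_
  · refine .rep (fun i s' => s' = { s with
      tb := Function.update s.tb s.i s.tt, m := l.length, b := s.st s.i, pw := 4 ^ i }) l.length rfl rfl
      ?_ (fun _ h => h)
    rintro i hi _ rfl
    refine .straight rfl (by decide) ?_
    rw [show 4 ^ (i + 1) = 4 ^ i + 4 ^ i + 4 ^ i + 4 ^ i by rw [pow_succ]; omega]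
    rfl
  rintro _ rfl
  refine Spec.seq (R := fun s' => s' = { s with
      tb := Function.update s.tb s.i s.tt, m := l.length, b := s.st s.i, pw := 4 ^ l.length
      pw4 := Function.update s.pw4 s.i (4 ^ l.length), x := 0 }) (.straight rfl (by decide) rfl) ?_
  rintro _ rfl
  have hlp : l = pre (fun j => s.inp (s.st s.i + j)) l.length := by rw [← hm]; exact hl
  refine Spec.seq (R := fun s' => ∃ j t g h k wk sg ok w f y x, ∃ tab va sa : ℕ → ℕ,
      s' = { s with
        j := j, t := t, g := g, h := h, k := k, wk := wk, sg := sg, ok := ok, w := w, f := f, y := y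
        va := va, sa := sa, tab := tab, x := x
        tb := Function.update s.tb s.i s.tt, m := l.length, b := s.st s.i, pw := 4 ^ l.length
        pw4 := Function.update s.pw4 s.i (4 ^ l.length) } ∧
      (∀ k < s.tt, tab k = s.tab k) ∧ (∀ k, s.tt + 4 ^ l.length ≤ k → tab k = 0) ∧
      (∀ σ < 4 ^ l.length, (tab (s.tt + σ) = 0 ∨ tab (s.tt + σ) = s.tru + 1) ∧
        (0 < tab (s.tt + σ) ↔ LocallyOk C l σ)) ∧ (∃ A, va = patch l A fun _ => 0) ∧
      ∃ A, sa = patch l A fun _ => 0) ?_ ?_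
  · refine .rep (fun i s' => ∃ j t g h k wk sg ok w f y, ∃ tab va sa : ℕ → ℕ,
      s' = { s with
        j := j, t := t, g := g, h := h, k := k, wk := wk, sg := sg, ok := ok, w := w, f := f, y := y
        va := va, sa := sa, tab := tab, x := i
        tb := Function.update s.tb s.i s.tt, m := l.length, b := s.st s.i, pw := 4 ^ l.length
        pw4 := Function.update s.pw4 s.i (4 ^ l.length) } ∧
      (∀ k < s.tt, tab k = s.tab k) ∧ (∀ k, s.tt + i ≤ k → tab k = 0) ∧
      (∀ σ < i, (tab (s.tt + σ) = 0 ∨ tab (s.tt + σ) = s.tru + 1) ∧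
        (0 < tab (s.tt + σ) ↔ LocallyOk C l σ)) ∧ (∃ A, va = patch l A fun _ => 0) ∧
      ∃ A, sa = patch l A fun _ => 0) (4 ^ l.length) rfl ?_ ?_ ?_
    · have hzz : ∃ A, (fun _ : ℕ => 0) = patch l A fun _ => 0 :=
        ⟨fun _ => 0, by funext g; simp [patch]⟩
      exact ⟨_, _, _, _, _, _, _, _, _, _, _, _, _, _, rfl, fun _ _ => rfl, hz, fun σ hσ => by omega,
        hva ▸ hzz, hsa ▸ hzz⟩
    · rintro i hi _ ⟨j, t, g, h, k, wk, sg, ok, w, f, y, tab, va, sa, rfl, h1, h2, h3, h4, h5⟩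
      refine Spec.mono (initEntry_spec (C := C) (l := l) _ hlp hn hkd hwm hoG h4 h5) ?_ le_rfl
      rintro _ ⟨j, t, g, h, k, wk, sg, ok, w, f, y, u, va, sa, rfl, h6, h7, h8⟩
      refine ⟨_, _, _, _, _, _, _, _, _, _, _, _, _, _, rfl, fun k hk => ?_, fun k hk => ?_,
        fun σ hσ => ?_, h8⟩
      · rw [← h1 k hk]; exact Function.update_of_ne (by show k ≠ s.tt + i; omega) _ _
      · rw [← h2 k (by omega)]; exact Function.update_of_ne (by show k ≠ s.tt + i; omega) _ _
      · rcases Nat.lt_succ_iff_lt_or_eq.mp hσ with hσ | rfl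
        · have : Function.update tab (s.tt + i) u (s.tt + σ) = tab (s.tt + σ) :=
            Function.update_of_ne (by omega) _ _
          show (Function.update tab (s.tt + i) u (s.tt + σ) = 0 ∨
            Function.update tab (s.tt + i) u (s.tt + σ) = s.tru + 1) ∧
            (0 < Function.update tab (s.tt + i) u (s.tt + σ) ↔ _)
          rw [this]
          exact h3 σ hσ
        · show (Function.update tab (s.tt + σ) u (s.tt + σ) = 0 ∨
            Function.update tab (s.tt + σ) u (s.tt + σ) = s.tru + 1) ∧
            (0 < Function.update tab (s.tt + σ) u (s.tt + σ) ↔ _)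
          rw [Function.update_self]
          exact ⟨h6, h7⟩
    · rintro _ ⟨j, t, g, h, k, wk, sg, ok, w, f, y, tab, va, sa, rfl, h1⟩
      exact ⟨_, _, _, _, _, _, _, _, _, _, _, _, _, _, _, rfl, h1⟩
  rintro _ ⟨j, t, g, h, k, wk, sg, ok, w, f, y, x, tab, va, sa, rfl, h1, h2, h3, ⟨A, h4⟩, ⟨B, h5⟩⟩
  refine Spec.seq (clearA_spec _ hlp) ?_
  rintro _ ⟨j, g, rfl⟩
  have h6 : patch l (fun _ => 0) va = s.va := by rw [h4, patch_zero, hva]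
  have h7 : patch l (fun _ => 0) sa = s.sa := by rw [h5, patch_zero, hsa]
  simp only [h6, h7]
  refine .straight rfl (by decide) ?_
  exact ⟨_, _, _, _, _, _, _, _, _, _, _, _, _, _, _, _, rfl, h1, h2, h3⟩

theorem initTables_spec (s : S) {M : ℕ} {bag : ℕ → List ℕ} {par : ℕ → ℕ} (I : InputOk C M bag par s) :
    Spec initTables s ((s.n + 1) * (initTime M + 3) + 50) fun s' =>
      (∃ L, Seeds C M s.fr bag par ∅ L { s' with nn := s'.n + 1 }) ∧ s'.n = s.n := by
  set L : Net := [⟨s.fr, .and, []⟩]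
  have hok : L.Ok := ⟨trivial, by simp [Net.names], by simp, by simp, by simp, by simp, by simp, by simp⟩
  have hrep : NetRep L (s.gl + 2) s.wl (Function.update (Function.update s.go s.gl s.fr) (s.gl + 1) 3)
      s.wo := NetRep.cons₀ (L := []) (by rw [I.gl, I.wl]; exact ⟨rfl, rfl⟩) s.fr .and
  have htru : ∀ P : Prop, ∀ u, (u = 0 ∨ u = s.fr + 1) → (0 < u ↔ P) → L.Repr none (fun _ => P) u := by
    rintro P u (rfl | rfl) hu
    · exact ⟨fun _ _ hP => absurd (hu.mpr hP) (lt_irrefl _), by simp, by simp, by simp, by simp⟩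
    · have hP := hu.mp (by omega)
      exact ⟨by simp, by simp [L, Net.names], by simp [L, Net.ev, hP], by simp [L, Net.below],
        by simp [hP]⟩
  unfold initTables
  refine Spec.mono (Spec.seq (t₁ := 25) (t₂ := (s.n + 1) * (initTime M + 3) + 3 + 1)
    (R := fun s' => s' = { s with
      gl := s.gl + 2, go := Function.update (Function.update s.go s.gl s.fr) (s.gl + 1) 3
      z := s.fr, fr := s.fr + 1, tru := s.fr, i := 0 })
    (.straight rfl (by decide) (by simp only [newGate, useName, Cmd.den, Expr.eval, Expr.eval_add, Expr.eval_sub, Expr.eval_ofNat, S.get, S.set,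
      S.getA, S.setA])) ?_) (fun _ h => h) (by omega)
  rintro _ rfl
  refine .rep (fun i s' => ∃ j t g h k wk sg ok w f y m b pw x tt, ∃ tab tb pw4 : ℕ → ℕ,
      s' = { s with
        gl := s.gl + 2, go := Function.update (Function.update s.go s.gl s.fr) (s.gl + 1) 3
        z := s.fr, fr := s.fr + 1, tru := s.fr
        j := j, t := t, g := g, h := h, k := k, wk := wk, sg := sg, ok := ok, w := w, f := f, y := y
        m := m, b := b, pw := pw, x := x, tab := tab, i := i, tt := tt, tb := tb, pw4 := pw4 } ∧
      (∀ k, tt ≤ k → tab k = 0) ∧ ∀ b < i, tb b + 4 ^ s.sz b ≤ tt ∧ pw4 b = 4 ^ s.sz b ∧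
        ∀ σ < 4 ^ s.sz b, L.Repr none (fun _ => LocallyOk C (bag b) σ) (tab (tb b + σ)))
    (s.n + 1) rfl ?_ ?_ ?_
  · exact ⟨_, _, _, _, _, _, _, _, _, _, _, _, _, _, _, _, _, _, _, rfl, fun k _ => by rw [I.tab],
      fun b hb => by omega⟩
  · rintro i hi _ ⟨j, t, g, h, k, wk, sg, ok, w, f, y, m, b, pw, x, tt, tab, tb, pw4, rfl, h1, h2⟩
    have hi' : i ≤ s.n := by omega
    have hbag := I.bag_eq i hi'
    have hsub := I.raw.sub i hi'
    refine Spec.mono (initNode_spec (C := C) (l := bag i) (M := M) _ hbag.symm (I.raw.nodup i hi')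
      (I.card i hi') (fun g hg => I.kd g (hsub g hg))
      (fun h hh g hg => I.wm h (hsub h hh) g (hsub g hg)) I.oG I.va I.sa h1) ?_ le_rfl
    rintro _ ⟨j, t, g, h, k, wk, sg, ok, w, f, y, m, b, pw, x, tab', rfl, h3, h4, h5⟩
    refine ⟨_, _, _, _, _, _, _, _, _, _, _, _, _, _, _, _, _, _, _, rfl, h4, fun b hb => ?_⟩
    rcases Nat.lt_succ_iff_lt_or_eq.mp hb with hb | rfl
    · obtain ⟨h6, h7, h8⟩ := h2 b hb
      simp only [Function.update_of_ne hb.ne]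
      refine ⟨h6.trans (Nat.le_add_right _ _), h7, fun σ hσ => ?_⟩
      rw [h3 _ (by show _ < tt; omega)]
      exact h8 σ hσ
    · simp only [Function.update_self]
      exact ⟨le_rfl, trivial, fun σ hσ => htru _ _ (h5 σ hσ).1 (h5 σ hσ).2⟩
  · rintro _ ⟨j, t, g, h, k, wk, sg, ok, w, f, y, m, b, pw, x, tt, tab, tb, pw4, rfl, h1, h2⟩
    refine ⟨⟨L, ⟨I.raw, I.bag_eq, I.par_eq, I.card, I.kd, I.va, I.sa, I.vb, I.sb, I.out, I.sk, I.cnt,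
      I.qt, I.vars⟩, I.lt, Nat.le_succ _, ⟨hok, by simp [L, Net.names]⟩, ?_, hrep, h1, ?_, ?_, ?_, ?_,
      Nat.lt_succ_self _, fun b hb => ?_, fun x h1 h2 => ?_, ?_, fun x h1 h2 => ?_⟩, rfl⟩
    · simp [L, Net.Structured]
    · simp [L, Net.names]
    · simp [I.seen]
    · simp [L]
    · simp
    · obtain ⟨h3, h4, h5⟩ := h2 b (by show b < s.n + 1; exact Nat.lt_succ_of_le hb)
      exact ⟨h3, h4, by rw [I.vt], h5⟩
    · simp only at h1 h2; omega
    · simp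
    · simp only at h1 h2; omega

end

/-! ### Leaves for the variables -/

section

variable {C : Circuit} {M fr₀ : ℕ} {bag : ℕ → List ℕ} {par : ℕ → ℕ} {P : Set ℕ} {L : Net} {s : S}

/-- The functions of the four states at the leaf of the variable `g`: none for the states 0 and 1, the
negation of `g` for the state 2, and `g` itself for the state 3. -/
theorem Net.Good.literals (h : L.Good s.fr) {g : ℕ} (hg : g ∉ L.names) (hlt : g < s.fr) :
    Good (⟨s.fr, .not, [g]⟩ :: ⟨g, .var, []⟩ :: L) (s.fr + 1) ∧
      ∀ σ < 4, ∀ e, (σ < 2 → e = 0) → (σ = 2 → e = s.fr + 1) → (σ = 3 → e = g + 1) →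
        Repr (⟨s.fr, .not, [g]⟩ :: ⟨g, .var, []⟩ :: L) (some (.leaf g))
          (fun ν => σ = 2 + (ν g).toNat) e := by
  have h₁ : Good (⟨g, .var, []⟩ :: L) s.fr :=
    ⟨⟨h.ok, hg, by simp, by simp, by simp, by simp, by simp, by simp⟩, fun a ha => by
      rcases List.mem_cons.mp ha with rfl | ha
      exacts [hlt, h.lt a ha]⟩
  refine ⟨h₁.cons ⟨h₁.not_mem, by simp [names], by simp, by simp, fun _ => ⟨g, rfl, ?_⟩, by simp, by simp⟩
    rfl, fun σ hσ e h0 h2 h3 => ?_⟩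
  · exact ⟨_, List.mem_cons_self, rfl, rfl⟩
  · have hne : g ≠ s.fr := hlt.ne
    interval_cases σ
    · rw [h0 (by norm_num)]
      exact ⟨fun _ ν => by omega, by simp, by simp, by simp, by simp⟩
    · rw [h0 (by norm_num)]
      exact ⟨fun _ ν => by omega, by simp, by simp, by simp, by simp⟩
    · rw [h2 rfl]
      refine ⟨by simp, by simp [names], fun _ ν => ?_, ?_, by simp⟩
      · cases hν : ν g <;> simp [Net.ev, hne, hν]
      · simp [Net.below, hne, VTree.leaves, BinTree.leaves]
    · rw [h3 rfl]
      refine ⟨by simp, by simp [names], fun _ ν => ?_, ?_, by simp⟩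
      · cases hν : ν g <;> simp [Net.ev, hne, hν]
      · simp [Net.below, hne, VTree.leaves, BinTree.leaves]

theorem Seeds.aux (h : Seeds C M fr₀ bag par P L s) (i j m b g : ℕ) :
    Seeds C M fr₀ bag par P L { s with i := i, j := j, m := m, b := b, g := g } :=
  ⟨⟨h.raw, h.bag_eq, h.par_eq, h.card, h.kd, h.va, h.sa, h.vb, h.sb, h.out, h.sk, h.cnt, h.qt,
    h.vars⟩, h.lt, h.le, h.good, h.str, h.rep, h.zero, h.names, h.seen, h.var, h.sub, h.nn, h.node,
    h.leaf, h.exists_leaf, h.unique⟩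

/-- The new gates and the new node extend the seeds by the variable `g`. -/
theorem Seeds.newLeaf (h : Seeds C M fr₀ bag par P L s) (hi : s.i < s.n) (hb : s.b = s.st s.i)
    (hj : s.j < s.sz s.i) (hg : s.g = s.inp (s.b + s.j)) (hk : C.kind s.g = .var) (hP : s.g ∉ P) :
    Seeds C M fr₀ bag par (insert s.g P) (⟨s.fr, .not, [s.g]⟩ :: ⟨s.g, .var, []⟩ :: L)
      (newLeaf.den s) ∧ ∃ seen gl go wl wo z fr par sz st tb pw4 tab tt nv vl vr vt nn,
        newLeaf.den s = { s with
          seen := seen, gl := gl, go := go, wl := wl, wo := wo, z := z, fr := fr, par := par, sz := sz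
          st := st, tb := tb, pw4 := pw4, tab := tab, tt := tt, nv := nv, vl := vl, vr := vr, vt := vt
          nn := nn } ∧ sz s.i = s.sz s.i ∧ st s.i = s.st s.i := by
  unfold KC.newLeaf newGate newWire useName
  simp only [Cmd.den, Expr.eval, Expr.eval_add, Expr.eval_sub, Expr.eval_ofNat, S.get, S.set,
    S.getA, S.setA]
  have hin : s.i ≠ s.nn := by have := h.nn; omega
  refine ⟨?_, _, _, _, _, _, _, _, _, _, _, _, _, _, _, _, _, _, _, _, rfl,
    Function.update_of_ne hin _ _, Function.update_of_ne hin _ _⟩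
  have hgb : s.g ∈ bag s.i := by
    rw [← h.bag_eq s.i hi.le, hg, hb]
    exact mem_pre.mpr ⟨_, hj, rfl⟩
  have hgC := h.raw.sub s.i hi.le _ hgb
  have hg₀ := h.lt _ hgC
  have hfresh : s.g ∉ L.names := fun hh => hP (h.names _ hh hg₀)
  obtain ⟨good, hR⟩ := h.good.literals hfresh (hg₀.trans_le h.le)
  have hsuf : L <:+ ⟨s.fr, .not, [s.g]⟩ :: ⟨s.g, .var, []⟩ :: L :=
    (List.suffix_cons _ _).trans (List.suffix_cons _ _)
  have hle : ∀ b ≤ s.n, b ≠ s.nn := fun b hb => by have := h.nn; omega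
  have hst : s.inp (s.b + s.j) = s.g := hg.symm
  have hold : ∀ x, s.n < x → x < s.nn → s.inp (s.st x) ≠ s.g := fun x h1 h2 hh =>
    hP (hh ▸ (h.leaf x h1 h2).1)
  refine ⟨⟨h.raw, fun b hb => ?_, fun b hb => ?_, fun b hb => ?_, h.kd, h.va, h.sa, h.vb, h.sb, h.out,
    h.sk, h.cnt, h.qt, h.vars⟩, h.lt, h.le.trans (Nat.le_succ _), good, ?_,
    (h.rep.cons₀ _ .var).cons₁ _ _ .not, fun k hk => ?_, fun a ha ha' => ?_, fun a => ?_, fun u => ?_, ?_,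
    h.nn.trans (Nat.lt_succ_self _), fun b hb => ?_, fun x h1 h2 => ?_, fun u hu => ?_,
    fun x h1 h2 y h3 h4 hxy => ?_⟩
  · rw [← h.bag_eq b hb]
    simp only [bagOf, Function.update_of_ne (hle b hb)]
  · rw [← h.par_eq b hb]
    exact Function.update_of_ne (hle b hb) _ _
  · simp only [Function.update_of_ne (hle b hb)]; exact h.card b hb
  · exact (h.str.cons good.ok.1 (by simp)).cons good.ok (by simp)
  · simp only at hk ⊢
    rw [Function.update_of_ne (by omega), Function.update_of_ne (by omega)]
    exact h.zero k (by omega)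
  · simp only [Net.names, List.map_cons, List.mem_cons] at ha
    rcases ha with rfl | rfl | ha
    · exact absurd ha' (not_lt.mpr h.le)
    · exact Set.mem_insert _ _
    · exact Set.mem_insert_of_mem _ (h.names a ha ha')
  · by_cases ha : a = s.g
    · subst ha; simp
    · simp [ha, h.seen]
  · simp only [Set.mem_insert_iff, h.var, List.mem_cons]
    constructor
    · rintro (rfl | ⟨e, h1, h2⟩)
      exacts [⟨_, .inr (.inl rfl), rfl, rfl⟩, ⟨e, .inr (.inr h1), h2⟩]
    · rintro ⟨e, rfl | rfl | h1, h2, h3⟩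
      · simp at h3
      · exact .inl h2.symm
      · exact .inr ⟨e, h1, h2, h3⟩
  · rintro u (rfl | hu)
    exacts [by simp [Circuit.vars, hgC, hk], h.sub u hu]
  · simp only [Function.update_of_ne (hle b hb)]
    obtain ⟨h1, h2, h3, h4⟩ := h.node b hb
    refine ⟨by omega, h2, h3, fun σ hσ => ?_⟩
    rw [Function.update_of_ne (by omega), Function.update_of_ne (by omega)]
    exact (h4 σ hσ).suffix good.ok hsuf
  · simp only at h1 h2
    rcases Nat.lt_succ_iff_lt_or_eq.mp h2 with h2 | rfl
    · simp only [Function.update_of_ne h2.ne]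
      obtain ⟨h3, h4, h5, h6, h7, h8, h9, h10⟩ := h.leaf x h1 h2
      refine ⟨Set.mem_insert_of_mem _ h3, h4, h5, h6, by omega, h8, h9.write (Nat.le_succ _),
        fun σ hσ => ?_⟩
      rw [Function.update_of_ne (by omega), Function.update_of_ne (by omega)]
      exact (h10 σ hσ).suffix good.ok hsuf
    · simp only [Function.update_self, hst]
      refine ⟨Set.mem_insert _ _, trivial, hi, hgb, le_rfl, trivial,
        ⟨⟨Nat.succ_pos _, le_rfl⟩, Function.update_self _ _ _, Function.update_self _ _ _⟩,
        fun σ hσ => hR σ hσ _ (fun h2 => ?_) ?_ ?_⟩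
      · rw [Function.update_of_ne (by omega), Function.update_of_ne (by omega)]
        exact h.zero _ (by omega)
      · rintro rfl
        rw [Function.update_of_ne (by omega), Function.update_self]
      · rintro rfl
        rw [Function.update_self]
  · rcases hu with rfl | hu
    · refine ⟨s.nn, h.nn, Nat.lt_succ_self _, ?_⟩
      simp only [Function.update_self, hst]
    · obtain ⟨x, h1, h2, h3⟩ := h.exists_leaf u hu
      refine ⟨x, h1, h2.trans (Nat.lt_succ_self _), ?_⟩
      simp only [Function.update_of_ne h2.ne, h3]
  · simp only at h1 h2 h3 h4 hxy
    rcases Nat.lt_succ_iff_lt_or_eq.mp h2 with h2 | rfl <;>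
    rcases Nat.lt_succ_iff_lt_or_eq.mp h4 with h4 | rfl
    · rw [Function.update_of_ne h2.ne, Function.update_of_ne h4.ne] at hxy
      exact h.unique x h1 h2 y h3 h4 hxy
    · rw [Function.update_of_ne h2.ne, Function.update_self, hst] at hxy
      exact absurd hxy (hold x h1 h2)
    · rw [Function.update_of_ne h4.ne, Function.update_self, hst] at hxy
      exact absurd hxy.symm (hold y h3 h4)
    · rfl

/-- The memory while the gates of the node `i` are treated, `j` of which are done. -/
def Leaving (C : Circuit) (M fr₀ : ℕ) (bag : ℕ → List ℕ) (par : ℕ → ℕ) (n i j : ℕ) (s : S) : Prop :=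
  ∃ P L, Seeds C M fr₀ bag par P L s ∧ s.n = n ∧ s.i = i ∧ s.j = j ∧
    (∀ b < i, ∀ u ∈ bag b, C.kind u = .var → u ∈ P) ∧
    ∀ j' < j, C.kind (s.inp (s.st i + j')) = .var → s.inp (s.st i + j') ∈ P

theorem leafGate_spec {n i j m : ℕ} (h : Leaving C M fr₀ bag par n i j s) (hi : i < n)
    (hb : s.b = s.st i) (hm : s.sz i = m) (hj : j < m) :
    Spec leafGate s 200 fun s' => Leaving C M fr₀ bag par n i (j + 1) s' ∧ s'.b = s'.st i ∧
      s'.sz i = m := by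
  obtain ⟨P, L, h, rfl, rfl, rfl, h1, h2⟩ := h
  subst hm
  have hgC : s.inp (s.st s.i + s.j) ∈ C.gates := by
    refine h.raw.sub s.i hi.le _ ?_
    rw [← h.bag_eq s.i hi.le]
    exact mem_pre.mpr ⟨_, hj, rfl⟩
  have hkd := h.kd _ hgC
  obtain ⟨s₁, hs₁⟩ : ∃ s₁ : S, s₁ = { s with g := s.inp (s.b + s.j) } := ⟨_, rfl⟩
  have h₁ : Seeds C M fr₀ bag par P L s₁ := by
    rw [hs₁]
    exact h.aux _ _ _ _ _
  have hg₁ : s₁.g = s₁.inp (s₁.b + s₁.j) := by rw [hs₁]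
  have hfin : ∀ P' L' s₂, P ⊆ P' → (C.kind s₁.g = .var → s₁.g ∈ P') → Seeds C M fr₀ bag par P' L' s₂ →
      (s₂.inp = s.inp ∧ s₂.n = s.n ∧ s₂.i = s.i ∧ s₂.j = s.j ∧ s₂.b = s.b) ∧
        s₂.sz s.i = s.sz s.i ∧ s₂.st s.i = s.st s.i →
      Leaving C M fr₀ bag par s.n s.i (s.j + 1) { s₂ with j := s₂.j + 1 } ∧ s₂.b = s₂.st s.i ∧
        s₂.sz s.i = s.sz s.i := by
    rintro P' L' s₂ hP hg h ⟨⟨e1, e2, e3, e4, e5⟩, e6, e7⟩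
    refine ⟨⟨P', L', h.aux _ _ _ _ _, e2, e3, congrArg (· + 1) e4,
      fun b hb u hu hk => hP (h1 b hb u hu hk), fun j' hj' => ?_⟩, by rw [e5, e7, hb], e6⟩
    show C.kind (s₂.inp (s₂.st s.i + j')) = .var → s₂.inp (s₂.st s.i + j') ∈ P'
    rw [e1, e7]
    rcases Nat.lt_succ_iff_lt_or_eq.mp hj' with hj' | rfl
    · exact fun hk => hP (h2 j' hj' hk)
    · have : s₁.g = s.inp (s.st s.i + s.j) := by rw [hs₁, ← hb]
      rwa [this] at hg
  refine .straight rfl (by decide) ?_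
  unfold leafGate
  simp only [Cmd.den]
  have hset : s.set (Expr.eval s (.ld .inp (.v .b + .v .j))) .g = s₁ := by rw [hs₁]; rfl
  rw [hset]
  have hkd₁ : s₁.kd s₁.g = (C.kind s₁.g).code := by
    rw [hs₁]; simp only [hb]; exact hkd
  have e1 : Expr.eval s₁ (.ld .kd (.v .g)) = (C.kind s₁.g).code := hkd₁
  have e2 : Expr.eval s₁ (.ld .seen (.v .g)) = s₁.seen s₁.g := rfl
  have e3 : Expr.eval s₁ 1 = 1 := rfl
  rw [e1, e2, e3]
  have hend : ∀ s₂ : S, s₂.set (Expr.eval s₂ (.v .j + 1)) .j = { s₂ with j := s₂.j + 1 } :=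
    fun _ => rfl
  rw [hend]
  by_cases hk : C.kind s₁.g = .var
  · simp only [sel, hk, GateKind.code, zero_lt_one, if_true]
    by_cases hse : s₁.seen s₁.g < 1
    · rw [if_pos hse]
      have hgP : s₁.g ∉ P := fun hh => by have := (h₁.seen _).mpr hh; omega
      obtain ⟨h3, seen, gl, go, wl, wo, z, fr, par, sz, st, tb, pw4, tab, tt, nv, vl, vr, vt, nn, h4, h5,
        h6⟩ := h₁.newLeaf (by rw [hs₁]; exact hi) (by rw [hs₁]; exact hb) (by rw [hs₁]; exact hj) hg₁ hk hgP
      refine hfin _ _ _ (Set.subset_insert _ _) (fun _ => Set.mem_insert _ _) h3 ?_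
      rw [h4]
      subst hs₁
      exact ⟨⟨rfl, rfl, rfl, rfl, rfl⟩, h5, h6⟩
    · rw [if_neg hse]
      refine hfin P L s₁ (fun _ h => h) (fun _ => (h₁.seen _).mp (by omega)) h₁ ?_
      subst hs₁
      exact ⟨⟨rfl, rfl, rfl, rfl, rfl⟩, rfl, rfl⟩
  · have : ¬ (C.kind s₁.g).code < 1 := by
      revert hk; cases C.kind s₁.g <;> simp [GateKind.code]
    simp only [sel, this, if_false]
    refine hfin P L s₁ (fun _ h => h) (fun h => absurd h hk) h₁ ?_
    subst hs₁
    exact ⟨⟨rfl, rfl, rfl, rfl, rfl⟩, rfl, rfl⟩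

/-- The register `j` and other auxiliary registers do not matter. -/
theorem Leaving.congr {n i j : ℕ} (h : Leaving C M fr₀ bag par n i j s) (i' m b g : ℕ)
    (hi : i' = i ∨ i' = i + 1 ∧ ∀ P : Set ℕ, (∀ b < i, ∀ u ∈ bag b, C.kind u = .var → u ∈ P) →
      (∀ j' < j, C.kind (s.inp (s.st i + j')) = .var → s.inp (s.st i + j') ∈ P) →
      ∀ u ∈ bag i, C.kind u = .var → u ∈ P) :
    Leaving C M fr₀ bag par n i' 0 { s with i := i', m := m, b := b, j := 0, g := g } := by
  obtain ⟨P, L, h, h1, h2, h3, h4, h5⟩ := h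
  refine ⟨P, L, h.aux _ _ _ _ _, h1, rfl, rfl, ?_, by simp⟩
  rcases hi with rfl | ⟨rfl, hi⟩
  · exact h4
  · intro b hb
    rcases Nat.lt_succ_iff_lt_or_eq.mp hb with hb | rfl
    exacts [h4 b hb, hi P h4 h5]

theorem leafNode_spec {n i : ℕ} (h : Leaving C M fr₀ bag par n i 0 { s with j := 0 }) (hi : i < n) :
    Spec leafNode s (M * 203 + 50) fun s' => Leaving C M fr₀ bag par n (i + 1) 0 { s' with j := 0 } := by
  have hsi : s.i = i := by obtain ⟨P, L, h⟩ := h; exact h.2.2.1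
  have hM : s.sz i ≤ M := by obtain ⟨P, L, h, h1, _⟩ := h; exact h.card i (by rw [h1]; exact hi.le)
  unfold leafNode
  refine Spec.mono (Spec.seq (t₁ := 20) (t₂ := (s.sz i * (200 + 3) + 2) + 20)
    (R := fun s' => s' = { s with m := s.sz i, b := s.st i, j := 0 })
    (.straight rfl (by decide) (by subst hsi; rfl)) ?_) (fun _ h => h) ?_
  swap
  · have : s.sz i * (200 + 3) ≤ M * 203 := Nat.mul_le_mul_right _ hM
    omega
  rintro _ rfl
  refine Spec.seq (R := fun s' => Leaving C M fr₀ bag par n i (s.sz i) s' ∧ s'.b = s'.st i ∧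
      s'.sz i = s.sz i) ?_ ?_
  · refine .rep (fun j s' => Leaving C M fr₀ bag par n i j s' ∧ s'.b = s'.st i ∧ s'.sz i = s.sz i)
      (s.sz i) rfl ?_ ?_ (fun _ h => h)
    · refine ⟨?_, rfl, rfl⟩
      have := h.congr s.i (s.sz i) (s.st i) s.g (.inl hsi)
      rw [hsi] at this
      subst hsi
      exact this
    · rintro j hj s' ⟨h1, h2, h3⟩
      exact leafGate_spec h1 hi h2 h3 hj
  · rintro s' ⟨h1, h2, h3⟩
    refine .straight rfl (by decide) ?_
    have hs' : s'.i = i := by obtain ⟨P, L, h⟩ := h1; exact h.2.2.1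
    have := h1.congr (s'.i + 1) s'.m s'.b s'.g (.inr ⟨by rw [hs'], fun P h4 h5 u hu => ?_⟩)
    · rw [hs'] at this
      subst hs'
      exact this
    · have hbag : bagOf s'.inp s'.st s'.sz i = bag i := by
        obtain ⟨P, L, h, h1, _⟩ := h1; exact h.bag_eq i (by rw [h1]; exact hi.le)
      rw [← hbag] at hu
      obtain ⟨j, hj, rfl⟩ := mem_pre.mp hu
      exact h5 j (h3 ▸ hj)

theorem addLeaves_spec (h : Seeds C M fr₀ bag par ∅ L { s with nn := s.n + 1 }) :
    Spec addLeaves s (s.n * (M * 203 + 60) + 20) fun s' =>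
      (∃ L, Seeds C M fr₀ bag par (C.vars : Set ℕ) L s') ∧ s'.n = s.n := by
  unfold addLeaves
  refine Spec.mono (Spec.seq (t₁ := 6) (t₂ := s.n * (M * 203 + 50 + 3) + 2)
    (R := fun s' => s' = { s with nn := s.n + 1, i := 0 })
    (.straight rfl (by decide) rfl) ?_) (fun _ h => h) (by nlinarith)
  rintro _ rfl
  refine .rep (fun i s' => Leaving C M fr₀ bag par s.n i 0 { s' with j := 0 }) s.n rfl ?_ ?_ ?_
  · exact ⟨∅, L, h.aux _ _ _ _ _, rfl, rfl, rfl, by simp, by simp⟩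
  · intro i hi s' h'
    exact leafNode_spec h' hi
  · rintro s' ⟨P, L, h, h1, h2, h3, h4, h5⟩
    have : P = (C.vars : Set ℕ) := by
      ext u
      refine ⟨h.sub u, fun hu => ?_⟩
      obtain ⟨hu, hk⟩ := Finset.mem_filter.mp (Finset.mem_coe.mp hu)
      obtain ⟨b, hb, hub⟩ := h.raw.gate u hu
      exact h4 b (h1 ▸ hb) u hub hk
    subst this
    exact ⟨⟨L, ⟨h.raw, h.bag_eq, h.par_eq, h.card, h.kd, h.va, h.sa, h.vb, h.sb, h.out, h.sk,
      h.cnt, h.qt, h.vars⟩, h.lt, h.le, h.good, h.str, h.rep, h.zero, h.names, h.seen, h.var, h.sub,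
      h.nn, h.node, h.leaf, h.exists_leaf, h.unique⟩, h1⟩

end

theorem cluster_empty {par : ℕ → ℕ} {b x : ℕ} : Cluster par ∅ b x ↔ x = b := by
  constructor
  · rintro (_ | ⟨h, _⟩)
    exacts [rfl, h.elim]
  · rintro rfl; exact .self

theorem iterate_congr {f g : ℕ → ℕ} {n : ℕ} (hg : ∀ b ≤ n, g b ≤ n) (h : ∀ b ≤ n, f b = g b) (j : ℕ) :
    ∀ b ≤ n, f^[j] b = g^[j] b := by
  induction j with
  | zero => exact fun _ _ => rfl
  | succ j ih =>
    intro b hb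
    rw [Function.iterate_succ_apply, Function.iterate_succ_apply, h b hb, ih _ (hg b hb)]

section

variable {C : Circuit} {M fr₀ : ℕ} {bag : ℕ → List ℕ} {par : ℕ → ℕ} {L : Net} {s : S}

theorem Seeds.bagOf_leaf {P : Set ℕ} (h : Seeds C M fr₀ bag par P L s) {x : ℕ} (h1 : s.n < x)
    (h2 : x < s.nn) : bagOf s.inp s.st s.sz x = [s.inp (s.st x)] := by
  obtain ⟨_, h3, _⟩ := h.leaf x h1 h2
  simp [bagOf, h3, pre]

/-- With leaves for all variables, the decomposition has its normal form. -/
theorem Seeds.normalDec (h : Seeds C M fr₀ bag par (C.vars : Set ℕ) L s) :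
    NormalDec C s.n s.nn (bagOf s.inp s.st s.sz) s.par := by
  have R := h.raw
  have hpar : ∀ x < s.nn, s.par x ≤ s.n := fun x hx => by
    by_cases hxn : x ≤ s.n
    · rw [h.par_eq x hxn]; exact R.par_le x hxn
    · obtain ⟨_, _, h3, _⟩ := h.leaf x (by omega) hx
      exact h3.le
  have hreach : ∀ b ≤ s.n, ∃ j, s.par^[j] b = s.n := fun b hb => by
    obtain ⟨j, hj⟩ := R.reach b hb
    exact ⟨j, by rw [iterate_congr R.par_le h.par_eq j b hb, hj]⟩
  refine ⟨h.nn, fun b hb => (hpar b hb).trans_lt h.nn, ?_, fun b hb => ?_, fun b hb => ?_,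
    fun b hb g hg => ?_, ?_, fun b h1 h2 => ?_, fun v hv => ?_, fun b b' v h1 h2 h3 h4 h5 h6 => ?_,
    fun i g hw => ?_, fun g hg => ?_, fun g X hX x hx hxn hgx y hy hgy => ?_⟩
  · rw [h.par_eq _ le_rfl, R.par_root]
  · obtain ⟨j, hj⟩ := hreach _ (hpar b hb)
    exact ⟨j + 1, hj⟩
  · by_cases hbn : b ≤ s.n
    · rw [h.bag_eq b hbn]; exact R.nodup b hbn
    · rw [h.bagOf_leaf (by omega) hb]; exact List.nodup_singleton _
  · by_cases hbn : b ≤ s.n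
    · rw [h.bag_eq b hbn] at hg; exact R.sub b hbn g hg
    · rw [h.bagOf_leaf (by omega) hb, List.mem_singleton] at hg
      subst hg
      exact (Finset.mem_filter.mp (h.leaf b (by omega) hb).1).1
  · rw [h.bag_eq _ le_rfl, R.bag_root]
  · exact ⟨_, (h.leaf b h1 h2).1, h.bagOf_leaf h1 h2⟩
  · obtain ⟨x, h1, h2, rfl⟩ := h.exists_leaf v hv
    exact ⟨x, h1, h2, h.bagOf_leaf h1 h2⟩
  · rw [h.bagOf_leaf h1 h2] at h5
    rw [h.bagOf_leaf h3 h4] at h6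
    refine h.unique b h1 h2 b' h3 h4 ?_
    simp only [List.cons.injEq, and_true] at h5 h6
    rw [h5, h6]
  · obtain ⟨b, hb, h1, h2⟩ := R.wire i g hw
    exact ⟨b, hb, by rw [h.bag_eq b hb.le]; exact ⟨h1, h2⟩⟩
  · obtain ⟨b, hb, h1⟩ := R.gate g hg
    exact ⟨b, hb, by rwa [h.bag_eq b hb.le]⟩
  · -- a leaf has its gate in common with its parent
    have hlow : ∀ z < s.nn, g ∈ bagOf s.inp s.st s.sz z → ∃ z' ≤ s.n, g ∈ bag z' ∧ (z ∈ X ↔ z' ∈ X) := by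
      intro z hz hgz
      by_cases hzn : z ≤ s.n
      · exact ⟨z, hzn, by rwa [← h.bag_eq z hzn], Iff.rfl⟩
      · have h1 := hgz
        rw [h.bagOf_leaf (by omega) hz, List.mem_singleton] at h1
        obtain ⟨_, _, h3, h4, _⟩ := h.leaf z (by omega) hz
        rw [← h1] at h4
        exact ⟨_, h3.le, h4, hX z hz hgz (by rwa [h.bag_eq _ h3.le])⟩
    obtain ⟨x', h1, h2, h3⟩ := hlow x hxn hgx
    obtain ⟨y', h4, h5, h6⟩ := hlow y hy hgy
    refine h6.mpr (R.conn g X (fun z hz hgz hgp => ?_) x' (h3.mp hx) h1 h2 y' h4 h5)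
    have := hX z (by have := h.nn; omega) (by rwa [h.bag_eq z hz])
      (by rw [h.par_eq z hz, h.bag_eq _ (R.par_le z hz)]; exact hgp)
    rwa [h.par_eq z hz] at this

theorem Seeds.setting (h : Seeds C M fr₀ bag par (C.vars : Set ℕ) L s) (hM : 1 ≤ M) :
    Setting C M s := by
  refine ⟨h.normalDec, fun b hb => ?_, fun b hb => ?_, h.va, h.sa, h.vb, h.sb, h.out, h.sk, h.vars⟩
  · by_cases hbn : b ≤ s.n
    · exact h.card b hbn
    · rw [(h.leaf b (by omega) hb).2.1]; exact hM
  · by_cases hbn : b ≤ s.n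
    · exact (h.node b hbn).2.1
    · obtain ⟨_, h1, _, _, _, h2, _⟩ := h.leaf b (by omega) hb
      rw [h1, h2]; rfl

theorem Seeds.forest (h : Seeds C M fr₀ bag par (C.vars : Set ℕ) L s) :
    Forest C s.n s.nn (bagOf s.inp s.st s.sz) s.par ∅ L
      (fun b => if b ≤ s.n then none else some (.leaf (s.inp (s.st b)))) s := by
  have hc : ∀ b, {x | Cluster s.par ∅ b x} = {b} := fun b => by ext x; exact cluster_empty
  refine ⟨h.good, h.str.mono fun _ h => h.elim, h.rep, h.var, fun b hb _ => ?_, fun b hb _ => ?_,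
    fun b hb _ u => ?_, fun b hb _ => ?_, h.zero, fun b hb _ σ hσ => ?_⟩
  · by_cases hbn : b ≤ s.n
    · rw [if_pos hbn]; exact (h.node b hbn).2.2.1
    · rw [if_neg hbn]; exact (h.leaf b (by omega) hb).2.2.2.2.2.2.1
  · by_cases hbn : b ≤ s.n <;> simp [hbn, VTree.leaves, BinTree.leaves]
  · simp only [cluster_empty]
    by_cases hbn : b ≤ s.n
    · simp only [hbn, if_true, VTree.leaves, List.not_mem_nil, false_iff]
      rintro ⟨x, h1, h2, rfl, _⟩
      omega
    · simp only [hbn, if_false, VTree.leaves, BinTree.leaves, List.mem_singleton]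
      constructor
      · rintro rfl
        exact ⟨b, by omega, hb, rfl, h.bagOf_leaf (by omega) hb⟩
      · rintro ⟨x, h1, h2, rfl, h3⟩
        rw [h.bagOf_leaf h1 h2, List.cons.injEq] at h3
        exact h3.1.symm
  · rw [bagOf_length]
    by_cases hbn : b ≤ s.n
    · exact (h.node b hbn).1
    · obtain ⟨_, h1, _, _, h2, _⟩ := h.leaf b (by omega) hb
      rw [h1]; exact h2
  · rw [hc]
    have hσ' := hσ
    rw [bagOf_length] at hσ
    by_cases hbn : b ≤ s.n
    · simp only [hbn, if_true]
      refine ((h.node b hbn).2.2.2 σ hσ).congr fun ν => ?_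
      rw [holds_singleton hbn hσ', h.bag_eq b hbn]
    · simp only [hbn, if_false]
      obtain ⟨h0, h1, _, _, _, _, _, h2⟩ := h.leaf b (by omega) hb
      rw [h1] at hσ
      refine (h2 σ hσ).congr fun ν => ?_
      rw [holds_leaf (by omega) (Finset.mem_filter.mp h0).2 (h.bagOf_leaf (by omega) hb)]

theorem Seeds.nn_le (h : Seeds C M fr₀ bag par (C.vars : Set ℕ) L s) :
    s.nn ≤ s.n + 1 + C.vars.card := by
  have : (Finset.Ico (s.n + 1) s.nn).card ≤ C.vars.card := by
    refine Finset.card_le_card_of_injOn (fun x => s.inp (s.st x)) (fun x hx => ?_) fun x hx y hy => ?_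
    · obtain ⟨h1, h2⟩ := Finset.mem_Ico.mp hx
      exact (h.leaf x h1 h2).1
    · obtain ⟨h1, h2⟩ := Finset.mem_Ico.mp hx
      obtain ⟨h3, h4⟩ := Finset.mem_Ico.mp hy
      exact h.unique x h1 h2 y h3 h4
  rw [Nat.card_Ico] at this
  omega

end

/-! ### Sorting the nodes -/

open Classical in
/-- The situation when the parents of the first `i` nodes of the queue have been considered: `cnt`
counts the other children, and the queue has the nodes without other children. -/
structure SortInv (nn : ℕ) (par : ℕ → ℕ) (i : ℕ) (q : ℕ → ℕ) (qt : ℕ) (cnt : ℕ → ℕ) : Prop where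
  le : i ≤ qt
  inj : ∀ j < qt, ∀ k < qt, q j = q k → j = k
  count : ∀ b, cnt b = ((Finset.range nn).filter fun y => par y = b ∧ ∀ j < i, q j ≠ y).card
  mem : ∀ b, (∃ j < qt, q j = b) ↔ b < nn ∧ cnt b = 0
  child : ∀ k < qt, ∀ y < nn, par y = q k → ∃ j < k, j < i ∧ q j = y

section

variable {n nn : ℕ} {par q cnt : ℕ → ℕ} {i qt : ℕ}

open Classical in
/-- Processing one node of the queue: the count of its parent drops by one, and the parent enters the
queue if the count becomes zero. -/
theorem SortInv.next (h : SortInv nn par i q qt cnt) (hi : i < qt) (hp : ∀ b < nn, par b < nn) :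
    SortInv nn par (i + 1) (Function.update q qt (par (q i)))
      (sel (cnt (par (q i)) - 1) 1 (qt + 1) qt)
      (Function.update cnt (par (q i)) (cnt (par (q i)) - 1)) := by
  obtain ⟨c, hc⟩ : ∃ c, q i = c := ⟨_, rfl⟩
  obtain ⟨p, hpc⟩ : ∃ p, par c = p := ⟨_, rfl⟩
  rw [hc, hpc]
  have hcn : c < nn := ((h.mem c).mp ⟨i, hi, hc⟩).1
  have hq : ∀ j < qt, Function.update q qt p j = q j := fun j hj => Function.update_of_ne hj.ne _ _
  have hlast : ∀ y, (∀ j < i + 1, Function.update q qt p j ≠ y) ↔ (∀ j < i, q j ≠ y) ∧ c ≠ y := by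
    intro y
    constructor
    · exact fun hy => ⟨fun j hj => by rw [← hq j (by omega)]; exact hy j (by omega),
        by rw [← hc, ← hq i hi]; exact hy i (by omega)⟩
    · rintro ⟨h1, h2⟩ j hj
      rw [hq j (by omega)]
      rcases Nat.lt_succ_iff_lt_or_eq.mp hj with hj | rfl
      exacts [h1 j hj, hc ▸ h2]
  have hnew : ∀ b, Function.update cnt p (cnt p - 1) b =
      ((Finset.range nn).filter fun y => par y = b ∧ ∀ j < i + 1, Function.update q qt p j ≠ y).card := by
    intro b
    simp only [hlast]
    by_cases hb : b = p
    · subst hb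
      rw [Function.update_self, h.count]
      have hmem : c ∈ (Finset.range nn).filter fun y => par y = b ∧ ∀ j < i, q j ≠ y :=
        Finset.mem_filter.mpr ⟨Finset.mem_range.mpr hcn, hpc, fun j hj hh => by
          have := h.inj j (by omega) i hi (hh.trans hc.symm); omega⟩
      rw [← Finset.card_erase_of_mem hmem]
      congr 1
      ext y
      simp only [Finset.mem_erase, Finset.mem_filter]
      constructor
      · rintro ⟨h1, h2, h3, h4⟩; exact ⟨h2, h3, h4, Ne.symm h1⟩
      · rintro ⟨h2, h3, h4, h1⟩; exact ⟨Ne.symm h1, h2, h3, h4⟩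
    · rw [Function.update_of_ne hb, h.count]
      congr 1
      ext y
      simp only [Finset.mem_filter]
      refine and_congr_right fun _ => and_congr_right fun hy => (and_iff_left ?_).symm
      rintro rfl
      exact hb (hy.symm.trans hpc)
  have hcp : 1 ≤ cnt p := by
    rw [h.count]
    refine Finset.card_pos.mpr ⟨c, Finset.mem_filter.mpr ⟨Finset.mem_range.mpr hcn, hpc, fun j hj hh => ?_⟩⟩
    have := h.inj j (by omega) i hi (hh.trans hc.symm)
    omega
  have hpQ : ∀ j < qt, q j ≠ p := fun j hj hh => by
    have := ((h.mem p).mp ⟨j, hj, hh⟩).2; omega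
  by_cases h0 : cnt p - 1 < 1
  · simp only [sel, h0, if_true]
    have hself : Function.update q qt p qt = p := Function.update_self _ _ _
    refine ⟨by omega, fun j hj k hk hjk => ?_, hnew, fun b => ?_, fun k hk y hy hpy => ?_⟩
    · rcases Nat.lt_succ_iff_lt_or_eq.mp hj with hj | rfl <;>
      rcases Nat.lt_succ_iff_lt_or_eq.mp hk with hk | rfl
      · rw [hq j hj, hq k hk] at hjk; exact h.inj j hj k hk hjk
      · rw [hq j hj, hself] at hjk; exact absurd hjk (hpQ j hj)
      · rw [hq k hk, hself] at hjk; exact absurd hjk.symm (hpQ k hk)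
      · rfl
    · by_cases hb : b = p
      · subst hb
        rw [Function.update_self]
        exact iff_of_true ⟨qt, Nat.lt_succ_self _, hself⟩ ⟨hpc ▸ hp c hcn, by omega⟩
      · rw [Function.update_of_ne hb, ← h.mem]
        constructor
        · rintro ⟨j, hj, hjb⟩
          rcases Nat.lt_succ_iff_lt_or_eq.mp hj with hj | rfl
          · exact ⟨j, hj, by rwa [hq j hj] at hjb⟩
          · exact absurd (hjb.symm.trans hself) hb
        · rintro ⟨j, hj, hjb⟩
          exact ⟨j, by omega, by rwa [hq j hj]⟩
    · rcases Nat.lt_succ_iff_lt_or_eq.mp hk with hk | rfl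
      · rw [hq k hk] at hpy
        obtain ⟨j, h1, h2, h3⟩ := h.child k hk y hy hpy
        exact ⟨j, h1, by omega, by rwa [hq j (by omega)]⟩
      · rw [hself] at hpy
        have h1 := hnew p
        rw [Function.update_self, show cnt p - 1 = 0 by omega] at h1
        have h2 := Finset.card_eq_zero.mp h1.symm
        have h3 : y ∉ (Finset.range nn).filter
            fun y => par y = p ∧ ∀ j < i + 1, Function.update q k p j ≠ y := by rw [h2]; simp
        simp only [Finset.mem_filter, Finset.mem_range, hy, hpy, true_and, not_forall, not_not] at h3
        obtain ⟨j, hj, h3⟩ := h3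
        exact ⟨j, by omega, hj, h3⟩
  · simp only [sel, h0, if_false]
    refine ⟨hi, fun j hj k hk hjk => ?_, hnew, fun b => ?_, fun k hk y hy hpy => ?_⟩
    · rw [hq j hj, hq k hk] at hjk; exact h.inj j hj k hk hjk
    · have h1 : (∃ j < qt, Function.update q qt p j = b) ↔ ∃ j < qt, q j = b :=
        exists_congr fun j => and_congr_right fun hj => by rw [hq j hj]
      rw [h1]
      by_cases hb : b = p
      · subst hb
        rw [Function.update_self]
        exact iff_of_false (fun ⟨j, hj, hh⟩ => hpQ j hj hh) (by omega)
      · rw [Function.update_of_ne hb]; exact h.mem b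
    · rw [hq k hk] at hpy
      obtain ⟨j, h1, h2, h3⟩ := h.child k hk y hy hpy
      exact ⟨j, h1, by omega, by rwa [hq j (by omega)]⟩

theorem SortInv.ne_root (h : SortInv nn par i q qt cnt) (hn : n < nn) (hr : par n = n) {k : ℕ}
    (hk : k < qt) : q k ≠ n := fun hh => by
  obtain ⟨j, h1, _, h2⟩ := h.child k hk n hn (hr.trans hh.symm)
  have := h.inj j (by omega) k hk (h2.trans hh.symm)
  omega

/-- While there are other nodes than the root left, a deepest one of them is in the queue. -/
theorem SortInv.lt (h : SortInv nn par i q qt cnt) (hn : n < nn) (hr : par n = n)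
    (hp : ∀ b < nn, ∃ j, par^[j] b = n) (hi : i < nn - 1) : i < qt := by
  classical
  by_contra hqt
  have hiq : i = qt := le_antisymm h.le (not_lt.mp hqt)
  set R := ((Finset.range nn).erase n) \ (Finset.range i).image q with hR
  have hne : R.Nonempty := by
    rw [← Finset.card_pos, hR]
    have h1 := Finset.le_card_sdiff ((Finset.range i).image q) ((Finset.range nn).erase n)
    have h2 : ((Finset.range i).image q).card ≤ i := Finset.card_image_le.trans (by simp)
    rw [Finset.card_erase_of_mem (Finset.mem_range.mpr hn), Finset.card_range] at h1
    omega
  have hmemR : ∀ y, y ∈ R ↔ (y ≠ n ∧ y < nn) ∧ ∀ j < i, q j ≠ y := by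
    intro y
    simp [hR]
  obtain ⟨y, hy, hmax⟩ := Finset.exists_max_image R (fun y => sInf {j | par^[j] y = n}) hne
  obtain ⟨⟨hyn, hylt⟩, hyq⟩ := (hmemR y).mp hy
  have hcy : cnt y ≠ 0 := fun h0 => by
    obtain ⟨j, hj, hh⟩ := (h.mem y).mpr ⟨hylt, h0⟩
    exact hyq j (by omega) hh
  rw [h.count] at hcy
  obtain ⟨z, hz⟩ := Finset.card_pos.mp (Nat.pos_of_ne_zero hcy)
  obtain ⟨hz1, hz2, hz3⟩ := Finset.mem_filter.mp hz
  rw [Finset.mem_range] at hz1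
  have hzn : z ≠ n := by
    rintro rfl
    exact hyn (hz2.symm.trans hr)
  have hzR : z ∈ R := (hmemR z).mpr ⟨⟨hzn, hz1⟩, hz3⟩
  have h1 := hmax z hzR
  have h2 : sInf {j | par^[j] z = n} ∈ {j | par^[j] z = n} := Nat.sInf_mem (hp z hz1)
  obtain ⟨d, hd⟩ : ∃ d, sInf {j | par^[j] z = n} = d := ⟨_, rfl⟩
  rw [hd] at h1 h2
  cases d with
  | zero => exact hzn h2
  | succ d =>
    have h3 : sInf {j | par^[j] y = n} ≤ d := Nat.sInf_le (by
      have : par^[d + 1] z = n := h2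
      rw [Function.iterate_succ_apply, hz2] at this
      exact this)
    omega

/-- When as many nodes as there are nodes besides the root have been processed, the queue lists them
all, children first. -/
theorem SortInv.isOrder (h : SortInv nn par (nn - 1) q qt cnt) (hn : n < nn) (hr : par n = n) :
    IsOrder n nn par q := by
  have hle := h.le
  refine ⟨fun i hi => ((h.mem (q i)).mp ⟨i, by omega, rfl⟩).1, fun i hi => h.ne_root hn hr (by omega),
    fun i hi j hj hij => h.inj i (by omega) j (by omega) hij, fun b hb hbn => ?_,
    fun i hi y hy hpy => ?_⟩
  · have himg : (Finset.range (nn - 1)).image q = (Finset.range nn).erase n := by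
      refine Finset.eq_of_subset_of_card_le (fun x hx => ?_) ?_
      · obtain ⟨i, hi, rfl⟩ := Finset.mem_image.mp hx
        rw [Finset.mem_range] at hi
        exact Finset.mem_erase.mpr ⟨h.ne_root hn hr (by omega),
          Finset.mem_range.mpr ((h.mem (q i)).mp ⟨i, by omega, rfl⟩).1⟩
      · rw [Finset.card_erase_of_mem (Finset.mem_range.mpr hn), Finset.card_range,
          Finset.card_image_of_injOn, Finset.card_range]
        intro i hi j hj hij
        simp only [Finset.coe_range, Set.mem_Iio] at hi hj
        exact h.inj i (by omega) j (by omega) hij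
    have hb' : b ∈ (Finset.range (nn - 1)).image q := by
      rw [himg]; exact Finset.mem_erase.mpr ⟨hbn, Finset.mem_range.mpr hb⟩
    obtain ⟨i, hi, hib⟩ := Finset.mem_image.mp hb'
    exact ⟨i, Finset.mem_range.mp hi, hib⟩
  · obtain ⟨j, h1, _, h2⟩ := h.child i (by omega) y hy hpy
    exact ⟨j, h1, h2⟩

end

open Classical in
theorem sortNodes_spec (s : S) (hn : s.n < s.nn) (hr : s.par s.n = s.n)
    (hlt : ∀ b < s.nn, s.par b < s.nn) (hp : ∀ b < s.nn, ∃ j, s.par^[j] b = s.n)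
    (hc : s.cnt = fun _ => 0) (hq : s.qt = 0) :
    Spec sortNodes s (s.nn * 80 + 20) fun s' => ∃ i p qt, ∃ q cnt : ℕ → ℕ,
      s' = { s with i := i, p := p, qt := qt, q := q, cnt := cnt } ∧ IsOrder s.n s.nn s.par q := by
  unfold sortNodes
  refine Spec.mono (Spec.seq (t₁ := 2) (t₂ := (s.nn * (17 + 3) + 2) + (2 + ((s.nn * (17 + 3) + 2) +
      (2 + ((s.nn - 1) * (30 + 3) + 3 + 1)))))
    (R := fun s' => s' = { s with i := 0 }) (.straight rfl (by decide) rfl) ?_) (fun _ h => h) (by omega)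
  rintro _ rfl
  refine Spec.seq (R := fun s' => ∃ cnt : ℕ → ℕ, s' = { s with i := s.nn, cnt := cnt } ∧
      ∀ b, cnt b = ((Finset.range s.nn).filter fun y => s.par y = b).card) ?_ ?_
  · refine .rep (fun i s' => ∃ cnt : ℕ → ℕ, s' = { s with i := i, cnt := cnt } ∧
      ∀ b, cnt b = ((Finset.range i).filter fun y => s.par y = b).card) s.nn rfl ?_ ?_ (fun _ h => h)
    · exact ⟨_, rfl, fun b => by rw [hc]; simp⟩
    · rintro i hi _ ⟨cnt, rfl, h⟩
      refine .straight rfl (by decide) ⟨_, rfl, fun b => ?_⟩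
      show Function.update cnt (s.par i) (cnt (s.par i) + 1) b = _
      rw [Finset.range_add_one, Finset.filter_insert]
      by_cases hb : s.par i = b
      · subst hb
        rw [Function.update_self, if_pos rfl, Finset.card_insert_of_notMem (by simp), h]
      · rw [if_neg hb, Function.update_of_ne (Ne.symm hb), h]
  rintro _ ⟨cnt, rfl, hcnt⟩
  refine Spec.seq (R := fun s' => s' = { s with i := 0, cnt := cnt })
    (.straight rfl (by decide) rfl) ?_
  rintro _ rfl
  refine Spec.seq (R := fun s' => ∃ qt, ∃ q : ℕ → ℕ,
      s' = { s with i := s.nn, cnt := cnt, qt := qt, q := q } ∧ SortInv s.nn s.par 0 q qt cnt) ?_ ?_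
  · refine .rep (fun i s' => ∃ qt, ∃ q : ℕ → ℕ,
      s' = { s with i := i, cnt := cnt, qt := qt, q := q } ∧
      (∀ j < qt, ∀ k < qt, q j = q k → j = k) ∧ ∀ b, (∃ j < qt, q j = b) ↔ b < i ∧ cnt b = 0)
      s.nn rfl ?_ ?_ ?_
    · exact ⟨_, _, rfl, by simp [hq], by simp [hq]⟩
    · rintro i hi _ ⟨qt, q, rfl, h1, h2⟩
      refine .straight rfl (by decide) ⟨_, _, rfl, ?_⟩
      show (∀ j < sel (cnt i) 1 (qt + 1) qt, ∀ k < sel (cnt i) 1 (qt + 1) qt,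
          Function.update q qt i j = Function.update q qt i k → j = k) ∧
        ∀ b, (∃ j < sel (cnt i) 1 (qt + 1) qt, Function.update q qt i j = b) ↔ b < i + 1 ∧ cnt b = 0
      have hqq : ∀ j < qt, Function.update q qt i j = q j := fun j hj => Function.update_of_ne hj.ne _ _
      have hself : Function.update q qt i qt = i := Function.update_self _ _ _
      have hiQ : ∀ j < qt, q j ≠ i := fun j hj hh => by
        have := ((h2 i).mp ⟨j, hj, hh⟩).1; omega
      by_cases h0 : cnt i < 1
      · simp only [sel, h0, if_true]
        refine ⟨fun j hj k hk hjk => ?_, fun b => ⟨?_, ?_⟩⟩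
        · rcases Nat.lt_succ_iff_lt_or_eq.mp hj with hj | rfl <;>
          rcases Nat.lt_succ_iff_lt_or_eq.mp hk with hk | rfl
          · rw [hqq j hj, hqq k hk] at hjk; exact h1 j hj k hk hjk
          · rw [hqq j hj, hself] at hjk; exact absurd hjk (hiQ j hj)
          · rw [hqq k hk, hself] at hjk; exact absurd hjk.symm (hiQ k hk)
          · rfl
        · rintro ⟨j, hj, rfl⟩
          rcases Nat.lt_succ_iff_lt_or_eq.mp hj with hj | rfl
          · rw [hqq j hj]
            have := (h2 _).mp ⟨j, hj, rfl⟩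
            exact ⟨by omega, this.2⟩
          · rw [hself]; omega
        · rintro ⟨h3, h4⟩
          rcases Nat.lt_succ_iff_lt_or_eq.mp h3 with h3 | rfl
          · obtain ⟨j, hj, h5⟩ := (h2 b).mpr ⟨h3, h4⟩
            exact ⟨j, by omega, by rwa [hqq j hj]⟩
          · exact ⟨qt, by omega, hself⟩
      · simp only [sel, h0, if_false]
        refine ⟨fun j hj k hk hjk => ?_, fun b => ⟨?_, ?_⟩⟩
        · rw [hqq j hj, hqq k hk] at hjk; exact h1 j hj k hk hjk
        · rintro ⟨j, hj, rfl⟩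
          rw [hqq j hj]
          have := (h2 _).mp ⟨j, hj, rfl⟩
          exact ⟨by omega, this.2⟩
        · rintro ⟨h3, h4⟩
          have : b ≠ i := by rintro rfl; omega
          obtain ⟨j, hj, h5⟩ := (h2 b).mpr ⟨by omega, h4⟩
          exact ⟨j, by omega, by rwa [hqq j hj]⟩
    · rintro _ ⟨qt, q, rfl, h1, h2⟩
      refine ⟨_, _, rfl, Nat.zero_le _, h1, fun b => ?_, h2, fun k hk y hy hpy => ?_⟩
      · rw [hcnt]; simp
      · have h3 := ((h2 _).mp ⟨k, hk, rfl⟩).2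
        rw [hcnt, Finset.card_eq_zero] at h3
        have h4 : y ∈ (Finset.range s.nn).filter fun z => s.par z = q k :=
          Finset.mem_filter.mpr ⟨Finset.mem_range.mpr hy, hpy⟩
        rw [h3] at h4
        simp at h4
  rintro _ ⟨qt, q, rfl, hS⟩
  refine Spec.seq (R := fun s' => s' = { s with i := 0, cnt := cnt, qt := qt, q := q })
    (.straight rfl (by decide) rfl) ?_
  rintro _ rfl
  refine .rep (fun i s' => ∃ p qt, ∃ q cnt : ℕ → ℕ,
      s' = { s with i := i, p := p, qt := qt, q := q, cnt := cnt } ∧ SortInv s.nn s.par i q qt cnt)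
    (s.nn - 1) rfl ⟨_, _, _, _, rfl, hS⟩ ?_ ?_
  · rintro i hi _ ⟨p, qt, q, cnt, rfl, h⟩
    refine .straight rfl (by decide) ?_
    simp only [queueNext, Cmd.den, Expr.eval, Expr.eval_add, Expr.eval_sub, Expr.eval_ofNat, S.get, S.set,
      S.getA, S.setA]
    refine ⟨_, _, _, _, rfl, ?_⟩
    have := h.next (h.lt hn hr hp hi) hlt
    simpa only [Function.update_self] using this
  · rintro _ ⟨p, qt, q, cnt, rfl, h⟩
    exact ⟨_, _, _, _, _, rfl, h.isOrder hn hr⟩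

/-- All is prepared for merging the nodes. -/
theorem sortNodes_stage {C : Circuit} {M fr₀ : ℕ} {bag : ℕ → List ℕ} {par : ℕ → ℕ} {L : Net} {s : S}
    (h : Seeds C M fr₀ bag par (C.vars : Set ℕ) L s) (hM : 1 ≤ M) :
    Spec sortNodes s (s.nn * 80 + 20) fun s' => Stage C M 0 { s' with i := 0 } ∧ s'.nn = s.nn := by
  have E := h.normalDec
  have St := h.setting hM
  obtain ⟨V, F⟩ : ∃ V, Forest C s.n s.nn (bagOf s.inp s.st s.sz) s.par ∅ L V s := ⟨_, h.forest⟩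
  refine (sortNodes_spec s E.lt E.par_root E.par_lt E.reach h.cnt h.qt).mono ?_ le_rfl
  rintro _ ⟨i, p, qt, q, cnt, rfl, O⟩
  refine ⟨⟨⟨E, St.card, St.pw4, St.va, St.sa, St.vb, St.sb, St.out, St.sk, St.vars⟩, O, rfl, L, V, ?_⟩, rfl⟩
  show Forest C s.n s.nn (bagOf s.inp s.st s.sz) s.par {x | ∃ j < 0, q j = x} L V _
  have : {x | ∃ j < 0, q j = x} = ∅ := by ext x; simp
  rw [this]
  exact ⟨F.good, F.str, F.rep, F.vars, F.tree, F.nodup, F.leaves, F.le, F.zero, F.table⟩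

/-! ### Reading the input -/

/-- The array contains the list `l` from the index `pos` on, followed by zeros. -/
def At (A : ℕ → ℕ) (pos : ℕ) (l : List ℕ) : Prop := ∀ i, A (pos + i) = l.getD i 0

section

variable {A : ℕ → ℕ} {pos : ℕ} {l r : List ℕ}

theorem At.cons {a : ℕ} (h : At A pos (a :: l)) : A pos = a ∧ At A (pos + 1) l :=
  ⟨h 0, fun i => by rw [add_assoc, add_comm 1]; exact h (i + 1)⟩

theorem At.append (h : At A pos (l ++ r)) : pre (fun j => A (pos + j)) l.length = l ∧ At A (pos + l.length) r := by
  constructor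
  · refine List.ext_getElem (pre_length _ _) fun i h1 h2 => ?_
    rw [getElem_pre, h i, List.getD_append _ _ _ _ h2, List.getD_eq_getElem _ _ h2]
  · intro i
    rw [add_assoc, h, List.getD_append_right _ _ _ _ (by omega)]
    congr 1; omega

end

section

variable (s : S) {rest : List ℕ}

theorem readGates_loop_spec {gs : List ℕ} {f : ℕ → ℕ} (hgs : gs.Nodup)
    (h : At s.inp s.pos (gs.flatMap (fun g => [g, f g]) ++ rest)) (hn : s.nG = gs.length) (hi : s.i = 0)
    (ho : s.o = 0) :
    Spec (.rep (.v .nG) readGate) s (gs.length * 60 + 5) fun s' =>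
      ∃ g fr o pos, ∃ kd ix off : ℕ → ℕ,
      s' = { s with
        g := g, fr := fr, o := o, pos := pos, kd := kd, ix := ix, off := off, i := gs.length } ∧
      At s.inp pos rest ∧ ∀ k (hk : k < gs.length), kd gs[k] = f gs[k] ∧ ix gs[k] = k ∧
        off gs[k] = k * gs.length ∧ gs[k] < fr := by
  refine Spec.mono (Spec.rep (t := 50) (fun i s' => ∃ g fr pos, ∃ kd ix off : ℕ → ℕ,
      s' = { s with
        g := g, fr := fr, o := i * gs.length, pos := pos, kd := kd, ix := ix, off := off, i := i } ∧
      At s.inp pos ((gs.drop i).flatMap (fun g => [g, f g]) ++ rest) ∧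
      ∀ k (hk : k < gs.length), k < i → kd gs[k] = f gs[k] ∧ ix gs[k] = k ∧
        off gs[k] = k * gs.length ∧ gs[k] < fr) gs.length hn ?_ ?_ ?_) (fun _ h => h)
      (by show gs.length * 53 + 1 + 1 ≤ _; omega)
  · refine ⟨s.g, s.fr, s.pos, s.kd, s.ix, s.off, ?_, h, fun k _ hk => by omega⟩
    rw [zero_mul]
    have h3 : ∀ a b, s.i = a → s.o = b → s = { s with i := a, o := b } := by
      rintro _ _ rfl rfl; rfl
    exact h3 _ _ hi ho
  · rintro i hi _ ⟨g, fr, pos, kd, ix, off, rfl, h1, h2⟩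
    refine .straight rfl (by decide) ?_
    simp only [readGate, Cmd.den, Expr.eval, Expr.eval_add, Expr.eval_sub, Expr.eval_ofNat, S.get, S.set,
      S.getA, S.setA]
    rw [List.drop_eq_getElem_cons hi] at h1
    obtain ⟨e1, h3⟩ := At.cons h1
    obtain ⟨e2, h3⟩ := h3.cons
    rw [hn, ← Nat.succ_mul]
    refine ⟨_, _, _, _, _, _, rfl, h3, fun k hk hki => ?_⟩
    simp only [e1, e2]
    rcases Nat.lt_succ_iff_lt_or_eq.mp hki with hki | rfl
    · have : gs[k] ≠ gs[i] := fun hh => by have := (hgs.getElem_inj_iff).mp hh; omega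
      simp only [Function.update_of_ne this]
      obtain ⟨h4, h5, h6, h7⟩ := h2 k hk hki
      exact ⟨h4, h5, h6, by omega⟩
    · simp only [Function.update_self, true_and]
      omega
  · rintro _ ⟨g, fr, pos, kd, ix, off, rfl, h1, h2⟩
    rw [List.drop_length] at h1
    exact ⟨_, _, _, _, _, _, _, rfl, h1, fun k hk => h2 k hk hk⟩

theorem readWires_loop_spec {ws : List (ℕ × ℕ)}
    (h : At s.inp s.pos (ws.flatMap (fun w => [w.1, w.2]) ++ rest)) (hn : s.nW = ws.length)
    (hw : s.wm = fun _ => 0) :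
    Spec (.rep (.v .nW) readWire) s (ws.length * 60 + 5) fun s' => ∃ pos, ∃ wm : ℕ → ℕ,
      s' = { s with pos := pos, wm := wm } ∧
      At s.inp pos rest ∧ ∀ a, 0 < wm a ↔ ∃ w ∈ ws, s.off w.1 + s.ix w.2 = a := by
  refine Spec.mono (Spec.rep (t := 50) (fun i s' => ∃ pos, ∃ wm : ℕ → ℕ,
      s' = { s with pos := pos, wm := wm } ∧
      At s.inp pos ((ws.drop i).flatMap (fun w => [w.1, w.2]) ++ rest) ∧
      ∀ a, 0 < wm a ↔ ∃ w ∈ ws.take i, s.off w.1 + s.ix w.2 = a) ws.length hn ?_ ?_ ?_) (fun _ h => h)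
      (by show ws.length * 53 + 1 + 1 ≤ _; omega)
  · exact ⟨_, _, rfl, h, fun a => by simp [hw]⟩
  · rintro i hi _ ⟨pos, wm, rfl, h1, h2⟩
    refine .straight rfl (by decide) ?_
    simp only [readWire, Cmd.den, Expr.eval, Expr.eval_add, Expr.eval_sub, Expr.eval_ofNat, S.get, S.set,
      S.getA, S.setA]
    rw [List.drop_eq_getElem_cons hi] at h1
    obtain ⟨e1, h3⟩ := At.cons h1
    obtain ⟨e2, h3⟩ := h3.cons
    refine ⟨_, _, rfl, h3, fun a => ?_⟩
    rw [List.take_add_one, List.getElem?_eq_getElem hi]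
    simp only [e1, e2, List.mem_append, Option.toList_some, List.mem_singleton, or_and_right,
      exists_or, exists_eq_left, ← h2 a]
    by_cases ha : a = s.off ws[i].1 + s.ix ws[i].2
    · subst ha; simp
    · simp [Function.update_of_ne ha, Ne.symm ha]
  · rintro _ ⟨pos, wm, rfl, h1, h2⟩
    rw [List.drop_length] at h1
    rw [List.take_length] at h2
    exact ⟨_, _, rfl, h1, h2⟩

theorem readParents_loop_spec {ps : List ℕ} (h : At s.inp s.pos (ps ++ rest)) (hn : s.n = ps.length)
    (hi : s.i = 0) :
    Spec (.rep (.v .n) readParent) s (ps.length * 60 + 5) fun s' => ∃ pos, ∃ par : ℕ → ℕ,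
      s' = { s with pos := pos, par := par, i := ps.length } ∧
      At s.inp pos rest ∧ ∀ k (hk : k < ps.length), par k = ps[k] := by
  refine Spec.mono (Spec.rep (t := 50) (fun i s' => ∃ pos, ∃ par : ℕ → ℕ,
      s' = { s with pos := pos, par := par, i := i } ∧
      At s.inp pos (ps.drop i ++ rest) ∧ ∀ k (hk : k < ps.length), k < i → par k = ps[k])
      ps.length hn ?_ ?_ ?_) (fun _ h => h) (by show ps.length * 53 + 1 + 1 ≤ _; omega)
  · refine ⟨s.pos, s.par, ?_, h, fun k _ hk => by omega⟩
    rw [← hi]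
  · rintro i hi _ ⟨pos, par, rfl, h1, h2⟩
    refine .straight rfl (by decide) ?_
    simp only [readParent, Cmd.den, Expr.eval, Expr.eval_add, Expr.eval_sub, Expr.eval_ofNat, S.get, S.set,
      S.getA, S.setA]
    rw [List.drop_eq_getElem_cons hi] at h1
    obtain ⟨e1, h3⟩ := At.cons h1
    refine ⟨_, _, rfl, h3, fun k hk hki => ?_⟩
    simp only [e1]
    rcases Nat.lt_succ_iff_lt_or_eq.mp hki with hki | rfl
    · rw [Function.update_of_ne hki.ne]; exact h2 k hk hki
    · rw [Function.update_self]
  · rintro _ ⟨pos, par, rfl, h1, h2⟩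
    rw [List.drop_length] at h1
    exact ⟨_, _, rfl, h1, fun k hk => h2 k hk hk⟩

theorem readBags_loop_spec {bs : List (List ℕ)} (h : At s.inp s.pos (bs.flatMap (fun b => b.length :: b)))
    (hn : s.n = bs.length) (hi : s.i = 0) (hsz : s.sz = fun _ => 0) :
    Spec (.rep (.v .n) readBag) s (bs.length * 60 + 5) fun s' => ∃ pos, ∃ sz st : ℕ → ℕ,
      s' = { s with pos := pos, sz := sz, st := st, i := bs.length } ∧
      (∀ k (hk : k < bs.length), bagOf s.inp st sz k = bs[k]) ∧ ∀ k, bs.length ≤ k → sz k = 0 := by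
  refine Spec.mono (Spec.rep (t := 50) (fun i s' => ∃ pos, ∃ sz st : ℕ → ℕ,
      s' = { s with pos := pos, sz := sz, st := st, i := i } ∧
      At s.inp pos ((bs.drop i).flatMap (fun b => b.length :: b)) ∧
      (∀ k (hk : k < bs.length), k < i → bagOf s.inp st sz k = bs[k]) ∧ ∀ k, i ≤ k → sz k = 0)
      bs.length hn ?_ ?_ ?_) (fun _ h => h) (by show bs.length * 53 + 1 + 1 ≤ _; omega)
  · refine ⟨s.pos, s.sz, s.st, ?_, h, fun k _ hk => by omega, fun k _ => by rw [hsz]⟩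
    rw [← hi]
  · rintro i hi _ ⟨pos, sz, st, rfl, h1, h2, h4⟩
    refine .straight rfl (by decide) ?_
    simp only [readBag, Cmd.den, Expr.eval, Expr.eval_add, Expr.eval_sub, Expr.eval_ofNat, S.get, S.set,
      S.getA, S.setA]
    rw [List.drop_eq_getElem_cons hi] at h1
    obtain ⟨e1, h3⟩ := At.cons h1
    obtain ⟨e2, h3⟩ := h3.append
    refine ⟨_, _, _, rfl, ?_, fun k hk hki => ?_, fun k hk => ?_⟩
    · rw [e1]; exact h3
    · simp only [e1]
      rcases Nat.lt_succ_iff_lt_or_eq.mp hki with hki | rfl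
      · rw [← h2 k hk hki]
        simp only [bagOf, Function.update_of_ne hki.ne]
      · simp only [bagOf, Function.update_self, e2]
    · rw [Function.update_of_ne (by omega)]
      exact h4 k (by omega)
  · rintro _ ⟨pos, sz, st, rfl, h1, h2, h3⟩
    exact ⟨_, _, _, rfl, fun k hk => h2 k hk hk, h3⟩

end

section

variable {C : Circuit} (T : TreeDecomposition C)

/-- The parents, with a new root above the given one. -/
def TreeDecomposition.par (b : ℕ) : ℕ :=
  if h : b < T.size then if b = T.root then T.size else T.parent ⟨b, h⟩ else T.size

/-- The bags as lists, with an empty bag of the new root. -/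
def TreeDecomposition.bagList (bags : Fin T.size → List ℕ) (b : ℕ) : List ℕ :=
  if h : b < T.size then bags ⟨b, h⟩ else []

/-- The given tree with the new node as its root, whose bag is empty. -/
theorem TreeDecomposition.rawDec {bags : Fin T.size → List ℕ}
    (hb : ∀ b, (bags b).Nodup ∧ (bags b).toFinset = T.bag b) :
    RawDec C T.size (T.bagList bags) T.par := by
  have hmem : ∀ b g, g ∈ bags b ↔ g ∈ T.bag b := fun b g => by rw [← (hb b).2, List.mem_toFinset]
  have hbag : ∀ b : Fin T.size, T.bagList bags b = bags b := fun b => by simp [bagList]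
  have hin : ∀ b g, g ∈ T.bagList bags b → ∃ h : b < T.size, g ∈ T.bag ⟨b, h⟩ := by
    intro b g hg
    unfold bagList at hg
    split_ifs at hg with h
    · exact ⟨h, (hmem _ _).mp hg⟩
    · simp at hg
  have hout : ∀ (b : Fin T.size) g, g ∈ T.bag b → g ∈ T.bagList bags b := fun b g hg => by
    rw [hbag, hmem]; exact hg
  have hroot : T.par T.size = T.size := by simp [par]
  have hpar : ∀ b : Fin T.size, b ≠ T.root → T.par b = T.parent b := fun b hbr => by
    have : (b : ℕ) ≠ T.root := fun h => hbr (Fin.ext h)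
    simp [par, this]
  refine ⟨fun b hb => ?_, hroot, fun b hbs => ?_, fun b hbs => ?_, fun b hbs g hg => ?_, by simp [bagList],
    fun h g hw => ?_, fun g hg => ?_, fun g X hX x hx hxs hgx y hys hgy => ?_⟩
  · unfold par; split_ifs
    · exact le_rfl
    · exact (T.parent _).2.le
    · exact le_rfl
  · have key : ∀ j (b : Fin T.size), T.parent^[j] b = T.root → ∃ j, T.par^[j] b = T.size := by
      intro j
      induction j with
      | zero =>
        intro b hb
        exact ⟨1, by rw [show b = T.root from hb]; simp [par]⟩
      | succ j ih =>
        intro b hb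
        by_cases hbr : b = T.root
        · exact ⟨1, by rw [hbr]; simp [par]⟩
        · obtain ⟨i, hi⟩ := ih (T.parent b) hb
          exact ⟨i + 1, by rw [Function.iterate_succ_apply, hpar b hbr, hi]⟩
    rcases hbs.lt_or_eq with hbs | rfl
    · obtain ⟨j, hj⟩ := T.reaches_root ⟨b, hbs⟩
      exact key j _ hj
    · exact ⟨0, rfl⟩
  · unfold bagList; split_ifs
    · exact (hb _).1
    · exact List.nodup_nil
  · obtain ⟨h, hg⟩ := hin b g hg
    exact T.bag_subset _ hg
  · obtain ⟨b, h1, h2⟩ := T.edge_covered h g hw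
    exact ⟨b, b.2, hout _ _ h1, hout _ _ h2⟩
  · obtain ⟨⟨b, hgb⟩⟩ := (T.connected g hg).nonempty
    exact ⟨b, b.2, hout _ _ hgb⟩
  · obtain ⟨hx', hgx'⟩ := hin x g hgx
    obtain ⟨hy', hgy'⟩ := hin y g hgy
    have hstep : ∀ a b : Fin T.size, g ∈ T.bag a → g ∈ T.bag b → a ≠ b → T.parent a = b →
        ((a : ℕ) ∈ X ↔ (b : ℕ) ∈ X) := by
      intro a b ha hb hab hp
      have har : a ≠ T.root := by
        rintro rfl
        exact hab (T.parent_root.symm.trans hp)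
      have := hX a a.2.le (hout _ _ ha) (by rw [hpar a har, hp]; exact hout _ _ hb)
      rwa [hpar a har, hp] at this
    obtain ⟨w⟩ := (T.connected g (T.bag_subset _ hgx')).preconnected ⟨⟨x, hx'⟩, hgx'⟩ ⟨⟨y, hy'⟩, hgy'⟩
    have key : ∀ u v : {b | g ∈ T.bag b}, ((SimpleGraph.fromRel (fun b b' => T.parent b = b')).induce
        {b | g ∈ T.bag b}).Walk u v → ((u.1 : ℕ) ∈ X → (v.1 : ℕ) ∈ X) := by
      intro u v w
      induction w with
      | nil => exact id
      | @cons u v _ huv _ ih =>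
        intro hu
        refine ih ?_
        have h1 := huv
        rw [SimpleGraph.comap_adj, SimpleGraph.fromRel_adj] at h1
        obtain ⟨h1, h2 | h2⟩ := h1
        · exact (hstep _ _ u.2 v.2 h1 h2).mp hu
        · exact (hstep _ _ v.2 u.2 h1.symm h2).mpr hu
    exact key _ _ w hx

/-- The maximal size of a bag. -/
def TreeDecomposition.maxCard : ℕ := Finset.univ.sup fun b => (T.bag b).card

theorem TreeDecomposition.card_le_maxCard (b : Fin T.size) : (T.bag b).card ≤ T.maxCard :=
  Finset.le_sup (f := fun b => (T.bag b).card) (Finset.mem_univ b)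

theorem TreeDecomposition.maxCard_eq : T.maxCard = T.width + 1 := by
  obtain ⟨⟨b, hb⟩⟩ := (T.connected _ C.output_mem).nonempty
  have h1 : 1 ≤ T.maxCard := (Finset.card_pos.mpr ⟨_, hb⟩).trans_le (T.card_le_maxCard b)
  rw [TreeDecomposition.width]
  rw [maxCard] at *
  omega

theorem TreeDecomposition.card_gates_le : C.gates.card ≤ T.size * T.maxCard := by
  have h1 : C.gates ⊆ Finset.univ.biUnion T.bag := fun g hg => by
    obtain ⟨⟨b, hb⟩⟩ := (T.connected g hg).nonempty
    exact Finset.mem_biUnion.mpr ⟨b, Finset.mem_univ _, hb⟩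
  refine (Finset.card_le_card h1).trans ((Finset.card_biUnion_le_card_mul _ _ _ fun b _ =>
    T.card_le_maxCard b).trans ?_)
  simp

theorem TreeDecomposition.card_wires_le : C.wires.card ≤ T.size * (T.maxCard * T.maxCard) := by
  have h1 : C.wires ⊆ Finset.univ.biUnion fun b => T.bag b ×ˢ T.bag b := fun w hw => by
    obtain ⟨b, h1, h2⟩ := T.edge_covered w.1 w.2 hw
    exact Finset.mem_biUnion.mpr ⟨b, Finset.mem_univ _, Finset.mem_product.mpr ⟨h1, h2⟩⟩
  refine (Finset.card_le_card h1).trans ((Finset.card_biUnion_le_card_mul _ _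
    (T.maxCard * T.maxCard) fun b _ => ?_).trans (le_of_eq ?_))
  · rw [Finset.card_product]
    exact Nat.mul_le_mul (T.card_le_maxCard b) (T.card_le_maxCard b)
  · simp

/-- The matrix index of a pair of positions determines the pair. -/
theorem index_inj {n a b c d : ℕ} (hb : b < n) (hd : d < n) (h : a * n + b = c * n + d) :
    a = c ∧ b = d := by
  have h1 : (a * n + b) % n = (c * n + d) % n := by rw [h]
  rw [Nat.mul_add_mod', Nat.mul_add_mod', Nat.mod_eq_of_lt hb, Nat.mod_eq_of_lt hd] at h1
  subst h1
  exact ⟨Nat.eq_of_mul_eq_mul_right (by omega) (Nat.add_right_cancel h), rfl⟩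

theorem readInput_spec {lC lT : List ℕ} (hC : C.RepresentedBy lC) (hT : T.RepresentedBy lT) :
    ∃ bag, Spec readInput (S.initial (lC ++ lT))
      (60 * (C.gates.card + C.wires.card + T.size + T.size) + 100) fun s' =>
        InputOk C T.maxCard bag T.par s' ∧ s'.n = T.size ∧ s'.nG = C.gates.card := by
  obtain ⟨gs, ws, hgn, hg, hwn, hw, hlC⟩ := hC
  obtain ⟨bags, hb, hlT⟩ := hT
  have hgc : C.gates.card = gs.length := by rw [← hg, List.toFinset_card_of_nodup hgn]
  have hwc : C.wires.card = ws.length := by rw [← hw, List.toFinset_card_of_nodup hwn]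
  have hmg : ∀ g, g ∈ C.gates ↔ g ∈ gs := fun g => by rw [← hg, List.mem_toFinset]
  refine ⟨T.bagList bags, ?_⟩
  set s := S.initial (lC ++ lT) with hs
  have h0 : At s.inp 0 (lC ++ lT) := fun i => by rw [zero_add]; rfl
  set ps := (List.finRange T.size).map fun b => (T.parent b).val with hps
  set bs := (List.finRange T.size).map bags with hbs
  have hbs' : ((List.finRange T.size).flatMap fun b => (bags b).length :: bags b) =
      bs.flatMap fun b => b.length :: b := by rw [hbs, List.flatMap_map]
  have hpl : ps.length = T.size := by simp [hps]
  have hbl : bs.length = T.size := by simp [hbs]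
  rw [hlC, hlT, hbs'] at h0
  simp only [List.cons_append, List.nil_append, List.append_assoc] at h0
  obtain ⟨e1, h0⟩ := h0.cons
  obtain ⟨e2, h0⟩ := h0.cons
  obtain ⟨e3, h0⟩ := h0.cons
  unfold readInput
  refine Spec.mono (Spec.seq (t₁ := 20) (t₂ := (gs.length * 60 + 5) + ((ws.length * 60 + 5) +
    (15 + ((ps.length * 60 + 5) + (15 + (bs.length * 60 + 5))))))
    (R := fun s' => s' = { s with
      nG := gs.length, nW := ws.length, oG := C.output, pos := 3, fr := 1 })
    (.straight rfl (by decide) (by rw [← e1, ← e2, ← e3]; rfl)) ?_) (fun _ h => h) (by omega)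
  rintro _ rfl
  refine Spec.seq (readGates_loop_spec _ hgn h0 rfl rfl rfl) ?_
  rintro _ ⟨g, fr, o, pos, kd, ix, off, rfl, h1, hgates⟩
  refine Spec.seq (readWires_loop_spec _ h1 rfl rfl) ?_
  rintro _ ⟨pos, wm, rfl, h1, hwires⟩
  obtain ⟨e4, h1⟩ := h1.cons
  obtain ⟨e5, h1⟩ := h1.cons
  have e4 : s.inp pos = T.size := e4
  have e5 : s.inp (pos + 1) = T.root := e5
  refine Spec.seq (R := fun s' => s' = { s with
      nG := gs.length, nW := ws.length, oG := C.output, fr := fr, g := g, o := o, kd := kd, ix := ix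
      off := off, wm := wm, n := T.size, rt := T.root, pos := pos + 2, i := 0 })
    (.straight rfl (by decide) ?_) ?_
  · simp only [readTree, Cmd.den, Expr.eval, Expr.eval_add, Expr.eval_sub, Expr.eval_ofNat, S.get, S.set,
    S.getA, S.setA]
    simp only [e4, e5]
  rintro _ rfl
  refine Spec.seq (readParents_loop_spec _ h1 hpl.symm rfl) ?_
  rintro _ ⟨pos, par, rfl, h1, hpar⟩
  refine Spec.seq (R := fun s' => s' = { s with
      nG := gs.length, nW := ws.length, oG := C.output, fr := fr, g := g, o := o, kd := kd, ix := ix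
      off := off, wm := wm, n := T.size, rt := T.root, pos := pos, i := 0
      par := Function.update (Function.update par T.root T.size) T.size T.size })
    (.straight rfl (by decide) rfl) ?_
  rintro _ rfl
  refine Spec.mono (readBags_loop_spec _ h1 hbl.symm rfl rfl) ?_ le_rfl
  rintro _ ⟨pos, sz, st, rfl, hbag, hsz⟩
  have hget : ∀ g ∈ C.gates, ∃ k, ∃ hk : k < gs.length, gs[k] = g := fun g hg =>
    List.getElem_of_mem ((hmg g).mp hg)
  have hbag' : ∀ b ≤ T.size, bagOf s.inp st sz b = T.bagList bags b := by
    intro b hb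
    rcases hb.lt_or_eq with hb | rfl
    · have := hbag b (hbl.symm ▸ hb)
      rw [TreeDecomposition.bagList, dif_pos hb, show bags ⟨b, hb⟩ = bs[b]'(hbl.symm ▸ hb) by simp [hbs]]
      exact this
    · simp [TreeDecomposition.bagList, bagOf, hsz T.size hbl.le, pre]
  refine ⟨⟨⟨T.rawDec hb, hbag', fun b hb => ?_, fun b hb' => ?_, fun g hg => ?_, rfl, rfl, rfl, rfl, rfl,
    rfl, rfl, rfl, ?_⟩, fun g hg => ?_, fun h hh g hg => ?_, rfl, rfl, rfl, rfl, rfl, rfl⟩, rfl, hgc.symm⟩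
  · rcases (show b ≤ T.size from hb).lt_or_eq with hb | rfl
    · show Function.update (Function.update par T.root T.size) T.size T.size b = T.par b
      rw [Function.update_of_ne hb.ne, TreeDecomposition.par, dif_pos hb]
      by_cases hbr : b = T.root
      · rw [if_pos hbr, hbr, Function.update_self]
      · rw [if_neg hbr, Function.update_of_ne hbr, hpar b (hpl.symm ▸ hb)]
        simp [hps]
    · show Function.update (Function.update par T.root T.size) T.size T.size T.size = _
      rw [Function.update_self]
      simp [TreeDecomposition.par]
  · show sz b ≤ T.maxCard
    have h2 := hbag' b hb'
    rw [← bagOf_length s.inp st sz b, h2, TreeDecomposition.bagList]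
    split_ifs with h
    · rw [← List.toFinset_card_of_nodup (hb _).1, (hb _).2]
      exact T.card_le_maxCard _
    · exact Nat.zero_le _
  · obtain ⟨k, hk, rfl⟩ := hget g hg
    exact (hgates k hk).1
  · show C.vars.card ≤ gs.length
    rw [← hgc]; exact Finset.card_filter_le _ _
  · obtain ⟨k, hk, rfl⟩ := hget g hg
    exact (hgates k hk).2.2.2
  · show 0 < wm (off h + ix g) ↔ C.Wire h g
    have hwires' : 0 < wm (off h + ix g) ↔ ∃ w ∈ ws, off w.1 + ix w.2 = off h + ix g :=
      hwires (off h + ix g)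
    rw [hwires', Circuit.Wire, ← hw, List.mem_toFinset]
    refine ⟨?_, fun hm => ⟨_, hm, rfl⟩⟩
    rintro ⟨w, hm, he⟩
    have hwC : (w.1, w.2) ∈ C.wires := by rw [← hw, List.mem_toFinset]; exact hm
    obtain ⟨h3, h4⟩ := C.wires_mem _ _ hwC
    obtain ⟨k₁, hk₁, e₁⟩ := hget _ h3
    obtain ⟨k₂, hk₂, e₂⟩ := hget _ h4
    obtain ⟨k₃, hk₃, e₃⟩ := hget _ hh
    obtain ⟨k₄, hk₄, e₄⟩ := hget _ hg
    rw [← e₁, ← e₂, ← e₃, ← e₄, (hgates k₁ hk₁).2.2.1, (hgates k₂ hk₂).2.1, (hgates k₃ hk₃).2.2.1,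
      (hgates k₄ hk₄).2.1] at he
    obtain ⟨rfl, rfl⟩ := index_inj hk₂ hk₄ he
    rw [← e₃, ← e₄, e₁, e₂]
    exact hm

end

/-! ### Writing the output -/

namespace Cmd

/-- Every assignment to the register `x` increases it by at most two. -/
def slow (x : Var) : Cmd → Bool
  | set y e => decide (y ≠ x) || match e with
    | .add (.v z) (.c k) => decide (z = x) && decide (k ≤ 2)
    | _ => false
  | seq a b => slow x a && slow x b
  | ite _ _ a b => slow x a && slow x b
  | rep _ a => slow x a
  | _ => true

/-- The running time bounds the growth of a register that only grows slowly. -/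
theorem get_den_le {x : Var} (a : Cmd) (h : a.slow x = true) (s : S) :
    (a.den s).get x ≤ s.get x + a.cost s := by
  induction a generalizing s with
  | skip => exact Nat.le_add_right _ _
  | sto a e₁ e₂ => rw [den, S.get_setA]; exact Nat.le_add_right _ _
  | wr e => cases x <;> exact Nat.le_add_right _ _
  | set y e =>
    by_cases hy : x = y
    · subst hy
      rw [den, S.get_set_self]
      simp only [slow, ne_eq, not_true_eq_false, decide_false, Bool.false_or] at h
      split at h
      · simp only [Bool.and_eq_true, decide_eq_true_eq] at h
        rw [h.1]
        simp only [Expr.eval, cost, Expr.cost]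
        omega
      · simp at h
    · rw [den, S.get_set_of_ne _ _ hy]
      exact Nat.le_add_right _ _
  | seq a b iha ihb =>
    simp only [slow, Bool.and_eq_true] at h
    have h1 := iha h.1 s
    have h2 := ihb h.2 (a.den s)
    simp only [den, cost]
    omega
  | ite e₁ e₂ a b iha ihb =>
    simp only [slow, Bool.and_eq_true] at h
    have h1 := iha h.1 s
    have h2 := ihb h.2 s
    simp only [den, cost, sel]
    split_ifs <;> omega
  | rep e a ih =>
    have key : ∀ n, ((den a)^[n] s).get x ≤
        s.get x + ∑ k ∈ Finset.range n, (cost a ((den a)^[k] s) + 3) := by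
      intro n
      induction n with
      | zero => simp
      | succ n ihn =>
        rw [Function.iterate_succ_apply', Finset.sum_range_succ]
        have := ih h ((den a)^[n] s)
        omega
    have := key (e.eval s)
    simp only [den, cost]
    omega

end Cmd

/-- The stack holds trees with the given roots, the first of the list on top. -/
def StackRep (R : ℕ → BinTree → Prop) (stk : ℕ → ℕ) : ℕ → List BinTree → Prop
  | 0, [] => True
  | k + 1, t :: ts => R (stk k) t ∧ StackRep R stk k ts
  | _, _ => False

theorem StackRep.update {R : ℕ → BinTree → Prop} {stk : ℕ → ℕ} {k i a : ℕ} {ts : List BinTree}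
    (h : StackRep R stk k ts) (hi : k ≤ i) : StackRep R (Function.update stk i a) k ts := by
  induction ts generalizing k with
  | nil => cases k <;> exact h
  | cons t ts ih =>
    cases k with
    | zero => exact h
    | succ k => exact ⟨by rw [Function.update_of_ne (by omega)]; exact h.1, ih h.2 (by omega)⟩

/-- The number of nodes of the trees in a list. -/
def nodeCount (ts : List BinTree) : ℕ := (ts.map fun t => t.subtrees.length).sum

theorem TreeRep.nodeCount {vl vr : ℕ → ℕ} {nv a : ℕ} {t : BinTree} (h : TreeRep vl vr nv a t) :
    t.subtrees.length + 1 = 2 * t.leaves.length := by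
  induction t generalizing a with
  | leaf u => rfl
  | one t => exact h.elim
  | two l r ihl ihr =>
    have h1 := ihl h.2.2.1
    have h2 := ihr h.2.2.2
    simp only [BinTree.subtrees, BinTree.leaves, List.length_cons, List.length_append]
    omega

/-- One step outputs the root of the tree on top of the stack and puts the children in its place, the
left one on top, so that the traversal is in preorder. -/
theorem writeNode_spec (s : S) {ts : List BinTree}
    (h : StackRep (TreeRep s.vl s.vr s.nv) s.stk s.sk ts) :
    Spec writeNode s 60 fun s' => ∃ sk a, ∃ stk : ℕ → ℕ, ∃ out ts',
      s' = { s with sk := sk, a := a, stk := stk, out := out } ∧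
      StackRep (TreeRep s.vl s.vr s.nv) stk sk ts' ∧
      out ++ ts'.flatMap BinTree.code = s.out ++ ts.flatMap BinTree.code ∧
      nodeCount ts' = nodeCount ts - 1 := by
  refine .straight rfl (by decide) ?_
  simp only [writeNode, Cmd.den, Expr.eval, Expr.eval_add, Expr.eval_sub, Expr.eval_ofNat, S.get, S.set,
    S.getA, S.setA]
  rcases hk : s.sk with _ | k <;> rw [hk] at h <;> rcases ts with _ | ⟨t, ts⟩
  · exact ⟨s.sk, s.a, s.stk, s.out, [], by simp only [sel, lt_irrefl, if_false], by rw [hk]; trivial, rfl, rfl⟩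
  · exact h.elim
  · exact h.elim
  obtain ⟨h1, h2⟩ := h
  cases t with
  | one t => exact h1.elim
  | leaf u =>
    obtain ⟨h3, h4, h5⟩ := h1
    simp only [sel, Nat.succ_pos, if_true, Nat.add_sub_cancel, h4, h5, lt_irrefl, if_false]
    refine ⟨_, _, _, _, ts, rfl, h2, by simp [BinTree.code], ?_⟩
    simp [nodeCount, BinTree.subtrees]
  | two l r =>
    obtain ⟨h3, h4, h5, h6⟩ := h1
    simp only [sel, Nat.succ_pos, if_true, Nat.add_sub_cancel, h4]
    refine ⟨_, _, _, _, l :: r :: ts, rfl, ⟨?_, ?_, ?_⟩, by simp [BinTree.code], ?_⟩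
    · rw [Function.update_self]; exact h5
    · rw [Function.update_of_ne (by omega), Function.update_self]; exact h6
    · exact (h2.update le_rfl).update (by omega)
    · simp only [nodeCount, BinTree.subtrees, List.map_cons, List.sum_cons, List.length_cons,
        List.length_append]
      omega

theorem writeTree_spec (s : S) {V : VTree} (h : VTreeRep s.vl s.vr s.nv s.a V) (hsk : s.sk = 0)
    (hV : V.leaves.length ≤ s.nG) :
    Spec (startStack ;; .rep (.v .nG + .v .nG) writeNode) s (s.nG * 126 + 20)
      fun s' => s'.out = s.out ++ V.code := by
  refine Spec.mono (Spec.seq (t₁ := 12) (t₂ := (s.nG + s.nG) * (60 + 3) + 3 + 1)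
    (R := fun s' => ∃ sk, ∃ stk : ℕ → ℕ, ∃ out ts,
      s' = { s with sk := sk, stk := stk, out := out } ∧
      StackRep (TreeRep s.vl s.vr s.nv) stk sk ts ∧
      out ++ ts.flatMap BinTree.code = s.out ++ V.code ∧ nodeCount ts ≤ s.nG + s.nG)
    (.straight rfl (by decide) ?_) ?_) (fun _ h => h) (by omega)
  · simp only [startStack, Cmd.den, Expr.eval, Expr.eval_add, Expr.eval_sub, Expr.eval_ofNat, S.get, S.set,
    S.getA, S.setA]
    cases V with
    | none =>
      have ha : s.a = 0 := h
      refine ⟨s.sk, s.stk, s.out ++ [0], [], ?_, by rw [hsk]; trivial, by simp [VTree.code],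
        Nat.zero_le _⟩
      simp only [sel, ha, lt_irrefl, if_false]
    | some t =>
      have ht : TreeRep s.vl s.vr s.nv s.a t := h
      simp only [sel, ht.pos.1, if_true]
      refine ⟨_, _, _, [t], rfl, ⟨by rw [Function.update_self]; exact ht, trivial⟩, ?_, ?_⟩
      · simp [VTree.code]
      · have h1 := ht.nodeCount
        have h2 : t.leaves.length ≤ s.nG := hV
        simp only [nodeCount, List.map_cons, List.map_nil, List.sum_cons, List.sum_nil]
        omega
  · rintro _ ⟨sk, stk, out, ts, rfl, h1, h2, h3⟩
    refine .rep (fun i s' => ∃ sk a, ∃ stk : ℕ → ℕ, ∃ out ts,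
      s' = { s with sk := sk, a := a, stk := stk, out := out } ∧
      StackRep (TreeRep s.vl s.vr s.nv) stk sk ts ∧
      out ++ ts.flatMap BinTree.code = s.out ++ V.code ∧ nodeCount ts ≤ s.nG + s.nG - i)
      (s.nG + s.nG) rfl ⟨_, _, _, _, ts, rfl, h1, h2, h3⟩ ?_ ?_
    · rintro i hi _ ⟨sk, a, stk, out, ts, rfl, h1, h2, h3⟩
      refine Spec.mono (writeNode_spec _ h1) ?_ le_rfl
      rintro _ ⟨sk, a, stk, out, ts', rfl, h4, h5, h6⟩
      exact ⟨_, _, _, _, ts', rfl, h4, h5.trans h2, by omega⟩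
    · rintro _ ⟨sk, a, stk, out, ts, rfl, h1, h2, h3⟩
      have h4 : ts = [] := by
        cases ts with
        | nil => rfl
        | cons t ts =>
          have : t.subtrees ≠ [] := List.ne_nil_of_mem t.self_mem_subtrees
          have := List.length_pos_iff.mpr this
          simp only [nodeCount, List.map_cons, List.sum_cons] at h3
          omega
      subst h4
      simpa using h2

theorem writeGates_loop_spec (s : S) (hi : s.i = 0) :
    Spec (.rep (.v .gl) writeGates) s (s.gl * 10 + 2) fun s' => ∃ i,
      s' = { s with i := i, out := s.out ++ pre s.go s.gl } := by
  refine Spec.mono (Spec.rep (t := 7) (fun k s' => s' = { s with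
      i := k, out := s.out ++ pre s.go k }) s.gl rfl ?_ ?_ ?_) (fun _ h => h) (by rfl)
  · have : ∀ a, s.i = a → s = { s with i := a, out := s.out ++ [] } := by
      rintro _ rfl; rw [List.append_nil]
    exact this _ hi
  · rintro k hk _ rfl
    refine .straight rfl (by decide) ?_
    simp only [writeGates, Cmd.den, Expr.eval, Expr.eval_add, Expr.eval_sub, Expr.eval_ofNat, S.get, S.set,
      S.getA, S.setA]
    rw [pre_succ, List.append_assoc]
  · rintro _ rfl; exact ⟨_, rfl⟩

theorem writeWires_loop_spec (s : S) (hj : s.j = 0) :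
    Spec (.rep (.v .wl) writeWires) s (s.wl * 10 + 2) fun s' => ∃ j,
      s' = { s with j := j, out := s.out ++ pre s.wo s.wl } := by
  refine Spec.mono (Spec.rep (t := 7) (fun k s' => s' = { s with
      j := k, out := s.out ++ pre s.wo k }) s.wl rfl ?_ ?_ ?_) (fun _ h => h) (by rfl)
  · have : ∀ a, s.j = a → s = { s with j := a, out := s.out ++ [] } := by
      rintro _ rfl; rw [List.append_nil]
    exact this _ hj
  · rintro k hk _ rfl
    refine .straight rfl (by decide) ?_
    simp only [writeWires, Cmd.den, Expr.eval, Expr.eval_add, Expr.eval_sub, Expr.eval_ofNat, S.get, S.set,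
      S.getA, S.setA]
    rw [pre_succ, List.append_assoc]
  · rintro _ rfl; exact ⟨_, rfl⟩

/-- If no gate computes the output, then an OR-gate without inputs is added for it. -/
theorem finish_spec (s : S) {L : Net} {T : BinTree → Prop} {V : VTree} {P : (ℕ → Bool) → Prop}
    (hg : L.Good s.fr) (hs : L.Structured T) (hr : NetRep L s.gl s.wl s.go s.wo)
    (hP : L.Repr V P (s.tab (s.tb s.n))) :
    Spec finish s 70 fun s' => ∃ e z fr gl, ∃ go : ℕ → ℕ, ∃ L' : Net,
      s' = { s with
        e := e, z := z, fr := fr, gl := gl, go := go, i := 0, j := 0, a := s.vt s.n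
        out := s.out ++ [gl / 2, s.wl / 2, e - 1] } ∧
      gl ≤ s.gl + 2 ∧ L'.Ok ∧ L'.Structured T ∧ NetRep L' gl s.wl go s.wo ∧
      (∀ u, (∃ f ∈ L', f.name = u ∧ f.kind = .var) ↔ ∃ f ∈ L, f.name = u ∧ f.kind = .var) ∧
      e - 1 ∈ L'.names ∧ ∀ ν, L'.ev ν (e - 1) = true ↔ P ν := by
  refine .straight rfl (by decide) ?_
  simp only [finish, newGate, useName, Cmd.den, Expr.eval, Expr.eval_add, Expr.eval_sub, Expr.eval_ofNat, S.get, S.set,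
    S.getA, S.setA]
  generalize he : s.tab (s.tb s.n) = e at *
  rcases Nat.eq_zero_or_pos e with rfl | hpos
  · have hL : Net.Good (⟨s.fr, .or, []⟩ :: L) (s.fr + 1) :=
      hg.cons ⟨hg.not_mem, by simp, by simp, by simp, by simp, by simp, by simp⟩ rfl
    simp only [sel, lt_irrefl, if_false]
    refine ⟨s.fr + 1, s.fr, s.fr + 1, s.gl + 2,
      Function.update (Function.update s.go s.gl s.fr) (s.gl + 1) GateKind.or.code,
      ⟨s.fr, .or, []⟩ :: L, ?_, le_rfl, hL.ok, hs.cons hL.ok (by simp), hr.cons₀ s.fr .or,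
      fun u => ?_, ?_, fun ν => ?_⟩
    · simp only [List.append_assoc]; rfl
    · simp
    · simp [Net.names]
    · simp [Net.ev, hP.zero rfl ν]
  · simp only [sel, hpos, if_true]
    refine ⟨e, s.z, s.fr, s.gl, s.go, L, ?_, Nat.le_add_right _ _, hg.ok, hs, hr, fun _ => Iff.rfl,
      hP.mem hpos, hP.ev hpos⟩
    simp only [List.append_assoc]; rfl

/-- After all merges only the part of the sink is left, which is the whole tree. So its v-tree has all
variables as leaves, and the gate of its state computes the function of the circuit. -/
theorem Stage.output {C : Circuit} {M : ℕ} {s : S} (h : Stage C M (s.nn - 1) s) :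
    Spec output s ((s.gl + s.wl) * 10 + s.nG * 126 + 150) fun s' => ∃ (D : Circuit) (V : VTree) (lD : List ℕ),
      D.RepresentedBy lD ∧ s'.out = lD ++ V.code ∧ D.IsDSDNNF ∧ V.Structures D ∧ D.Equivalent C := by
  obtain ⟨St, O, -, L, V, F⟩ := h
  have E := St.dec
  generalize hbag : bagOf s.inp s.st s.sz = bag at *
  set D : Set ℕ := {x | ∃ j < s.nn - 1, s.q j = x} with hD
  have hnD : s.n ∉ D := by
    rintro ⟨j, hj, h⟩; exact O.ne j hj h
  have hmem : ∀ x < s.nn, x ≠ s.n → x ∈ D := fun x hx hxn => O.all x hx hxn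
  have hcl : ∀ x < s.nn, Cluster s.par D s.n x := fun x hx => by
    obtain ⟨j, hj⟩ := E.reach x hx
    exact cluster_of_reach E.par_lt hmem hx hj
  have hclu : {x | Cluster s.par D s.n x} = {x | x < s.nn} := by
    ext x
    refine ⟨fun h => h.lt E.lt ?_, hcl x⟩
    rintro _ ⟨j, hj, rfl⟩; exact O.lt j hj
  have hlv : ∀ u, u ∈ (V s.n).leaves ↔ u ∈ C.vars := fun u => by
    rw [F.leaves s.n E.lt hnD]
    constructor
    · rintro ⟨x, h1, h2, -, h3⟩
      obtain ⟨v, hv, h4⟩ := E.leaf x h1 h2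
      have : v = u := by simpa [h3] using h4.symm
      exact this ▸ hv
    · intro hu
      obtain ⟨x, h1, h2, h3⟩ := E.exists_leaf u hu
      exact ⟨x, h1, h2, hcl x h2, h3⟩
  have hnd := F.nodup s.n E.lt hnD
  have hlen : (V s.n).leaves.length ≤ s.nG := by
    rw [← List.toFinset_card_of_nodup hnd, show (V s.n).leaves.toFinset = C.vars from
      Finset.ext fun u => by rw [List.mem_toFinset, hlv]]
    exact St.vars
  have hstr : L.Structured (· ∈ (V s.n).subtrees) := F.str.mono fun t ⟨b, hb, hbD, ht⟩ => by
    have : b = s.n := by by_contra hbn; exact hbD (hmem b hb hbn)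
    exact this ▸ ht
  have htab : L.Repr (V s.n) (fun ν => C.eval ν C.output = true) (s.tab (s.tb s.n)) := by
    have h0 := F.table s.n E.lt hnD 0 (by positivity)
    rw [hclu] at h0
    exact h0.congr fun ν => holds_root E ν
  unfold KC.output
  refine Spec.mono (Spec.seq (finish_spec s F.good hstr F.rep htab)
    (t₂ := ((s.gl + 2) * 10 + 2) + ((s.wl * 10 + 2) + (s.nG * 126 + 20))) ?_) (fun _ h => h) (by omega)
  rintro _ ⟨e, z, fr, gl, go, L', rfl, hgl, hok, hs', hr', hvar, hmem', hev⟩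
  refine Spec.seq (Spec.mono (writeGates_loop_spec _ rfl) (fun _ h => h) (t' := (s.gl + 2) * 10 + 2)
    (by show gl * 10 + 2 ≤ _; omega)) ?_
  rintro _ ⟨i, rfl⟩
  refine Spec.seq (writeWires_loop_spec _ rfl) ?_
  rintro _ ⟨j, rfl⟩
  refine Spec.mono (writeTree_spec _ (V := V s.n) (F.tree s.n E.lt hnD) St.sk hlen) ?_ le_rfl
  intro s' hout
  have hVs : (V s.n).Structures (L'.toCircuit hok _ hmem') :=
    Net.toCircuit_structures hnd (fun u => by rw [hlv, F.vars, hvar]) hs'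
  refine ⟨L'.toCircuit hok _ hmem', V s.n, _, Net.toCircuit_representedBy, ?_,
    Net.toCircuit_isDSDNNF hVs, hVs, ?_, fun ν => ?_⟩
  · rw [hout]
    show s.out ++ [gl / 2, s.wl / 2, e - 1] ++ pre go gl ++ pre s.wo s.wl ++ _ = _
    rw [← hr'.gate, ← hr'.wire, pre_length, pre_length, St.out, List.nil_append]
  · ext u
    rw [Net.mem_toCircuit_vars, hvar, ← F.vars]
  · show Circuit.eval _ ν (e - 1) = _
    rw [Net.toCircuit_eval ν hmem', Bool.eq_iff_iff, hev]

/-! ### The running time -/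

/-- The time for the computation on a tree with `N` nodes and bags of at most `M` gates. -/
def treeTime (N M : ℕ) : ℕ := N * (initTime M + absorbTime M + 203 * M + 146) + 100

theorem translate_spec {C : Circuit} {M : ℕ} {bag : ℕ → List ℕ} {par : ℕ → ℕ} {s : S}
    (I : InputOk C M bag par s) (hM : 1 ≤ M) {N : ℕ} (hN : s.n + 1 + C.vars.card ≤ N) :
    Spec translate s (treeTime N M) fun s' => Stage C M (s'.nn - 1) s' ∧
      s'.gl ≤ treeTime N M ∧ s'.wl ≤ treeTime N M ∧ s'.nG ≤ s.nG + treeTime N M := by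
  have h : Spec translate s (treeTime N M) fun s' => Stage C M (s'.nn - 1) s' := by
    unfold translate
    refine Spec.mono (Spec.seq (Spec.mono (initTables_spec s I) (fun _ h => h)
      (t' := N * (initTime M + 3) + 50) ?_) (t₂ := (N * (M * 203 + 60) + 20) + ((N * 80 + 20) +
      (N * (absorbTime M + 3) + 10))) ?_) (fun _ h => h) ?_
    · gcongr; omega
    · rintro s₁ ⟨⟨L, h1⟩, hn₁⟩
      refine Spec.seq (Spec.mono (addLeaves_spec h1) (fun _ h => h) ?_) ?_
      · rw [hn₁]; gcongr; omega
      rintro s₂ ⟨⟨L, h2⟩, hn₂⟩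
      have hnn : s₂.nn ≤ N := h2.nn_le.trans (by omega)
      refine Spec.seq (Spec.mono (sortNodes_stage h2 hM) (fun _ h => h) (by gcongr)) ?_
      rintro s₃ ⟨h3, hn₃⟩
      exact Spec.mono h3.absorbAll (fun _ h => h.1) (by rw [hn₃]; gcongr)
    · rw [treeTime]; exact le_of_eq (by ring)
  have hgl := Cmd.get_den_le (x := .gl) translate rfl s
  have hwl := Cmd.get_den_le (x := .wl) translate rfl s
  have hnG := Cmd.get_den_le (x := .nG) translate rfl s
  simp only [S.get, I.gl, I.wl, zero_add] at hgl hwl hnG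
  exact ⟨⟨h.1, hgl.trans h.2, hwl.trans h.2, hnG.trans (Nat.add_le_add_left h.2 _)⟩, h.2⟩

theorem treeTime_le {t M N : ℕ} (ht : 1 ≤ t) (hM : 1 ≤ M) (hN : N ≤ t + 1 + t * M) :
    treeTime N M ≤ 6500 * (t * M ^ 3 * 16 ^ M) := by
  have h1 : N ≤ 3 * (t * M) := by nlinarith
  have h2 : (4 : ℕ) ^ M ≤ 16 ^ M := Nat.pow_le_pow_left (by norm_num) M
  have h3 : 1 ≤ (16 : ℕ) ^ M := Nat.one_le_pow _ _ (by norm_num)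
  have h4 : M ≤ M ^ 2 := Nat.le_self_pow (by norm_num) M
  have h5 : 1 ≤ M ^ 2 := Nat.one_le_pow _ _ hM
  have h6 : initTime M + absorbTime M + 203 * M + 146 ≤ 16 ^ M * (2129 * M ^ 2) := by
    rw [initTime, absorbTime]
    calc 4 ^ M * (80 * M * M + 200 * M + 200) + 16 ^ M * (300 * M + 1000) + 203 * M + 146
        ≤ 16 ^ M * (80 * M * M + 200 * M + 200) + 16 ^ M * (300 * M + 1000) +
          16 ^ M * (203 * M + 146) := by
          rw [add_assoc _ (203 * M)]
          gcongr
          exact Nat.le_mul_of_pos_left _ h3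
      _ = 16 ^ M * (80 * M ^ 2 + 703 * M + 1346) := by ring
      _ ≤ 16 ^ M * (2129 * M ^ 2) := by gcongr; omega
  have h7 : 1 ≤ t * M ^ 3 * 16 ^ M :=
    Nat.mul_pos (Nat.mul_pos ht (Nat.pow_pos hM)) h3
  calc treeTime N M ≤ 3 * (t * M) * (16 ^ M * (2129 * M ^ 2)) + 100 := by
        rw [treeTime]; gcongr
    _ = 6387 * (t * M ^ 3 * 16 ^ M) + 100 := by ring
    _ ≤ _ := by omega

theorem mainCmd_spec {C : Circuit} (T : TreeDecomposition C) {lC lT : List ℕ}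
    (hC : C.RepresentedBy lC) (hT : T.RepresentedBy lT) :
    Spec mainCmd (S.initial (lC ++ lT)) (1000000 * (T.size * (T.width + 1) ^ 3 * 16 ^ (T.width + 1)))
      fun s' => ∃ (D : Circuit) (V : VTree) (lD : List ℕ),
        D.RepresentedBy lD ∧ s'.out = lD ++ V.code ∧ D.IsDSDNNF ∧ V.Structures D ∧ D.Equivalent C := by
  obtain ⟨bag, hread⟩ := readInput_spec T hC hT
  have hg := T.card_gates_le
  have hw := T.card_wires_le
  rw [T.maxCard_eq] at hg hw hread
  have ht : 1 ≤ T.size := T.root.pos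
  generalize hM : T.width + 1 = M at *
  have hM1 : 1 ≤ M := by omega
  have hvars : C.vars.card ≤ C.gates.card := Finset.card_filter_le _ _
  set N := T.size + 1 + C.vars.card with hN
  have htime := treeTime_le ht hM1 (N := N) (by omega)
  unfold mainCmd
  refine Spec.mono (Spec.seq hread (t₂ := treeTime N M + ((treeTime N M + treeTime N M) * 10 +
    (C.gates.card + treeTime N M) * 126 + 150)) ?_) (fun _ h => h) ?_
  · rintro s ⟨I, hn, hnG⟩
    refine Spec.seq (translate_spec I hM1 (N := N) (by rw [hn])) ?_
    rintro s' ⟨h1, h2, h3, h4⟩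
    refine Spec.mono h1.output (fun _ h => h) ?_
    rw [hnG] at h4
    gcongr
  · have h1 : T.size * M ≤ T.size * M ^ 3 * 16 ^ M := by
      calc T.size * M = T.size * M ^ 1 * 1 := by ring
        _ ≤ _ := by gcongr <;> first | omega | exact Nat.one_le_pow _ _ (by norm_num)
    have h2 : T.size * (M * M) ≤ T.size * M ^ 3 * 16 ^ M := by
      calc T.size * (M * M) = T.size * M ^ 2 * 1 := by ring
        _ ≤ _ := by gcongr <;> first | omega | exact Nat.one_le_pow _ _ (by norm_num)
    have h3 : T.size ≤ T.size * M := Nat.le_mul_of_pos_right _ hM1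
    omega

/-- The polynomial factor is absorbed by the factor `2 ^ (ε * k)`. -/
theorem exists_time_bound {ε : ℝ} (hε : 0 < ε) : ∃ B : ℝ, ∀ k : ℕ,
    ((k : ℝ) + 1) ^ 3 * 16 ^ (k + 1) ≤ B * (2 : ℝ) ^ ((4 + ε) * (k : ℝ)) := by
  set r : ℝ := 2 ^ ε with hr
  have hr1 : 1 < r := Real.one_lt_rpow (by norm_num) hε
  obtain ⟨B, hB⟩ := (tendsto_pow_const_div_const_pow_of_one_lt 3 hr1).bddAbove_range
  refine ⟨B * r * 16, fun k => ?_⟩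
  have h1 : ((k : ℝ) + 1) ^ 3 ≤ B * r ^ (k + 1) := by
    have := hB ⟨k + 1, rfl⟩
    rw [div_le_iff₀ (by positivity)] at this
    exact_mod_cast this
  have h2 : (2 : ℝ) ^ ((4 + ε) * (k : ℝ)) = 16 ^ k * r ^ k := by
    rw [Real.rpow_mul (by norm_num), Real.rpow_natCast, Real.rpow_add (by norm_num), ← hr, mul_pow]
    norm_num
  rw [h2]
  calc ((k : ℝ) + 1) ^ 3 * 16 ^ (k + 1) ≤ B * r ^ (k + 1) * 16 ^ (k + 1) := by gcongr
    _ = _ := by ring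

end KC

theorem mainTheorem1 :
    ∃ P : KC.Program, ∀ ε : ℝ, 0 < ε → ∃ K : ℝ,
      ∀ (C : KC.Circuit) (T : KC.TreeDecomposition C) (lC lT : List ℕ),
        C.RepresentedBy lC → T.RepresentedBy lT →
        ∃ (t : ℕ) (D : KC.Circuit) (V : KC.VTree) (lD : List ℕ),
          (t : ℝ) ≤ K * (T.size : ℝ) * (2 : ℝ) ^ ((4 + ε) * (T.width : ℝ)) ∧
          D.RepresentedBy lD ∧
          KC.Computes P (lC ++ lT) t (lD ++ V.code) ∧
          D.IsDSDNNF ∧ V.Structures D ∧ D.Equivalent C := by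
  refine ⟨KC.mainCmd.compile 0, fun ε hε => ?_⟩
  obtain ⟨B, hB⟩ := KC.exists_time_bound hε
  refine ⟨1000000 * B, fun C T lC lT hC hT => ?_⟩
  obtain ⟨⟨D, V, lD, h1, h2, h3⟩, ht⟩ := KC.mainCmd_spec T hC hT
  refine ⟨_, D, V, lD, ?_, h1, KC.Spec.computes ⟨h2, ht⟩, h3⟩
  push_cast
  calc (1000000 : ℝ) * (T.size * ((T.width : ℝ) + 1) ^ 3 * 16 ^ (T.width + 1))
      = 1000000 * T.size * (((T.width : ℝ) + 1) ^ 3 * 16 ^ (T.width + 1)) := by ring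
    _ ≤ 1000000 * T.size * (B * (2 : ℝ) ^ ((4 + ε) * (T.width : ℝ))) :=
        mul_le_mul_of_nonneg_left (hB _) (by positivity)
    _ = _ := by ring
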